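/- Let $\Bbbk$ be a field, let $S=\Bbbk[x_1,\dots,x_n]$ with its standard grading, and let $\mathfrak S_n$ act on $S$ by permuting the variables. A partition of length $n$ is a sequence $\lambda=(\lambda_1,\dots,\lambda_n)$ of integers with $0\le\lambda_1\le\cdots\le\lambda_n$; write $|\lambda|=\lambda_1+\cdots+\lambda_n$, $x^\lambda=x_1^{\lambda_1}\cdots x_n^{\lambda_n}$ and $p(\lambda)=\#\{m:\lambda_m<\lambda_n-1\}$. A monomial ideal $I\subset S$ with $\sigma(I)=I$ for all $\sigma\in\mathfrak S_n$ is called a symmetric shifted ideal if, for every partition $\lambda$ with $x^\lambda\in I$ and every $1\le m<n$ with $\lambda_m<\lambda_n$, one has $x^\lambda(x_m/x_n)\in I$. Let $\Lambda(I)$ be the set of partitions $\lambda$ such that $x^\lambda$ is a minimal monomial generator of $I$, and put $$N^\lambda=\bigl(\sigma(x^\lambda):\sigma\in\mathfrak S_n\bigr)\big/\bigl(\sigma(x_jx^\lambda):1\le j\le p(\lambda),\ \sigma\in\mathfrak S_n\bigr).$$ For a graded $S$-module $M$ with a compatible degree-preserving $\mathfrak S_n$-action, $\operatorname{Tor}_i(M,\Bbbk)=\operatorname{Tor}_i^S(M,\Bbbk)$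 carries the induced grading and $\mathfrak S_n$-action; it is the homology of $F_\bullet\otimes_S\Bbbk$ for any $\mathfrak S_n$-equivariant graded free resolution $F_\bullet$ of $M$. **Theorem 5.4.** Let $I\subset S$ be a symmetric shifted ideal and let $i,d\ge 0$. If $n!\ne 0$ in $\Bbbk$ (that is, $\operatorname{char}\Bbbk=0$ or $\operatorname{char}\Bbbk>n$), then, as $\Bbbk[\mathfrak S_n]$-modules, $$\operatorname{Tor}_i(I,\Bbbk)_{i+d}\;\cong\bigoplus_{\lambda\in\Lambda(I),\ |\lambda|=d}\operatorname{Tor}_i(N^\lambda,\Bbbk).$$ Over an arbitrary field $\Bbbk$ the two sides are isomorphic as $\Bbbk$-vector spaces. -/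

import Mathlib

universe u v w

open MvPolynomial DirectSum

noncomputable section

namespace SymShifted

/-! ## Graded modules with a compatible action of the symmetric group

Throughout, `S = k[x_1, …, x_n]` is `MvPolynomial (Fin n) k` with its standard grading, and
`σ ∈ 𝔖_n = Equiv.Perm (Fin n)` acts on `S` by `x_i ↦ x_{σ(i)}`, that is, by `rename σ`. -/

/-- A graded `S`-module `M = ⨁_{j ≥ 0} M_j` with an action of `𝔖_n` that is `k`-linear, preserves
degrees, and satisfies `σ(f m) = σ(f) σ(m)` for `f ∈ S`, `m ∈ M`. -/
structure EquivGradedModule (k : Type u) [Field k] (n : ℕ) where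
  carrier : Type v
  [addCommGroup : AddCommGroup carrier]
  [moduleField : Module k carrier]
  [modulePoly : Module (MvPolynomial (Fin n) k) carrier]
  [isScalarTower : IsScalarTower k (MvPolynomial (Fin n) k) carrier]
  /-- the graded components `M_j` -/
  deg : ℕ → Submodule k carrier
  /-- the action of the symmetric group -/
  ρ : Representation k (Equiv.Perm (Fin n)) carrier
  isInternal : DirectSum.IsInternal deg
  smul_mem : ∀ (i j : ℕ) (f : MvPolynomial (Fin n) k) (m : carrier),
    f.IsHomogeneous i → m ∈ deg j → f • m ∈ deg (i + j)
  ρ_smul : ∀ (σ : Equiv.Perm (Fin n)) (f : MvPolynomial (Fin n) k) (m : carrier),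
    ρ σ (f • m) = rename σ f • ρ σ m
  ρ_mem : ∀ (σ : Equiv.Perm (Fin n)) (j : ℕ) (m : carrier), m ∈ deg j → ρ σ m ∈ deg j

attribute [instance] EquivGradedModule.addCommGroup EquivGradedModule.moduleField
  EquivGradedModule.modulePoly EquivGradedModule.isScalarTower

/-- `S`-linear maps of degree zero that commute with the action of `𝔖_n`. -/
structure EquivGradedHom {k : Type u} [Field k] {n : ℕ}
    (M : EquivGradedModule.{u, v} k n) (N : EquivGradedModule.{u, w} k n) where
  toLin : M.carrier →ₗ[MvPolynomial (Fin n) k] N.carrier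
  map_ρ : ∀ (σ : Equiv.Perm (Fin n)) (m : M.carrier), toLin (M.ρ σ m) = N.ρ σ (toLin m)
  map_mem : ∀ (j : ℕ) (m : M.carrier), m ∈ M.deg j → toLin m ∈ N.deg j

/-! ## Reduction modulo the maximal ideal: `M ⊗_S k = M / 𝔪 M` -/

/-- The graded maximal ideal `𝔪 = (x_1, …, x_n)`; the `S`-module `k` is `S / 𝔪`. -/
def maxIdeal (k : Type u) [Field k] (n : ℕ) : Ideal (MvPolynomial (Fin n) k) :=
  Ideal.span (Set.range X)

namespace EquivGradedModule

variable {k : Type u} [Field k] {n : ℕ}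

/-- `𝔪 M`, as a `k`-subspace of `M`. -/
def mSub (M : EquivGradedModule.{u, v} k n) : Submodule k M.carrier :=
  (maxIdeal k n • (⊤ : Submodule (MvPolynomial (Fin n) k) M.carrier)).restrictScalars k

lemma rename_mem_maxIdeal (σ : Equiv.Perm (Fin n)) {f : MvPolynomial (Fin n) k}
    (hf : f ∈ maxIdeal k n) : rename σ f ∈ maxIdeal k n := by
  have h : (maxIdeal k n) ≤ (maxIdeal k n).comap (rename σ : MvPolynomial (Fin n) k →ₐ[k] _) := by
    rw [maxIdeal, Ideal.span_le]
    rintro _ ⟨i, rfl⟩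
    simp only [SetLike.mem_coe, Ideal.mem_comap, rename_X]
    exact Ideal.subset_span ⟨σ i, rfl⟩
  exact h hf

lemma mSub_le_comap (M : EquivGradedModule.{u, v} k n) (σ : Equiv.Perm (Fin n)) :
    M.mSub ≤ M.mSub.comap (M.ρ σ) := by
  intro x hx
  simp only [mSub, Submodule.restrictScalars_mem, Submodule.mem_comap] at hx ⊢
  refine Submodule.smul_induction_on hx (fun f hf m _ => ?_) (fun a b ha hb => ?_)
  · rw [M.ρ_smul]
    exact Submodule.smul_mem_smul (rename_mem_maxIdeal σ hf) trivial
  · rw [map_add]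
    exact add_mem ha hb

/-- `M ⊗_S k = M / 𝔪 M`. -/
abbrev Fiber (M : EquivGradedModule.{u, v} k n) : Type v := M.carrier ⧸ M.mSub

/-- The induced action of `𝔖_n` on `M ⊗_S k`. -/
def fiberRep (M : EquivGradedModule.{u, v} k n) :
    Representation k (Equiv.Perm (Fin n)) M.Fiber :=
  M.ρ.quotient M.mSub M.mSub_le_comap

/-- The induced grading on `M ⊗_S k`. -/
def fiberDeg (M : EquivGradedModule.{u, v} k n) (j : ℕ) : Submodule k M.Fiber :=
  (M.deg j).map M.mSub.mkQ

lemma fiberDeg_le_comap (M : EquivGradedModule.{u, v} k n) (j : ℕ) (σ : Equiv.Perm (Fin n)) :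
    M.fiberDeg j ≤ (M.fiberDeg j).comap (M.fiberRep σ) := by
  rintro _ ⟨m, hm, rfl⟩
  exact ⟨M.ρ σ m, M.ρ_mem σ j m hm, rfl⟩

end EquivGradedModule

/-- The map `M ⊗_S k → N ⊗_S k` induced by `M → N`. -/
def EquivGradedHom.fiberMap {k : Type u} [Field k] {n : ℕ}
    {M : EquivGradedModule.{u, v} k n} {N : EquivGradedModule.{u, w} k n}
    (f : EquivGradedHom M N) : M.Fiber →ₗ[k] N.Fiber :=
  Submodule.mapQ M.mSub N.mSub (f.toLin.restrictScalars k) (by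
    intro x hx
    simp only [EquivGradedModule.mSub, Submodule.restrictScalars_mem, Submodule.mem_comap,
      LinearMap.coe_restrictScalars] at hx ⊢
    refine Submodule.smul_induction_on hx (fun g hg m _ => ?_) (fun a b ha hb => ?_)
    · rw [map_smul]
      exact Submodule.smul_mem_smul hg trivial
    · rw [map_add]
      exact add_mem ha hb)

lemma EquivGradedHom.fiberMap_rep {k : Type u} [Field k] {n : ℕ}
    {M : EquivGradedModule.{u, v} k n} {N : EquivGradedModule.{u, w} k n}
    (f : EquivGradedHom M N) (σ : Equiv.Perm (Fin n)) (x : M.Fiber) :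
    f.fiberMap (M.fiberRep σ x) = N.fiberRep σ (f.fiberMap x) := by
  obtain ⟨m, rfl⟩ := M.mSub.mkQ_surjective x
  exact congrArg N.mSub.mkQ (f.map_ρ σ m)

/-! ## Free resolutions and Tor -/

/-- An `𝔖_n`-equivariant graded free resolution
`⋯ → F_2 → F_1 → F_0 → M → 0` over `S = k[x_1, …, x_n]`: an exact complex of free `S`-modules with
compatible gradings and `𝔖_n`-actions. Every `M` has one (start from `S ⊗_k M → M` and iterate).
`Tor_i(M, k)`, with its grading and its `𝔖_n`-action, is the homology of `F_• ⊗_S k`, for an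
arbitrary choice of such a resolution. -/
structure EquivFreeResolution {k : Type u} [Field k] {n : ℕ}
    (M : EquivGradedModule.{u, v} k n) where
  F : ℕ → EquivGradedModule.{u, w} k n
  free : ∀ i, Module.Free (MvPolynomial (Fin n) k) (F i).carrier
  d : ∀ i, EquivGradedHom (F (i + 1)) (F i)
  ε : EquivGradedHom (F 0) M
  ε_surjective : Function.Surjective ε.toLin
  exact_zero : Function.Exact (d 0).toLin ε.toLin
  exact_succ : ∀ i, Function.Exact (d (i + 1)).toLin (d i).toLin

namespace EquivFreeResolution

variable {k : Type u} [Field k] {n : ℕ} {M : EquivGradedModule.{u, v} k n}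

/-- The cycles of the complex `F_• ⊗_S k`. -/
def cycles (R : EquivFreeResolution.{u, v, w} M) :
    (i : ℕ) → Submodule k (R.F i).Fiber
  | 0 => ⊤
  | i + 1 => LinearMap.ker (R.d i).fiberMap

/-- The boundaries of the complex `F_• ⊗_S k`. -/
def boundaries (R : EquivFreeResolution.{u, v, w} M) (i : ℕ) : Submodule k (R.F i).Fiber :=
  LinearMap.range (R.d i).fiberMap

lemma cycles_le_comap (R : EquivFreeResolution.{u, v, w} M) (i : ℕ) (σ : Equiv.Perm (Fin n)) :
    R.cycles i ≤ (R.cycles i).comap ((R.F i).fiberRep σ) := by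
  intro x hx
  cases i with
  | zero => exact trivial
  | succ i =>
    simp only [cycles, Submodule.mem_comap, LinearMap.mem_ker] at hx ⊢
    rw [EquivGradedHom.fiberMap_rep, hx, map_zero]

/-- The action of `𝔖_n` on the cycles of `F_• ⊗_S k`. -/
def cyclesRep (R : EquivFreeResolution.{u, v, w} M) (i : ℕ) :
    Representation k (Equiv.Perm (Fin n)) (R.cycles i) :=
  (R.F i).fiberRep.subrepresentation (R.cycles i) (R.cycles_le_comap i)

/-- `Tor_i(M, k)`, the homology of `F_• ⊗_S k`. -/
abbrev Tor (R : EquivFreeResolution.{u, v, w} M) (i : ℕ) : Type w :=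
  R.cycles i ⧸ (R.boundaries i).comap (R.cycles i).subtype

lemma boundaries_le_comap (R : EquivFreeResolution.{u, v, w} M) (i : ℕ)
    (σ : Equiv.Perm (Fin n)) :
    (R.boundaries i).comap (R.cycles i).subtype ≤
      ((R.boundaries i).comap (R.cycles i).subtype).comap (R.cyclesRep i σ) := by
  rintro x ⟨y, hy⟩
  exact ⟨(R.F (i + 1)).fiberRep σ y, by rw [EquivGradedHom.fiberMap_rep, hy]; rfl⟩

/-- The `k[𝔖_n]`-module structure of `Tor_i(M, k)`. -/
def torRep (R : EquivFreeResolution.{u, v, w} M) (i : ℕ) :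
    Representation k (Equiv.Perm (Fin n)) (R.Tor i) :=
  (R.cyclesRep i).quotient _ (R.boundaries_le_comap i)

/-- The graded component `Tor_i(M, k)_j`: the classes of the cycles of degree `j`. -/
def torDeg (R : EquivFreeResolution.{u, v, w} M) (i j : ℕ) : Submodule k (R.Tor i) :=
  (((R.F i).fiberDeg j).comap (R.cycles i).subtype).map (Submodule.mkQ _)

lemma torDeg_le_comap (R : EquivFreeResolution.{u, v, w} M) (i j : ℕ)
    (σ : Equiv.Perm (Fin n)) :
    R.torDeg i j ≤ (R.torDeg i j).comap (R.torRep i σ) := by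
  rintro _ ⟨z, hz, rfl⟩
  exact ⟨R.cyclesRep i σ z, (R.F i).fiberDeg_le_comap j σ hz, rfl⟩

/-- The `k[𝔖_n]`-module structure of `Tor_i(M, k)_j`. -/
def torDegRep (R : EquivFreeResolution.{u, v, w} M) (i j : ℕ) :
    Representation k (Equiv.Perm (Fin n)) (R.torDeg i j) :=
  (R.torRep i).subrepresentation (R.torDeg i j) (R.torDeg_le_comap i j)

end EquivFreeResolution

/-! ## Symmetric homogeneous ideals and their quotients as equivariant graded modules -/

section Ideals

variable {k : Type u} [Field k] {n : ℕ}

/-- `I` is `𝔖_n`-fixed: `σ(I) = I` for all `σ ∈ 𝔖_n`. -/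
def IsSymmFixed (I : Ideal (MvPolynomial (Fin n) k)) : Prop :=
  ∀ σ : Equiv.Perm (Fin n), I.map (rename σ : MvPolynomial (Fin n) k →ₐ[k] _) = I

lemma IsSymmFixed.rename_mem {I : Ideal (MvPolynomial (Fin n) k)} (hI : IsSymmFixed I)
    (σ : Equiv.Perm (Fin n)) {f : MvPolynomial (Fin n) k} (hf : f ∈ I) : rename σ f ∈ I := by
  have h := Ideal.mem_map_of_mem (rename σ : MvPolynomial (Fin n) k →ₐ[k] _) hf
  rwa [hI σ] at h

/-- `I` is a homogeneous ideal: it contains the homogeneous components of its elements. -/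
def IsGradedIdeal (I : Ideal (MvPolynomial (Fin n) k)) : Prop :=
  ∀ f ∈ I, ∀ j : ℕ, homogeneousComponent j f ∈ I

/-- The monomial `x^a`. -/
def mon (k : Type u) [Field k] {n : ℕ} (a : Fin n →₀ ℕ) : MvPolynomial (Fin n) k :=
  monomial a 1

/-- Monomial ideals: ideals generated by monomials. -/
def IsMonomialIdeal (I : Ideal (MvPolynomial (Fin n) k)) : Prop :=
  ∃ A : Set (Fin n →₀ ℕ), I = Ideal.span (mon k '' A)

lemma IsMonomialIdeal.isGraded {I : Ideal (MvPolynomial (Fin n) k)} (hI : IsMonomialIdeal I) :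
    IsGradedIdeal I := by
  obtain ⟨A, rfl⟩ := hI
  let _ := MvPolynomial.gradedAlgebra (σ := Fin n) (R := k)
  have h : (Ideal.span (mon k '' A)).IsHomogeneous (homogeneousSubmodule (Fin n) k) := by
    refine Ideal.homogeneous_span _ _ ?_
    rintro _ ⟨a, _, rfl⟩
    exact ⟨a.degree, isHomogeneous_monomial _ rfl⟩
  intro f hf j
  exact homogeneousComponent_mem_of_mem h hf j

/-- The action of `𝔖_n` on `S` by permutations of the variables. -/
def polyRep (k : Type u) [Field k] (n : ℕ) :
    Representation k (Equiv.Perm (Fin n)) (MvPolynomial (Fin n) k) where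
  toFun σ := (rename σ : MvPolynomial (Fin n) k →ₐ[k] _).toLinearMap
  map_one' := by
    refine LinearMap.ext fun f => ?_
    simp
  map_mul' σ τ := by
    refine LinearMap.ext fun f => ?_
    simp [rename_rename, Equiv.Perm.coe_mul]

/-- A family of subspaces with compatible projections that spans is a grading. -/
lemma isInternal_of_proj {V : Type v} [AddCommGroup V] [Module k V] (D : ℕ → Submodule k V)
    (π : ℕ → V →ₗ[k] V) (h1 : ∀ j, ∀ x ∈ D j, π j x = x)
    (h2 : ∀ i j, i ≠ j → ∀ x ∈ D i, π j x = 0) (h3 : ∀ x, x ∈ ⨆ j, D j) :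
    DirectSum.IsInternal D := by
  refine DirectSum.isInternal_submodule_of_iSupIndep_of_iSup_eq_top ?_
    (eq_top_iff.2 fun x _ => h3 x)
  intro j
  rw [Submodule.disjoint_def]
  intro x hx hx'
  have : (⨆ i, ⨆ (_ : i ≠ j), D i) ≤ LinearMap.ker (π j) :=
    iSup₂_le fun i hij y hy => h2 i j hij y hy
  rw [← h1 j x hx]
  exact this hx'

/-- The action of `𝔖_n` on an `𝔖_n`-fixed ideal. -/
def idealRep (U : Ideal (MvPolynomial (Fin n) k)) (hU : IsSymmFixed U) :
    Representation k (Equiv.Perm (Fin n)) U :=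
  (polyRep k n).subrepresentation (U.restrictScalars k) fun σ _ hf => hU.rename_mem σ hf

/-- The degree `j` component of an ideal. -/
def idealDeg (U : Ideal (MvPolynomial (Fin n) k)) (j : ℕ) : Submodule k U :=
  (homogeneousSubmodule (Fin n) k j).comap ((Submodule.subtype U).restrictScalars k)

/-- Taking homogeneous components of degree `j` in a homogeneous ideal. -/
def idealProj (U : Ideal (MvPolynomial (Fin n) k)) (hU : IsGradedIdeal U) (j : ℕ) :
    U →ₗ[k] U :=
  (homogeneousComponent j : MvPolynomial (Fin n) k →ₗ[k] _).restrict
    (p := U.restrictScalars k) (q := U.restrictScalars k) fun f hf => hU f hf j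

lemma mem_iSup_idealDeg (U : Ideal (MvPolynomial (Fin n) k)) (hU : IsGradedIdeal U) (x : U) :
    x ∈ ⨆ j, idealDeg U j := by
  have hx : x = ∑ j ∈ Finset.range (x.1.totalDegree + 1), idealProj U hU j x := by
    apply Subtype.ext
    rw [AddSubmonoidClass.coe_finsetSum]
    exact (sum_homogeneousComponent x.1).symm
  rw [hx]
  exact Submodule.sum_mem _ fun j _ => Submodule.mem_iSup_of_mem j
    (homogeneousComponent_isHomogeneous j x.1)

lemma idealProj_of_mem (U : Ideal (MvPolynomial (Fin n) k)) (hU : IsGradedIdeal U) (i j : ℕ)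
    (x : U) (hx : x ∈ idealDeg U i) : idealProj U hU j x = if i = j then x else 0 := by
  apply Subtype.ext
  have h := homogeneousComponent_of_mem (m := j) (n := i) (p := x.1) hx
  change homogeneousComponent j x.1 = _
  rw [h]
  split_ifs <;> first | rfl | omega

/-- An `𝔖_n`-fixed homogeneous ideal of `S`, as an equivariant graded `S`-module. -/
def ofIdeal (U : Ideal (MvPolynomial (Fin n) k)) (hs : IsSymmFixed U) (hg : IsGradedIdeal U) :
    EquivGradedModule.{u, u} k n where
  carrier := U
  deg := idealDeg U
  ρ := idealRep U hs
  isInternal := isInternal_of_proj _ (idealProj U hg)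
    (fun j x hx => by simp [idealProj_of_mem U hg j j x hx])
    (fun i j hij x hx => by simp [idealProj_of_mem U hg i j x hx, hij])
    (mem_iSup_idealDeg U hg)
  smul_mem i j f m hf hm := MvPolynomial.IsHomogeneous.mul hf hm
  ρ_smul σ f m := Subtype.ext (map_mul (rename σ : MvPolynomial (Fin n) k →ₐ[k] _) f m.1)
  ρ_mem σ j m hm := IsHomogeneous.rename_isHomogeneous hm

/-- `V ∩ U` as a submodule of `U`; when `V ⊆ U` this is `V`. -/
abbrev relSub (U V : Ideal (MvPolynomial (Fin n) k)) : Submodule (MvPolynomial (Fin n) k) U :=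
  Submodule.comap (Submodule.subtype U) V

/-- The quotient `U / V` of two `𝔖_n`-fixed homogeneous ideals `V ⊆ U` of `S`, as an equivariant
graded `S`-module. -/
def ofIdealQuotient (U V : Ideal (MvPolynomial (Fin n) k))
    (hU : IsSymmFixed U) (hgU : IsGradedIdeal U) (hV : IsSymmFixed V) (hgV : IsGradedIdeal V) :
    EquivGradedModule.{u, u} k n where
  carrier := U ⧸ relSub U V
  deg j := (idealDeg U j).map ((relSub U V).mkQ.restrictScalars k)
  ρ := (idealRep U hU).quotient ((relSub U V).restrictScalars k)
    fun σ _ hx => hV.rename_mem σ hx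
  isInternal := by
    refine isInternal_of_proj _
      (fun j => Submodule.mapQ ((relSub U V).restrictScalars k) ((relSub U V).restrictScalars k)
        (idealProj U hgU j) fun x hx => hgV x.1 hx j) ?_ ?_ ?_
    · rintro j _ ⟨x, hx, rfl⟩
      change (relSub U V).mkQ (idealProj U hgU j x) = _
      simp [idealProj_of_mem U hgU j j x hx]
    · rintro i j hij _ ⟨x, hx, rfl⟩
      change (relSub U V).mkQ (idealProj U hgU j x) = _
      simp [idealProj_of_mem U hgU i j x hx, hij]
    · intro y
      obtain ⟨x, rfl⟩ := (relSub U V).mkQ_surjective y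
      rw [← Submodule.map_iSup]
      exact ⟨x, mem_iSup_idealDeg U hgU x, rfl⟩
  smul_mem := by
    rintro i j f _ hf ⟨x, hx, rfl⟩
    exact ⟨f • x, MvPolynomial.IsHomogeneous.mul hf hx, rfl⟩
  ρ_smul := by
    intro σ f y
    obtain ⟨x, rfl⟩ := (relSub U V).mkQ_surjective y
    exact congrArg (relSub U V).mkQ
      (Subtype.ext (map_mul (rename σ : MvPolynomial (Fin n) k →ₐ[k] _) f x.1) :
        idealRep U hU σ (f • x) = rename σ f • idealRep U hU σ x)
  ρ_mem := by
    rintro σ j _ ⟨x, hx, rfl⟩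
    exact ⟨idealRep U hU σ x, IsHomogeneous.rename_isHomogeneous hx, rfl⟩

/-! ## Symmetric shifted ideals -/

/-- Partitions of length `n`, written as nondecreasing sequences `λ_1 ≤ ⋯ ≤ λ_n`. -/
def IsPartition (a : Fin n →₀ ℕ) : Prop := Monotone a

/-- `P(I)`: the partitions `λ` with `x^λ ∈ I`. -/
def partitionsOf (I : Ideal (MvPolynomial (Fin n) k)) : Set (Fin n →₀ ℕ) :=
  {a | IsPartition a ∧ mon k a ∈ I}

/-- `Λ(I)`: the partitions `λ` such that `x^λ` is a minimal monomial generator of `I`, that is,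
a monomial of `I` not divisible by any other monomial of `I`. -/
def partitionGenerators (I : Ideal (MvPolynomial (Fin n) k)) : Set (Fin n →₀ ℕ) :=
  {a | a ∈ partitionsOf I ∧ Minimal (fun b => mon k b ∈ I) a}

/-- Symmetric shifted ideals: `𝔖_n`-fixed monomial ideals such that `x^λ (x_m / x_n) ∈ I` for all
`λ ∈ P(I)` and all `m < n` with `λ_m < λ_n`; the last index is called `l` here. -/
structure IsSymmetricShifted (I : Ideal (MvPolynomial (Fin n) k)) : Prop where
  monomial : IsMonomialIdeal I
  fixed : IsSymmFixed I
  shifted : ∀ a ∈ partitionsOf I, ∀ m l : Fin n, (l : ℕ) + 1 = n → a m < a l →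
    mon k (a + Finsupp.single m 1 - Finsupp.single l 1) ∈ I

/-- `p(λ) = #{m : λ_m < λ_n - 1}`; the last index is called `l` here. -/
def numSmall (a : Fin n →₀ ℕ) : ℕ :=
  {m : Fin n | ∃ l : Fin n, (l : ℕ) + 1 = n ∧ a m + 1 < a l}.ncard

/-- The ideal `(σ(f) : f ∈ T, σ ∈ 𝔖_n)`. -/
def orbitIdeal (T : Set (MvPolynomial (Fin n) k)) : Ideal (MvPolynomial (Fin n) k) :=
  Ideal.span {g | ∃ f ∈ T, ∃ σ : Equiv.Perm (Fin n), g = rename σ f}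

lemma orbitIdeal_symm (T : Set (MvPolynomial (Fin n) k)) : IsSymmFixed (orbitIdeal T) := by
  intro σ
  rw [orbitIdeal, Ideal.map_span]
  congr 1
  ext g
  constructor
  · rintro ⟨_, ⟨f, hf, τ, rfl⟩, rfl⟩
    exact ⟨f, hf, σ * τ, by simp [rename_rename, Equiv.Perm.coe_mul]⟩
  · rintro ⟨f, hf, τ, rfl⟩
    refine ⟨rename (σ⁻¹ * τ : Equiv.Perm (Fin n)) f, ⟨f, hf, _, rfl⟩, ?_⟩
    simp only [rename_rename, ← Equiv.Perm.coe_mul, mul_inv_cancel_left]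

lemma orbitIdeal_graded (A : Set (Fin n →₀ ℕ)) : IsGradedIdeal (orbitIdeal (mon k '' A)) := by
  refine IsMonomialIdeal.isGraded
    ⟨{b | ∃ a ∈ A, ∃ σ : Equiv.Perm (Fin n), b = a.mapDomain σ}, ?_⟩
  rw [orbitIdeal]
  congr 1
  ext g
  constructor
  · rintro ⟨_, ⟨a, ha, rfl⟩, σ, rfl⟩
    exact ⟨_, ⟨a, ha, σ, rfl⟩, (rename_monomial σ a 1).symm⟩
  · rintro ⟨_, ⟨a, ha, σ, rfl⟩, rfl⟩
    exact ⟨_, ⟨a, ha, rfl⟩, σ, (rename_monomial σ a 1).symm⟩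

/-- The exponents of the monomials `x_i x^λ` with `1 ≤ i ≤ p(λ)`. -/
def raised (a : Fin n →₀ ℕ) : Set (Fin n →₀ ℕ) :=
  {b | ∃ i : Fin n, (i : ℕ) < numSmall a ∧ b = Finsupp.single i 1 + a}

/-- `N^λ = (σ(x^λ) : σ ∈ 𝔖_n) / (σ(x_i x^λ) : 1 ≤ i ≤ p(λ), σ ∈ 𝔖_n)`. -/
def Nmod (k : Type u) [Field k] {n : ℕ} (a : Fin n →₀ ℕ) : EquivGradedModule.{u, u} k n :=
  ofIdealQuotient (orbitIdeal (mon k '' {a})) (orbitIdeal (mon k '' raised a))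
    (orbitIdeal_symm _) (orbitIdeal_graded _) (orbitIdeal_symm _) (orbitIdeal_graded _)

/-- A symmetric shifted ideal as an equivariant graded `S`-module. -/
def IsSymmetricShifted.toModule {I : Ideal (MvPolynomial (Fin n) k)}
    (hI : IsSymmetricShifted I) : EquivGradedModule.{u, u} k n :=
  ofIdeal I hI.fixed hI.monomial.isGraded

end Ideals

end SymShifted

end

-- Free resolutions are traded for Koszul complexes. `Tor_i(M, k)_j` is the Koszul homology of `M`
-- in homological degree `i` with coefficients in `M_{j-i}`, compatibly with permutations
-- (`torDeg_iso_koszul`). This is dimension shifting along `0 → ker ε → F_0 → M → 0`, and it needs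
-- only that free modules are Koszul acyclic in positive homological degrees (`free_koszul_exact`).
-- In coefficient degrees, "linear resolution generated in degree `d`" means "homology concentrated
-- in degree `d`".
--
-- Each `N^λ` is concentrated in degree `|λ|` (`Nmod_vanishes`). If the largest entry of `λ` is `t +
-- 1`, a monomial basis of `N^λ` is given by the exponents whose truncation at `t` is a
-- rearrangement of that of `λ` and which have at least as many entries above `t` as `λ`
-- (`orbitDiff_eq_layer`). Filtering by the number of entries above `t` gives successive quotients
-- that are direct sums of copies of `S` modulo some variables, all generated in one degree. For
-- these, division by a variable gives explicit homotopies (`IsOrthantUnion.vanishes`). Long exact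
-- sequences then give the concentration for each step of the filtration (`layer_vanishes`).
--
-- Let `b` be a partition generator of `I` of maximal degree and, in that degree, of maximal sum of
-- squares. Removing the orbit of `b` leaves a symmetric shifted ideal `J` with `I / J ≅ N^b`
-- (`IsSymmetricShifted.exists_exact`). The sum of squares controls the argument. Moving a unit away
-- from a largest entry never increases it, and keeps it only if the result is a permutation of the
-- original (`sumSq_shift`). Thus shifts of other generators cannot produce `b`.
--
-- By induction on the number of generators, the homology of `J` lives in degrees at most `|b|`. The
-- connecting map out of the homology of `N^b` goes from degree `|b|` to degree `|b| + 1`, where the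
-- homology of `J` is zero. Hence the long exact sequence breaks into short exact ones
-- (`koszul_decomposition`). They split equivariantly for every subgroup `K` whose order is
-- invertible in `k`, by averaging. The whole symmetric group gives the equivariant statement, and
-- the trivial group gives the statement over any field.

universe v'

noncomputable section

namespace SymShifted

/-! ## Koszul complexes of commuting operators -/

/-- The `i`-th term of the Koszul complex: alternating maps in `i` variables with values in `V`. -/
abbrev KoszulChain (k : Type u) [Field k] (n : ℕ) (V : Type v) [AddCommGroup V] [Module k V]
    (i : ℕ) : Type (max u v) :=
  (Fin n → k) [⋀^Fin i]→ₗ[k] V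

section Koszul

variable {k : Type u} [Field k] {n : ℕ} {V : Type v} [AddCommGroup V] [Module k V]
  {W : Type w} [AddCommGroup W] [Module k W]

lemma alternating_sum_apply {ι κ : Type*} {U : Type*} [AddCommGroup U] [Module k U]
    (s : Finset κ) (f : κ → U [⋀^ι]→ₗ[k] V) (v : ι → U) :
    (∑ a ∈ s, f a) v = ∑ a ∈ s, f a v := by
  classical
  induction s using Finset.induction_on with
  | empty => simp
  | insert a s ha ih =>
    rw [Finset.sum_insert ha, Finset.sum_insert ha, AlternatingMap.add_apply, ih]

/-- The Koszul differential: contraction with the vector `(x_1, …, x_n)` of operators. -/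
def koszulD (x : Fin n → Module.End k V) (i : ℕ) :
    KoszulChain k n V (i + 1) →ₗ[k] KoszulChain k n V i where
  toFun f := ∑ l, (x l).compAlternatingMap (f.curryLeft (Pi.single l 1))
  map_add' f g := by
    ext v
    simp [Finset.sum_add_distrib]
  map_smul' c f := by
    ext v
    simp [Finset.smul_sum]

lemma koszulD_apply (x : Fin n → Module.End k V) {i : ℕ} (f : KoszulChain k n V (i + 1))
    (v : Fin i → Fin n → k) :
    koszulD x i f v = ∑ l, x l (f (Matrix.vecCons (Pi.single l 1) v)) := by
  rw [koszulD, LinearMap.coe_mk, AddHom.coe_mk, alternating_sum_apply]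
  rfl

lemma alternating_vecCons_self (f : KoszulChain k n V (i + 2)) (a : Fin n → k)
    (v : Fin i → Fin n → k) : f (Matrix.vecCons a (Matrix.vecCons a v)) = 0 :=
  f.map_eq_zero_of_eq _ (i := 0) (j := 1) rfl (by simp)

lemma alternating_vecCons_swap (f : KoszulChain k n V (i + 2)) (a b : Fin n → k)
    (v : Fin i → Fin n → k) :
    f (Matrix.vecCons a (Matrix.vecCons b v)) = - f (Matrix.vecCons b (Matrix.vecCons a v)) := by
  have h := alternating_vecCons_self f (a + b) v
  have h1 := alternating_vecCons_self f a v
  have h2 := alternating_vecCons_self f b v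
  have e : ∀ c d : Fin n → k, f (Matrix.vecCons c (Matrix.vecCons d v)) =
      (f.curryLeft c).curryLeft d v := fun _ _ => rfl
  simp only [e, map_add, AlternatingMap.curryLeft_add, LinearMap.add_apply,
    AlternatingMap.add_apply] at h h1 h2 ⊢
  rw [h1, h2, zero_add, add_zero] at h
  exact eq_neg_of_add_eq_zero_right h

/-- The terms for `(l, m)` and `(m, l)` cancel, as the operators commute and `f` changes sign. The
diagonal terms vanish because `f` is alternating, so characteristic two needs no separate treatment.
-/
lemma koszulD_koszulD (x : Fin n → Module.End k V) (hx : ∀ l m, Commute (x l) (x m)) {i : ℕ}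
    (f : KoszulChain k n V (i + 2)) : koszulD x i (koszulD x (i + 1) f) = 0 := by
  ext v
  simp only [koszulD_apply, map_sum, AlternatingMap.zero_apply]
  rw [← Finset.sum_product']
  have hc : ∀ l m y, x l (x m y) = x m (x l y) := fun l m y =>
    LinearMap.congr_fun (hx l m).eq y
  refine Finset.sum_involution (fun p _ => (p.2, p.1)) ?_ ?_ (fun _ _ => by simp)
    (fun _ _ => rfl)
  · rintro ⟨l, m⟩ _
    simp only
    rw [hc, ← map_add, ← map_add, alternating_vecCons_swap, neg_add_cancel, map_zero, map_zero]
  · rintro ⟨l, m⟩ _ h heq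
    simp only [Prod.mk.injEq] at heq
    obtain ⟨rfl, -⟩ := heq
    rw [alternating_vecCons_self] at h
    simp at h

/-- Koszul chains with values in a subspace. -/
def chainsIn (D : Submodule k V) (i : ℕ) : Submodule k (KoszulChain k n V i) where
  carrier := {f | ∀ v, f v ∈ D}
  add_mem' hf hg v := D.add_mem (hf v) (hg v)
  zero_mem' _ := D.zero_mem
  smul_mem' c _ hf v := D.smul_mem c (hf v)

/-- The cycles of the Koszul complex. -/
def koszulCycles (x : Fin n → Module.End k V) : (i : ℕ) → Submodule k (KoszulChain k n V i)
  | 0 => ⊤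
  | i + 1 => LinearMap.ker (koszulD x i)

lemma koszulD_mem_cycles (x : Fin n → Module.End k V) (hx : ∀ l m, Commute (x l) (x m)) {i : ℕ}
    (f : KoszulChain k n V (i + 1)) : koszulD x i f ∈ koszulCycles x i := by
  cases i with
  | zero => trivial
  | succ i => exact koszulD_koszulD x hx f

/-- Over a field the restriction of `T` to `P ∩ T⁻¹(Q)`, which maps onto `Q`, has a linear section,
and composing with it lifts chains without choosing a basis. -/
lemma exists_chain_lift (T : V →ₗ[k] W) (P : Submodule k V) (Q : Submodule k W)
    (h : ∀ w ∈ Q, ∃ v ∈ P, T v = w) {i : ℕ} {f : KoszulChain k n W i} (hf : f ∈ chainsIn Q i) :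
    ∃ g ∈ chainsIn P i, T.compAlternatingMap g = f := by
  let T' : (P ⊓ Q.comap T : Submodule k V) →ₗ[k] Q := T.restrict fun _ hv => hv.2
  have hT' : Function.Surjective T' := by
    rintro ⟨w, hw⟩
    obtain ⟨v, hv, rfl⟩ := h w hw
    exact ⟨⟨v, hv, hw⟩, rfl⟩
  obtain ⟨s, hs⟩ := T'.exists_rightInverse_of_surjective (LinearMap.range_eq_top.2 hT')
  refine ⟨((P ⊓ Q.comap T).subtype ∘ₗ s).compAlternatingMap (f.codRestrict Q hf),
    fun v => (s _).2.1, ?_⟩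
  ext v
  exact congrArg Subtype.val (LinearMap.congr_fun hs (f.codRestrict Q hf v))

/-- Commutation is demanded on `P` only, since the maps in use respect the operators only on the
graded pieces. -/
lemma koszulD_comp (x : Fin n → Module.End k V) (y : Fin n → Module.End k W) (T : V →ₗ[k] W)
    (P : Submodule k V) (h : ∀ l, ∀ v ∈ P, T (x l v) = y l (T v)) {i : ℕ}
    {f : KoszulChain k n V (i + 1)} (hf : f ∈ chainsIn P (i + 1)) :
    koszulD y i (T.compAlternatingMap f) = T.compAlternatingMap (koszulD x i f) := by
  ext v
  simp only [koszulD_apply, LinearMap.compAlternatingMap_apply, map_sum]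
  exact Finset.sum_congr rfl fun l _ => (h l _ (hf _)).symm

lemma exists_chain_factor {f : V →ₗ[k] W} (P : Submodule k V) {i : ℕ}
    {g g' : KoszulChain k n V i} (hg : g ∈ chainsIn P i) (hg' : g' ∈ chainsIn P i)
    (hf : ∀ v ∈ P, f v = 0 → v = 0) (h : f.compAlternatingMap g = f.compAlternatingMap g') :
    g = g' := by
  ext v
  refine sub_eq_zero.1 (hf _ (P.sub_mem (hg v) (hg' v)) ?_)
  rw [map_sub, sub_eq_zero]
  exact DFunLike.congr_fun h v

end Koszul

/-! ## Vector spaces with commuting operators of degree one -/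

/-- A vector space with `n` commuting operators of degree one for a family of subspaces. -/
structure OpModule (k : Type u) [Field k] (n : ℕ) where
  V : Type v
  [addCommGroup : AddCommGroup V]
  [module : Module k V]
  x : Fin n → Module.End k V
  comm : ∀ l m, Commute (x l) (x m)
  D : ℤ → Submodule k V
  x_mem : ∀ l z v, v ∈ D z → x l v ∈ D (z + 1)

attribute [instance] OpModule.addCommGroup OpModule.module

namespace OpModule

variable {k : Type u} [Field k] {n : ℕ}

/-- Koszul chains of internal degree `z`. -/
abbrev chains (A : OpModule.{u, v} k n) (i : ℕ) (z : ℤ) : Submodule k (KoszulChain k n A.V i) :=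
  chainsIn (A.D z) i

/-- Koszul cycles of internal degree `z`. -/
def cycles (A : OpModule.{u, v} k n) (i : ℕ) (z : ℤ) : Submodule k (KoszulChain k n A.V i) :=
  koszulCycles A.x i ⊓ A.chains i z

lemma koszulD_mem (A : OpModule.{u, v} k n) {i : ℕ} {z : ℤ} {f : KoszulChain k n A.V (i + 1)}
    (hf : f ∈ A.chains (i + 1) z) : koszulD A.x i f ∈ A.chains i (z + 1) := by
  intro v
  rw [koszulD_apply]
  exact Submodule.sum_mem _ fun l _ => A.x_mem _ _ _ (hf _)

lemma koszulD_mem' (A : OpModule.{u, v} k n) {i : ℕ} {z : ℤ} {f : KoszulChain k n A.V (i + 1)}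
    (hf : f ∈ A.chains (i + 1) (z - 1)) : koszulD A.x i f ∈ A.chains i z := by
  simpa using A.koszulD_mem hf

/-- Koszul boundaries of internal degree `z`. -/
def boundaries (A : OpModule.{u, v} k n) (i : ℕ) (z : ℤ) :
    Submodule k (KoszulChain k n A.V i) :=
  (A.chains (i + 1) (z - 1)).map (koszulD A.x i)

lemma boundaries_le_cycles (A : OpModule.{u, v} k n) (i : ℕ) (z : ℤ) :
    A.boundaries i z ≤ A.cycles i z := by
  rintro _ ⟨g, hg, rfl⟩
  exact ⟨koszulD_mem_cycles A.x A.comm g, A.koszulD_mem' hg⟩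

/-- The Koszul homology in homological degree `i` and internal degree `z` vanishes. -/
def Vanishes (A : OpModule.{u, v} k n) (i : ℕ) (z : ℤ) : Prop :=
  A.cycles i z ≤ A.boundaries i z

lemma vanishes_of_eq_zero (A : OpModule.{u, v} k n) (i : ℕ) (z : ℤ) (h : ∀ v ∈ A.D z, v = 0) :
    A.Vanishes i z := by
  rintro f ⟨-, hf⟩
  have : f = 0 := by
    ext v
    exact h _ (hf v)
  rw [this]
  exact Submodule.zero_mem _

/-- Linear maps of degree zero that commute with the operators. -/
structure IsHom (A : OpModule.{u, v} k n) (B : OpModule.{u, w} k n) (φ : A.V →ₗ[k] B.V) :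
    Prop where
  map_mem : ∀ z, ∀ a ∈ A.D z, φ a ∈ B.D z
  map_x : ∀ l z, ∀ a ∈ A.D z, φ (A.x l a) = B.x l (φ a)

namespace IsHom

variable {A : OpModule.{u, v} k n} {B : OpModule.{u, w} k n} {φ : A.V →ₗ[k] B.V}

lemma comp_mem (h : IsHom A B φ) {i : ℕ} {z : ℤ} {f : KoszulChain k n A.V i}
    (hf : f ∈ A.chains i z) : φ.compAlternatingMap f ∈ B.chains i z :=
  fun v => h.map_mem z _ (hf v)

lemma koszulD_comp (h : IsHom A B φ) {i : ℕ} {z : ℤ} {f : KoszulChain k n A.V (i + 1)}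
    (hf : f ∈ A.chains (i + 1) z) :
    koszulD B.x i (φ.compAlternatingMap f) = φ.compAlternatingMap (koszulD A.x i f) :=
  SymShifted.koszulD_comp A.x B.x φ (A.D z) (fun l a ha => h.map_x l z a ha) hf

lemma comp_mem_cycles (h : IsHom A B φ) {i : ℕ} {z : ℤ} {f : KoszulChain k n A.V i}
    (hf : f ∈ A.cycles i z) : φ.compAlternatingMap f ∈ B.cycles i z := by
  refine ⟨?_, h.comp_mem hf.2⟩
  cases i with
  | zero => trivial
  | succ i =>
    have h1 : koszulD A.x i f = 0 := hf.1
    change koszulD B.x i _ = 0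
    rw [h.koszulD_comp hf.2, h1]
    ext v
    simp

lemma comp_mem_boundaries (h : IsHom A B φ) {i : ℕ} {z : ℤ} {f : KoszulChain k n A.V i}
    (hf : f ∈ A.boundaries i z) : φ.compAlternatingMap f ∈ B.boundaries i z := by
  obtain ⟨g, hg, rfl⟩ := hf
  exact ⟨_, h.comp_mem hg, h.koszulD_comp hg⟩

end IsHom

/-- Short exact sequences in every internal degree. -/
structure IsShortExact (A : OpModule.{u, v} k n) (B : OpModule.{u, w} k n)
    (C : OpModule.{u, v'} k n) (φ : A.V →ₗ[k] B.V) (ψ : B.V →ₗ[k] C.V) : Prop where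
  left : IsHom A B φ
  right : IsHom B C ψ
  inj : ∀ z, ∀ a ∈ A.D z, φ a = 0 → a = 0
  zero : ∀ z, ∀ a ∈ A.D z, ψ (φ a) = 0
  exact : ∀ z, ∀ b ∈ B.D z, ψ b = 0 → ∃ a ∈ A.D z, φ a = b
  surj : ∀ z, ∀ c ∈ C.D z, ∃ b ∈ B.D z, ψ b = c

namespace IsShortExact

variable {A : OpModule.{u, v} k n} {B : OpModule.{u, w} k n} {C : OpModule.{u, v'} k n}
  {φ : A.V →ₗ[k] B.V} {ψ : B.V →ₗ[k] C.V}

lemma lift (h : IsShortExact A B C φ ψ) {i : ℕ} {z : ℤ} {f : KoszulChain k n C.V i}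
    (hf : f ∈ C.chains i z) : ∃ g ∈ B.chains i z, ψ.compAlternatingMap g = f :=
  exists_chain_lift ψ (B.D z) (C.D z) (h.surj z) hf

lemma factor (h : IsShortExact A B C φ ψ) {i : ℕ} {z : ℤ} {f : KoszulChain k n B.V i}
    (hf : f ∈ B.chains i z) (hf0 : ψ.compAlternatingMap f = 0) :
    ∃ g ∈ A.chains i z, φ.compAlternatingMap g = f :=
  exists_chain_lift φ (A.D z) (B.D z ⊓ LinearMap.ker ψ)
    (fun b hb => h.exact z b hb.1 hb.2)
    (fun v => ⟨hf v, DFunLike.congr_fun hf0 v⟩)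

lemma comp_comp (h : IsShortExact A B C φ ψ) {i : ℕ} {z : ℤ} {f : KoszulChain k n A.V i}
    (hf : f ∈ A.chains i z) : ψ.compAlternatingMap (φ.compAlternatingMap f) = 0 := by
  ext v
  exact h.zero z _ (hf v)

lemma eq_zero_of_comp (h : IsShortExact A B C φ ψ) {i : ℕ} {z : ℤ} {f : KoszulChain k n A.V i}
    (hf : f ∈ A.chains i z) (h0 : φ.compAlternatingMap f = 0) : f = 0 := by
  ext v
  exact h.inj z _ (hf v) (DFunLike.congr_fun h0 v)

lemma mem_cycles_of_comp (h : IsShortExact A B C φ ψ) {i : ℕ} {z : ℤ}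
    {f : KoszulChain k n A.V i} (hf : f ∈ A.chains i z)
    (hc : φ.compAlternatingMap f ∈ koszulCycles B.x i) : f ∈ A.cycles i z := by
  refine ⟨?_, hf⟩
  cases i with
  | zero => trivial
  | succ i =>
    refine h.eq_zero_of_comp (A.koszulD_mem hf) ?_
    rw [← h.left.koszulD_comp hf]
    exact hc

/-- Exactness of Koszul homology in the middle. -/
lemma exact_middle (h : IsShortExact A B C φ ψ) {i : ℕ} {z : ℤ} {f : KoszulChain k n B.V i}
    (hf : f ∈ B.cycles i z) (hb : ψ.compAlternatingMap f ∈ C.boundaries i z) :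
    ∃ a ∈ A.cycles i z, f - φ.compAlternatingMap a ∈ B.boundaries i z := by
  obtain ⟨c, hc, hcf⟩ := hb
  obtain ⟨b, hb, rfl⟩ := h.lift hc
  have h0 : ψ.compAlternatingMap (f - koszulD B.x i b) = 0 := by
    rw [h.right.koszulD_comp hb] at hcf
    have := sub_eq_zero.2 hcf.symm
    rw [← this]
    ext v
    simp
  have hmem : f - koszulD B.x i b ∈ B.cycles i z :=
    sub_mem hf (B.boundaries_le_cycles i z ⟨b, hb, rfl⟩)
  obtain ⟨a, ha, hab⟩ := h.factor hmem.2 h0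
  refine ⟨a, h.mem_cycles_of_comp ha (hab ▸ hmem.1), b, hb, ?_⟩
  rw [hab]
  abel

/-- Injectivity of the first map on Koszul homology. -/
lemma boundaries_of_comp (h : IsShortExact A B C φ ψ) {i : ℕ} {z : ℤ}
    (hC : C.Vanishes (i + 1) (z - 1)) {f : KoszulChain k n A.V i} (hf : f ∈ A.chains i z)
    (hb : φ.compAlternatingMap f ∈ B.boundaries i z) : f ∈ A.boundaries i z := by
  obtain ⟨b, hb, hbf⟩ := hb
  have hcyc : ψ.compAlternatingMap b ∈ C.cycles (i + 1) (z - 1) := by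
    refine ⟨?_, h.right.comp_mem hb⟩
    change koszulD C.x i _ = 0
    rw [h.right.koszulD_comp hb, hbf, h.comp_comp hf]
  obtain ⟨c, hc, hcb⟩ := hC hcyc
  -- Subtracting a boundary from `b` leaves its differential unchanged and makes `b` come from `A`.
  obtain ⟨b', hb', rfl⟩ := h.lift hc
  have h0 : ψ.compAlternatingMap (b - koszulD B.x _ b') = 0 := by
    rw [h.right.koszulD_comp hb'] at hcb
    have := sub_eq_zero.2 hcb.symm
    rw [← this]
    ext v
    simp
  obtain ⟨a, ha, hab⟩ := h.factor (sub_mem hb (B.koszulD_mem' hb')) h0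
  refine ⟨a, ha, sub_eq_zero.1 (h.eq_zero_of_comp (sub_mem (A.koszulD_mem' ha) hf) ?_)⟩
  have : koszulD B.x i (φ.compAlternatingMap a) = φ.compAlternatingMap f := by
    rw [hab, map_sub, koszulD_koszulD B.x B.comm, sub_zero, hbf]
  rw [h.left.koszulD_comp ha] at this
  have h2 := sub_eq_zero.2 this
  rw [← h2]
  ext v
  simp

/-- The zig-zag that defines the connecting map of Koszul homology. -/
lemma connecting (h : IsShortExact A B C φ ψ) {i : ℕ} {z : ℤ}
    {f : KoszulChain k n C.V (i + 1)} (hf : f ∈ C.cycles (i + 1) z) :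
    ∃ b ∈ B.chains (i + 1) z, ∃ a ∈ A.cycles i (z + 1), ψ.compAlternatingMap b = f ∧
      koszulD B.x i b = φ.compAlternatingMap a := by
  obtain ⟨b, hb, rfl⟩ := h.lift hf.2
  have h0 : ψ.compAlternatingMap (koszulD B.x i b) = 0 := by
    rw [← h.right.koszulD_comp hb]
    exact hf.1
  obtain ⟨a, ha, hab⟩ := h.factor (B.koszulD_mem hb) h0
  exact ⟨b, hb, a, h.mem_cycles_of_comp ha (hab ▸ koszulD_mem_cycles B.x B.comm b), rfl, hab.symm⟩

/-- Surjectivity of the second map on Koszul homology in positive degrees. -/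
lemma exists_cycle_lift (h : IsShortExact A B C φ ψ) {i : ℕ} {z : ℤ}
    (hA : A.Vanishes i (z + 1)) {f : KoszulChain k n C.V (i + 1)}
    (hf : f ∈ C.cycles (i + 1) z) :
    ∃ b ∈ B.cycles (i + 1) z, ψ.compAlternatingMap b = f := by
  obtain ⟨b, hb, a, ha, rfl, hab⟩ := h.connecting hf
  -- The obstruction to `b` being a cycle is the boundary of `a'`, so `b - φ a'` is a cycle with the
  -- same image.
  obtain ⟨a', ha', rfl⟩ := hA ha
  rw [add_sub_cancel_right] at ha'
  refine ⟨b - φ.compAlternatingMap a', ⟨?_, sub_mem hb (h.left.comp_mem ha')⟩, ?_⟩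
  · change koszulD B.x i _ = 0
    rw [map_sub, h.left.koszulD_comp ha', hab, sub_self]
  · ext v
    change ψ (b v - φ (a' v)) = ψ (b v)
    rw [map_sub, h.zero z _ (ha' v), sub_zero]

/-- Every chain in homological degree zero is a cycle, so nothing obstructs the lift. -/
lemma exists_cycle_lift_zero (h : IsShortExact A B C φ ψ) {z : ℤ}
    {f : KoszulChain k n C.V 0} (hf : f ∈ C.cycles 0 z) :
    ∃ b ∈ B.cycles 0 z, ψ.compAlternatingMap b = f := by
  obtain ⟨b, hb, rfl⟩ := h.lift hf.2
  exact ⟨b, ⟨trivial, hb⟩, rfl⟩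

/-- This is exactness of `H_{i+1}(C)_{z-1} → H_i(A)_z → H_i(B)_z` in the middle. -/
lemma vanishes_left (h : IsShortExact A B C φ ψ) {i : ℕ} {z : ℤ} (hB : B.Vanishes i z)
    (hC : C.Vanishes (i + 1) (z - 1)) : A.Vanishes i z := fun _ hf =>
  h.boundaries_of_comp hC hf.2 (hB (h.left.comp_mem_cycles hf))

end IsShortExact

end OpModule

/-! ## Reduction of Koszul cycles by division operators -/

section Reduction

variable {k : Type u} [Field k] {n : ℕ} {V : Type v} [AddCommGroup V] [Module k V]

/-- The wedge product of a Koszul chain with the `c`-th coordinate function. -/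
def wedge (c : Fin n) {i : ℕ} (f : KoszulChain k n V i) : KoszulChain k n V (i + 1) :=
  AlternatingMap.alternatizeUncurryFin ((LinearMap.proj c : (Fin n → k) →ₗ[k] k).smulRight f)

lemma wedge_apply (c : Fin n) {i : ℕ} (f : KoszulChain k n V i) (v : Fin (i + 1) → Fin n → k) :
    wedge c f v = ∑ j : Fin (i + 1), (-1) ^ (j : ℕ) • (v j c • f (j.removeNth v)) := by
  simp [wedge, AlternatingMap.alternatizeUncurryFin_apply]

lemma wedge_mem {c : Fin n} {i : ℕ} {f : KoszulChain k n V i} {Q : Submodule k V}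
    (hf : f ∈ chainsIn Q i) : wedge c f ∈ chainsIn Q (i + 1) := by
  intro v
  rw [wedge_apply]
  refine Submodule.sum_mem _ fun j _ => ?_
  rcases neg_one_pow_eq_or ℤ (j : ℕ) with h | h <;> rw [h]
  · simpa using Q.smul_mem _ (hf _)
  · simpa using Q.smul_mem _ (hf _)

lemma comp_wedge (c : Fin n) {i : ℕ} (f : KoszulChain k n V i) (T : Module.End k V) :
    T.compAlternatingMap (wedge c f) = wedge c (T.compAlternatingMap f) := by
  ext v
  simp [wedge_apply, map_sum]

lemma wedge_vecCons_zero (c : Fin n) (f : KoszulChain k n V 0) (a : Fin n → k)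
    (v : Fin 0 → Fin n → k) : wedge c f (Matrix.vecCons a v) = a c • f v := by
  rw [wedge_apply, Fin.sum_univ_one]
  simp only [Fin.val_zero, pow_zero, one_smul, Matrix.cons_val_zero]
  congr 2

/-- Contraction is an antiderivation. Homological degree zero is treated apart because `f` has then
no argument to contract. -/
lemma wedge_vecCons (c : Fin n) {i : ℕ} (f : KoszulChain k n V (i + 1)) (a : Fin n → k)
    (v : Fin (i + 1) → Fin n → k) :
    wedge c f (Matrix.vecCons a v) = a c • f v - wedge c (f.curryLeft a) v := by
  rw [wedge_apply, Fin.sum_univ_succ, wedge_apply, sub_eq_add_neg, ← Finset.sum_neg_distrib]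
  congr 1
  · simp [Fin.removeNth_zero]
  · refine Finset.sum_congr rfl fun j _ => ?_
    rw [Fin.val_succ, pow_succ, mul_neg_one, neg_smul, Matrix.cons_val_succ,
      AlternatingMap.curryLeft_apply_apply]
    congr 4
    funext m
    refine Fin.cases ?_ (fun m => ?_) m
    · rfl
    · simp [Fin.removeNth]

lemma koszulD_wedge_zero (x : Fin n → Module.End k V) (c : Fin n) (f : KoszulChain k n V 0) :
    koszulD x 0 (wedge c f) = (x c).compAlternatingMap f := by
  ext v
  rw [koszulD_apply, Finset.sum_eq_single c]
  · simp [wedge_vecCons_zero]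
  · intro l _ hl
    simp [wedge_vecCons_zero, Pi.single_eq_of_ne' hl]
  · simp

/-- Wedging with the `c`-th coordinate is a homotopy between multiplication by `x c` and zero. -/
lemma koszulD_wedge (x : Fin n → Module.End k V) (c : Fin n) {i : ℕ}
    (f : KoszulChain k n V (i + 1)) :
    koszulD x (i + 1) (wedge c f) = (x c).compAlternatingMap f - wedge c (koszulD x i f) := by
  ext v
  simp only [koszulD_apply, wedge_vecCons, map_sub, Finset.sum_sub_distrib,
    AlternatingMap.sub_apply, LinearMap.compAlternatingMap_apply]
  congr 1
  · rw [Finset.sum_eq_single c]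
    · simp
    · intro l _ hl
      simp [Pi.single_eq_of_ne' hl]
    · simp
  · simp only [wedge_apply, map_sum, koszulD_apply, Finset.smul_sum]
    rw [Finset.sum_comm]
    simp

variable (x δ : Fin n → Module.End k V)

/-- Only the summand `l = c` of the differential fails to commute with `δ c`, and it leaves the
commutator. -/
lemma koszulD_comp_division (h1 : ∀ c l, c ≠ l → Commute (δ c) (x l)) (c : Fin n) {i : ℕ}
    (f : KoszulChain k n V (i + 1)) :
    koszulD x i ((δ c).compAlternatingMap f) = (δ c).compAlternatingMap (koszulD x i f) +
      (x c * δ c - δ c * x c).compAlternatingMap (f.curryLeft (Pi.single c 1)) := by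
  ext v
  simp only [koszulD_apply, LinearMap.compAlternatingMap_apply, map_sum,
    AlternatingMap.add_apply]
  rw [← sub_eq_iff_eq_add', ← Finset.sum_sub_distrib, Finset.sum_eq_single c]
  · simp
  · intro l _ hl
    have := LinearMap.congr_fun (h1 c l hl.symm).eq (f (Matrix.vecCons (Pi.single l 1) v))
    simp only [Module.End.mul_apply] at this
    rw [this, sub_self]
  · simp

/-- One step of the reduction of a cycle. -/
lemma division_step (h1 : ∀ c l, c ≠ l → Commute (δ c) (x l)) (h2 : ∀ c l, Commute (δ c) (δ l))
    (h3 : ∀ c, δ c * x c * δ c = δ c) (h4 : ∀ c, δ c * δ c * x c = δ c) (c : Fin n) {i : ℕ}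
    {f : KoszulChain k n V i} (hf : f ∈ koszulCycles x i) (b : Fin n)
    (hb : b = c ∨ (δ b).compAlternatingMap f = 0) :
    (δ b).compAlternatingMap (f - koszulD x i (wedge c ((δ c).compAlternatingMap f))) = 0 := by
  -- This handles the term `f - x_c δ_c f` of the corrected cycle: `h3` for `b = c`, commutation
  -- otherwise.
  have main : ∀ y : V, (b = c ∨ δ b y = 0) → δ b (y - x c (δ c y)) = 0 := by
    rintro y (rfl | hy)
    · have := LinearMap.congr_fun (h3 b) y
      simp only [Module.End.mul_apply] at this
      rw [map_sub, this, sub_self]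
    · by_cases hbc : b = c
      · subst hbc
        simp [hy]
      · have e1 := LinearMap.congr_fun (h1 b c hbc).eq (δ c y)
        have e2 := LinearMap.congr_fun (h2 b c).eq y
        simp only [Module.End.mul_apply] at e1 e2
        rw [map_sub, e1, e2, hy, map_zero, map_zero, sub_zero]
  have hb' : ∀ v, b = c ∨ δ b (f v) = 0 := fun v => hb.imp_right fun h => DFunLike.congr_fun h v
  cases i with
  | zero =>
    rw [koszulD_wedge_zero]
    ext v
    exact main (f v) (hb' v)
  | succ i =>
    have hf' : koszulD x i f = 0 := hf
    rw [koszulD_wedge, koszulD_comp_division x δ h1, hf']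
    -- The remaining wedge term carries the commutator of `x_c` and `δ_c`. It is killed by `δ_c`,
    -- since `δ_c x_c δ_c` and `δ_c δ_c x_c` both equal `δ_c`. For `b ≠ c`, `δ_b` moves past it to
    -- an argument that it annihilates.
    have e : (δ b).compAlternatingMap (wedge c ((δ c).compAlternatingMap (0 : KoszulChain k n V i) +
        (x c * δ c - δ c * x c).compAlternatingMap (f.curryLeft (Pi.single c 1)))) = 0 := by
      rw [comp_wedge]
      have : (δ b).compAlternatingMap ((δ c).compAlternatingMap (0 : KoszulChain k n V i) +
          (x c * δ c - δ c * x c).compAlternatingMap (f.curryLeft (Pi.single c 1))) = 0 := by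
        ext v
        simp only [LinearMap.compAlternatingMap_apply, AlternatingMap.add_apply,
          AlternatingMap.zero_apply, map_zero, zero_add, AlternatingMap.curryLeft_apply_apply]
        generalize hy : f (Matrix.vecCons (Pi.single c 1) v) = y
        have hyb : b = c ∨ δ b y = 0 := hy ▸ hb' _
        by_cases hbc : b = c
        · subst hbc
          have e1 := LinearMap.congr_fun (h3 b) y
          have e2 := LinearMap.congr_fun (h4 b) y
          simp only [Module.End.mul_apply] at e1 e2
          simp [e1, e2]
        · have hy0 := hyb.resolve_left hbc
          have e1 := fun y => LinearMap.congr_fun (h1 b c hbc).eq y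
          have e2 := fun y => LinearMap.congr_fun (h2 b c).eq y
          simp only [Module.End.mul_apply] at e1 e2
          simp [e1, e2, hy0]
      rw [this]
      ext v
      simp [wedge_apply]
    ext v
    have e' := DFunLike.congr_fun e v
    have m := main (f v) (hb' v)
    simp only [LinearMap.compAlternatingMap_apply, AlternatingMap.sub_apply,
      AlternatingMap.zero_apply] at e' ⊢
    rw [← sub_add, map_add, m, e', zero_add]

/-- Every cycle is homologous to one that is killed by all division operators. -/
lemma exists_reduced (hx : ∀ l m, Commute (x l) (x m))
    (h1 : ∀ c l, c ≠ l → Commute (δ c) (x l)) (h2 : ∀ c l, Commute (δ c) (δ l))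
    (h3 : ∀ c, δ c * x c * δ c = δ c) (h4 : ∀ c, δ c * δ c * x c = δ c) (P Q : Submodule k V)
    (hPQ : ∀ c, ∀ y ∈ P, δ c y ∈ Q) (hQP : ∀ c, ∀ y ∈ Q, x c y ∈ P) {i : ℕ}
    {f : KoszulChain k n V i} (hf : f ∈ koszulCycles x i) (hfP : f ∈ chainsIn P i) :
    ∃ g ∈ chainsIn Q (i + 1), ∀ c, (δ c).compAlternatingMap (f - koszulD x i g) = 0 := by
  classical
  -- The correction for `c` preserves the vanishing already achieved for other variables, so they
  -- can be treated one after another.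
  suffices ∀ s : Finset (Fin n), ∃ g ∈ chainsIn Q (i + 1),
      ∀ c ∈ s, (δ c).compAlternatingMap (f - koszulD x i g) = 0 by
    obtain ⟨g, hg, h⟩ := this Finset.univ
    exact ⟨g, hg, fun c => h c (Finset.mem_univ c)⟩
  intro s
  induction s using Finset.induction_on with
  | empty => exact ⟨0, Submodule.zero_mem _, by simp⟩
  | insert c s _ ih =>
    obtain ⟨g, hg, h⟩ := ih
    set f' := f - koszulD x i g with hf'
    have hcyc : f' ∈ koszulCycles x i := sub_mem hf (koszulD_mem_cycles x hx g)
    have hP' : f' ∈ chainsIn P i := sub_mem hfP fun v => by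
      rw [koszulD_apply]
      exact Submodule.sum_mem _ fun l _ => hQP _ _ (hg _)
    refine ⟨g + wedge c ((δ c).compAlternatingMap f'),
      add_mem hg (wedge_mem fun v => hPQ c _ (hP' v)), fun b hb => ?_⟩
    rw [map_add, ← sub_sub, ← hf']
    exact division_step x δ h1 h2 h3 h4 c hcyc b ((Finset.mem_insert.1 hb).imp_right (h b))

end Reduction

/-! ## Acyclicity of free modules -/

section Free

variable {k : Type u} [Field k] {n : ℕ}

/-- Multiplication by a variable. -/
def mulX (k : Type u) [Field k] {n : ℕ} (F : Type v) [AddCommGroup F] [Module k F]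
    [Module (MvPolynomial (Fin n) k) F] [IsScalarTower k (MvPolynomial (Fin n) k) F] (l : Fin n) :
    Module.End k F where
  toFun m := (X l : MvPolynomial (Fin n) k) • m
  map_add' := smul_add _
  map_smul' c m := by
    rw [RingHom.id_apply, ← algebraMap_smul (MvPolynomial (Fin n) k) c m, smul_smul, mul_comm,
      mul_smul, algebraMap_smul]

variable {F : Type v} [AddCommGroup F] [Module k F]
    [Module (MvPolynomial (Fin n) k) F] [IsScalarTower k (MvPolynomial (Fin n) k) F]

lemma mulX_apply (l : Fin n) (m : F) : mulX k F l m = (X l : MvPolynomial (Fin n) k) • m := rfl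

lemma mulX_comm (l m : Fin n) : Commute (mulX k F l) (mulX k F m) := by
  refine LinearMap.ext fun y => ?_
  simp only [Module.End.mul_apply, mulX_apply, smul_smul, mul_comm]

/-- Division of a polynomial by a variable, forgetting the remainder. -/
def divX (c : Fin n) : Module.End k (MvPolynomial (Fin n) k) where
  toFun f := divMonomial f (Finsupp.single c 1)
  map_add' f g := add_divMonomial f g _
  map_smul' a f := by
    ext s
    simp [coeff_divMonomial]

lemma coeff_divX (c : Fin n) (f : MvPolynomial (Fin n) k) (s : Fin n →₀ ℕ) :
    coeff s (divX c f) = coeff (Finsupp.single c 1 + s) f :=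
  coeff_divMonomial _ _ _

lemma divX_X_mul (c : Fin n) (f : MvPolynomial (Fin n) k) : divX c (X c * f) = f :=
  X_mul_divMonomial c f

lemma divX_X_mul_of_ne {c l : Fin n} (h : c ≠ l) (f : MvPolynomial (Fin n) k) :
    divX c (X l * f) = X l * divX c f := by
  ext s
  rw [coeff_divX, coeff_X_mul', coeff_X_mul']
  have e : l ∈ (Finsupp.single c 1 + s).support ↔ l ∈ s.support := by
    simp [h]
  by_cases hl : l ∈ s.support
  · rw [if_pos (e.2 hl), if_pos hl, coeff_divX]
    congr 1
    ext b
    simp only [Finsupp.tsub_apply, Finsupp.add_apply, Finsupp.single_apply]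
    have := Finsupp.mem_support_iff.1 hl
    split_ifs <;> omega
  · rw [if_neg (fun h' => hl (e.1 h')), if_neg hl]

lemma divX_comm (c l : Fin n) (f : MvPolynomial (Fin n) k) :
    divX c (divX l f) = divX l (divX c f) := by
  ext s
  simp only [coeff_divX]
  rw [add_left_comm]

/-- Coordinatewise division by a variable in a free module. -/
def divXFree {ι : Type*} (b : Module.Basis ι (MvPolynomial (Fin n) k) F) (c : Fin n) :
    Module.End k F :=
  (b.repr.symm.toLinearMap.restrictScalars k) ∘ₗ
    (Finsupp.mapRange.linearMap (divX c)) ∘ₗ (b.repr.toLinearMap.restrictScalars k)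

lemma repr_divXFree {ι : Type*} (b : Module.Basis ι (MvPolynomial (Fin n) k) F) (c : Fin n)
    (m : F) (a : ι) : b.repr (divXFree b c m) a = divX c (b.repr m a) := by
  simp [divXFree]

lemma divXFree_mulX {ι : Type*} (b : Module.Basis ι (MvPolynomial (Fin n) k) F) (c : Fin n)
    (m : F) : divXFree b c (mulX k F c m) = m := by
  refine b.ext_elem fun a => ?_
  rw [repr_divXFree, mulX_apply, map_smul, Finsupp.smul_apply, smul_eq_mul, divX_X_mul]

lemma divXFree_mulX_of_ne {ι : Type*} (b : Module.Basis ι (MvPolynomial (Fin n) k) F)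
    {c l : Fin n} (h : c ≠ l) (m : F) :
    divXFree b c (mulX k F l m) = mulX k F l (divXFree b c m) := by
  refine b.ext_elem fun a => ?_
  rw [repr_divXFree]
  simp only [mulX_apply, map_smul, Finsupp.smul_apply, smul_eq_mul]
  rw [divX_X_mul_of_ne h, repr_divXFree]

lemma alternating_eq_zero {V : Type w} [AddCommGroup V] [Module k V] {i : ℕ}
    {f : KoszulChain k n V (i + 1)} (h : ∀ c v, f (Matrix.vecCons (Pi.single c 1) v) = 0) :
    f = 0 := by
  have : f.curryLeft = 0 := by
    refine (Pi.basisFun k (Fin n)).ext fun c => ?_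
    ext v
    rw [Pi.basisFun_apply]
    exact h c v
  ext v
  rw [← Matrix.cons_head_tail v]
  exact DFunLike.congr_fun (LinearMap.congr_fun this (Matrix.vecHead v)) (Matrix.vecTail v)

/-- In coordinates, division by `x_c` is a left inverse of multiplication by `x_c` and commutes with
the other variables. After reduction, every division operator kills `f'`. Applying the `c`-th one to
`∂ f' = 0` then isolates the value of `f'` with first argument the `c`-th basis vector, so `f' = 0`.
-/
lemma free_koszul_exact [Module.Free (MvPolynomial (Fin n) k) F] {i : ℕ}
    {f : KoszulChain k n F (i + 1)} (hf : koszulD (mulX k F) i f = 0) :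
    ∃ g, koszulD (mulX k F) (i + 1) g = f := by
  let b := Module.Free.chooseBasis (MvPolynomial (Fin n) k) F
  have h1 : ∀ c l, c ≠ l → Commute (divXFree b c) (mulX k F l) := fun c l h =>
    LinearMap.ext fun m => divXFree_mulX_of_ne b h m
  have h0 : ∀ c, divXFree b c * mulX k F c = 1 := fun c =>
    LinearMap.ext fun m => divXFree_mulX b c m
  obtain ⟨g, -, hg⟩ := exists_reduced (mulX k F) (divXFree b) mulX_comm h1
    (fun c l => LinearMap.ext fun m => b.ext_elem fun a => by
      simp only [Module.End.mul_apply, repr_divXFree]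
      exact divX_comm c l _)
    (fun c => by rw [h0, one_mul]) (fun c => by rw [mul_assoc, h0, mul_one]) ⊤ ⊤
    (fun _ _ _ => trivial) (fun _ _ _ => trivial) (i := i + 1) (f := f) hf (fun _ => trivial)
  refine ⟨g, ?_⟩
  set f' := f - koszulD (mulX k F) (i + 1) g with hf'
  have hcyc : koszulD (mulX k F) i f' = 0 := by
    rw [hf', map_sub, hf, koszulD_koszulD _ mulX_comm, sub_zero]
  have hg' : ∀ c v, divXFree b c (f' v) = 0 := fun c v => DFunLike.congr_fun (hg c) v
  refine (sub_eq_zero.1 (alternating_eq_zero (f := f') fun c v => ?_)).symm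
  have h := congrArg (divXFree b c) (DFunLike.congr_fun hcyc v)
  rw [koszulD_apply, map_sum, AlternatingMap.zero_apply, map_zero, Finset.sum_eq_single c] at h
  · rwa [divXFree_mulX] at h
  · intro l _ hl
    rw [divXFree_mulX_of_ne b hl.symm, hg', map_zero]
  · simp

end Free

/-! ## Modules spanned by convex sets of monomials -/

section Monomials

variable (k : Type u) [Field k] {n : ℕ}

/-- A set of exponents that is convex for divisibility by variables. -/
def IsConvexSet (E : Set (Fin n →₀ ℕ)) : Prop :=
  ∀ a l m, a ∈ E → a + Finsupp.single l 1 + Finsupp.single m 1 ∈ E → a + Finsupp.single l 1 ∈ E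

open Classical in
/-- Multiplication by a variable on the module spanned by a convex set of monomials. -/
def setX (E : Set (Fin n →₀ ℕ)) (l : Fin n) : Module.End k ((Fin n →₀ ℕ) →₀ k) :=
  Finsupp.linearCombination k fun a =>
    if a ∈ E ∧ a + Finsupp.single l 1 ∈ E then
      Finsupp.single (a + Finsupp.single l 1 : Fin n →₀ ℕ) 1 else 0

variable {k}

lemma setX_single_of_mem {E : Set (Fin n →₀ ℕ)} {l : Fin n} {a : Fin n →₀ ℕ} (h : a ∈ E)
    (h' : a + Finsupp.single l 1 ∈ E) :
    setX k E l (Finsupp.single a 1) = Finsupp.single (a + Finsupp.single l 1 : Fin n →₀ ℕ) 1 := by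
  rw [setX, Finsupp.linearCombination_single, one_smul, if_pos ⟨h, h'⟩]

lemma setX_single_of_notMem {E : Set (Fin n →₀ ℕ)} {l : Fin n} {a : Fin n →₀ ℕ}
    (h : ¬ (a ∈ E ∧ a + Finsupp.single l 1 ∈ E)) : setX k E l (Finsupp.single a 1) = 0 := by
  rw [setX, Finsupp.linearCombination_single, one_smul, if_neg h]

open Classical in
-- Convexity puts the intermediate monomial in `E` as soon as both ends are there, so either
-- composite is decided by the ends alone.
lemma setX_comm {E : Set (Fin n →₀ ℕ)} (hE : IsConvexSet E) (l m : Fin n) :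
    Commute (setX k E l) (setX k E m) := by
  have key : ∀ l m : Fin n, ∀ a, setX k E l (setX k E m (Finsupp.single a 1)) =
      if a ∈ E ∧ a + Finsupp.single m 1 + Finsupp.single l 1 ∈ E then
        Finsupp.single (a + Finsupp.single m 1 + Finsupp.single l 1) 1 else 0 := by
    intro l m a
    split_ifs with h
    · have h' := hE a m l h.1 h.2
      rw [setX_single_of_mem h.1 h', setX_single_of_mem h' h.2]
    · by_cases h' : a ∈ E ∧ a + Finsupp.single m 1 ∈ E
      · rw [setX_single_of_mem h'.1 h'.2, setX_single_of_notMem fun h'' => h ⟨h'.1, h''.2⟩]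
      · rw [setX_single_of_notMem h', map_zero]
  refine Finsupp.lhom_ext' fun a => LinearMap.ext_ring ?_
  change setX k E l (setX k E m (Finsupp.single a 1)) = setX k E m (setX k E l (Finsupp.single a 1))
  rw [key, key, add_right_comm]

/-- The part of degree `z` of the module spanned by a set of monomials. -/
def setD (k : Type u) [Field k] (E : Set (Fin n →₀ ℕ)) (z : ℤ) :
    Submodule k ((Fin n →₀ ℕ) →₀ k) :=
  Finsupp.supported k k {a | a ∈ E ∧ (a.degree : ℤ) = z}

lemma setD_induction {E : Set (Fin n →₀ ℕ)} {z : ℤ} {W : Type w} [AddCommGroup W] [Module k W]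
    {p : Submodule k W} (T : ((Fin n →₀ ℕ) →₀ k) →ₗ[k] W)
    (h : ∀ a ∈ E, (a.degree : ℤ) = z → T (Finsupp.single a 1) ∈ p) :
    ∀ y ∈ setD k E z, T y ∈ p := by
  intro y hy
  rw [setD, Finsupp.supported_eq_span_single] at hy
  have : Submodule.span k
      ((fun a => Finsupp.single a (1 : k)) '' {a | a ∈ E ∧ (a.degree : ℤ) = z}) ≤
      p.comap T := by
    rw [Submodule.span_le]
    rintro _ ⟨a, ha, rfl⟩
    exact h a ha.1 ha.2
  exact this hy

lemma setD_ext {E : Set (Fin n →₀ ℕ)} {z : ℤ} {W : Type w} [AddCommGroup W] [Module k W]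
    (T T' : ((Fin n →₀ ℕ) →₀ k) →ₗ[k] W)
    (h : ∀ a ∈ E, (a.degree : ℤ) = z → T (Finsupp.single a 1) = T' (Finsupp.single a 1)) :
    ∀ y ∈ setD k E z, T y = T' y := by
  intro y hy
  have := setD_induction (p := (⊥ : Submodule k W)) (T - T') (fun a ha hz => by
    rw [LinearMap.sub_apply, h a ha hz, sub_self]
    exact Submodule.zero_mem _) y hy
  exact sub_eq_zero.1 this

lemma setD_mono {E E' : Set (Fin n →₀ ℕ)} (h : E' ⊆ E) (z : ℤ) : setD k E' z ≤ setD k E z :=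
  Finsupp.supported_mono fun _ ha => ⟨h ha.1, ha.2⟩

lemma single_mem_setD {E : Set (Fin n →₀ ℕ)} {z : ℤ} {a : Fin n →₀ ℕ} (ha : a ∈ E)
    (hz : (a.degree : ℤ) = z) (c : k) : Finsupp.single a c ∈ setD k E z :=
  Finsupp.single_mem_supported k c ⟨ha, hz⟩

lemma degree_add_single (a : Fin n →₀ ℕ) (l : Fin n) :
    (a + Finsupp.single l 1).degree = a.degree + 1 := by
  rw [map_add, Finsupp.degree_single]

variable (k) in
/-- The module spanned by a convex set of monomials. -/
abbrev ofSet (E : Set (Fin n →₀ ℕ)) (hE : IsConvexSet E) : OpModule.{u, u} k n where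
  V := (Fin n →₀ ℕ) →₀ k
  x := setX k E
  comm := setX_comm hE
  D := setD k E
  x_mem l z := setD_induction _ fun a ha hz => by
    by_cases h : a ∈ E ∧ a + Finsupp.single l 1 ∈ E
    · rw [setX_single_of_mem h.1 h.2]
      exact single_mem_setD h.2 (by rw [degree_add_single, Nat.cast_add, hz, Nat.cast_one]) _
    · rw [setX_single_of_notMem h]
      exact Submodule.zero_mem _

open Classical in
/-- The projection to the span of a set of monomials. -/
def setProj (k : Type u) [Field k] (E : Set (Fin n →₀ ℕ)) : Module.End k ((Fin n →₀ ℕ) →₀ k) :=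
  Finsupp.linearCombination k fun a => if a ∈ E then Finsupp.single a 1 else 0

lemma setProj_single_of_mem {E : Set (Fin n →₀ ℕ)} {a : Fin n →₀ ℕ} (h : a ∈ E) :
    setProj k E (Finsupp.single a 1) = Finsupp.single a 1 := by
  rw [setProj, Finsupp.linearCombination_single, one_smul, if_pos h]

lemma setProj_single_of_notMem {E : Set (Fin n →₀ ℕ)} {a : Fin n →₀ ℕ} (h : a ∉ E) :
    setProj k E (Finsupp.single a 1) = 0 := by
  rw [setProj, Finsupp.linearCombination_single, one_smul, if_neg h]

lemma setProj_apply (E : Set (Fin n →₀ ℕ)) (y : (Fin n →₀ ℕ) →₀ k) {a : Fin n →₀ ℕ}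
    (h : a ∈ E) : setProj k E y a = y a := by
  have : (Finsupp.lapply a) ∘ₗ setProj k E = (Finsupp.lapply a : ((Fin n →₀ ℕ) →₀ k) →ₗ[k] k) := by
    refine Finsupp.lhom_ext' fun b => LinearMap.ext_ring ?_
    change setProj k E (Finsupp.single b 1) a = Finsupp.single b 1 a
    by_cases hb : b ∈ E
    · rw [setProj_single_of_mem hb]
    · rw [setProj_single_of_notMem hb, Finsupp.single_eq_of_ne (fun e => hb (by rwa [← e]))]
      rfl
  exact LinearMap.congr_fun this y

lemma setProj_of_mem {E E' : Set (Fin n →₀ ℕ)} (hE : E' ⊆ E) {z : ℤ} (y : (Fin n →₀ ℕ) →₀ k)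
    (hy : y ∈ setD k E' z) : setProj k E y = y :=
  setD_ext (setProj k E) LinearMap.id (fun _ ha _ => setProj_single_of_mem (hE ha)) y hy

/-- The sequence given by a subset that is closed under multiplication inside a convex set. -/
lemma ofSet_shortExact {E E' : Set (Fin n →₀ ℕ)} (hE : IsConvexSet E) (hE' : IsConvexSet E')
    (hd : IsConvexSet (E \ E')) (hsub : E' ⊆ E)
    (hup : ∀ a l, a ∈ E' → a + Finsupp.single l 1 ∈ E → a + Finsupp.single l 1 ∈ E') :
    OpModule.IsShortExact (ofSet k E' hE') (ofSet k E hE) (ofSet k (E \ E') hd)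
      LinearMap.id (setProj k (E \ E')) where
  -- All three modules share one ambient space of functions on exponents and differ in their
  -- operators and graded pieces. The inclusion is therefore the identity, and every condition is
  -- tested on the graded pieces only.
  left :=
    { map_mem := fun z y hy => setD_mono hsub z hy
      map_x := fun l z => setD_ext (setX k E' l) (setX k E l) fun a ha _ => by
        by_cases h : a + Finsupp.single l 1 ∈ E
        · rw [setX_single_of_mem ha (hup a l ha h), setX_single_of_mem (hsub ha) h]
        · rw [setX_single_of_notMem fun h' => h (hsub h'.2),
            setX_single_of_notMem fun h' => h h'.2] }
  right :=
    { map_mem := fun z => setD_induction _ fun a ha hz => by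
        by_cases h : a ∈ E \ E'
        · rw [setProj_single_of_mem h]
          exact single_mem_setD h hz _
        · rw [setProj_single_of_notMem h]
          exact Submodule.zero_mem _
      map_x := fun l z => setD_ext (setProj k (E \ E') ∘ₗ setX k E l)
          (setX k (E \ E') l ∘ₗ setProj k (E \ E')) fun a ha hz => by
        simp only [LinearMap.comp_apply]
        by_cases ha' : a ∈ E'
        · rw [setProj_single_of_notMem fun h => h.2 ha', map_zero]
          by_cases h : a + Finsupp.single l 1 ∈ E
          · rw [setX_single_of_mem ha h, setProj_single_of_notMem fun h' => h'.2 (hup a l ha' h)]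
          · rw [setX_single_of_notMem fun h' => h h'.2, map_zero]
        · rw [setProj_single_of_mem (⟨ha, ha'⟩ : a ∈ E \ E')]
          by_cases h : a + Finsupp.single l 1 ∈ E
          · rw [setX_single_of_mem ha h]
            by_cases h' : a + Finsupp.single l 1 ∈ E'
            · rw [setProj_single_of_notMem fun h'' => h''.2 h',
                setX_single_of_notMem fun h'' => h''.2.2 h']
            · rw [setProj_single_of_mem (⟨h, h'⟩ : _ ∈ E \ E'),
                setX_single_of_mem (E := E \ E') ⟨ha, ha'⟩ ⟨h, h'⟩]
          · rw [setX_single_of_notMem fun h' => h h'.2, map_zero,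
              setX_single_of_notMem fun h' => h h'.2.1] }
  inj _ _ _ h := h
  zero z := setD_ext (setProj k (E \ E') ∘ₗ LinearMap.id) 0 fun a ha _ =>
    setProj_single_of_notMem fun h => h.2 ha
  exact z y hy h0 := by
    refine ⟨y, (Finsupp.mem_supported' k y).2 fun a ha => ?_, rfl⟩
    by_contra hne
    have h1 := not_imp_comm.1 ((Finsupp.mem_supported' k y).1 hy a) hne
    have h2 : a ∉ E' := fun h => ha ⟨h, h1.2⟩
    have h3 := setProj_apply (E \ E') y (⟨h1.1, h2⟩ : a ∈ E \ E')
    rw [h0] at h3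
    exact hne h3.symm
  surj z y hy := ⟨y, setD_mono Set.sdiff_subset z hy,
    setProj_of_mem subset_rfl y hy⟩

/-- Sets of monomials that are disjoint unions of orthants: membership depends only on the
exponents truncated at `t`, and the truncated exponents have constant sum `d`. -/
structure IsOrthantUnion (E : Set (Fin n →₀ ℕ)) (t d : ℕ) : Prop where
  mem_of_min_eq : ∀ a b : Fin n →₀ ℕ, (∀ l, min (a l) t = min (b l) t) → a ∈ E → b ∈ E
  sum_min : ∀ a ∈ E, ∑ l, min (a l) t = d

namespace IsOrthantUnion

variable {E : Set (Fin n →₀ ℕ)} {t d : ℕ}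

lemma sum_min_lt (a : Fin n →₀ ℕ) {l : Fin n} (h : a l < t) :
    ∑ j, min (a j) t < ∑ j, min ((a + Finsupp.single l 1 : Fin n →₀ ℕ) j) t := by
  refine Finset.sum_lt_sum (fun j _ => min_le_min_right _ (by simp)) ⟨l, Finset.mem_univ l, ?_⟩
  simp only [Finsupp.add_apply, Finsupp.single_eq_same]
  omega

lemma sum_min_le (a : Fin n →₀ ℕ) (l : Fin n) :
    ∑ j, min (a j) t ≤ ∑ j, min ((a + Finsupp.single l 1 : Fin n →₀ ℕ) j) t :=
  Finset.sum_le_sum fun j _ => min_le_min_right _ (by simp)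

lemma min_add_single {a : Fin n →₀ ℕ} {l : Fin n} (h : t ≤ a l) (j : Fin n) :
    min (a j) t = min ((a + Finsupp.single l 1 : Fin n →₀ ℕ) j) t := by
  simp only [Finsupp.add_apply, Finsupp.single_apply]
  split_ifs with hj
  · subst hj
    omega
  · simp

lemma add_mem (h : IsOrthantUnion E t d) {a : Fin n →₀ ℕ} (ha : a ∈ E) {l : Fin n}
    (hl : t ≤ a l) : a + Finsupp.single l 1 ∈ E :=
  h.mem_of_min_eq _ _ (min_add_single hl) ha

lemma of_add_mem (h : IsOrthantUnion E t d) {a : Fin n →₀ ℕ} {l : Fin n}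
    (ha : a + Finsupp.single l 1 ∈ E) (hl : t ≤ a l) : a ∈ E :=
  h.mem_of_min_eq _ _ (fun j => (min_add_single hl j).symm) ha

/-- Raising an exponent below `t` would increase the truncated sum, which is constant on `E`. Inside
`E` one therefore moves only in directions where the exponent is already at least `t`. -/
lemma le_of_add_mem (h : IsOrthantUnion E t d) {a : Fin n →₀ ℕ} (ha : a ∈ E) {l : Fin n}
    (hl : a + Finsupp.single l 1 ∈ E) : t ≤ a l := by
  by_contra hlt
  have := sum_min_lt a (not_le.1 hlt)
  rw [h.sum_min a ha, h.sum_min _ hl] at this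
  exact this.false

lemma isConvexSet (h : IsOrthantUnion E t d) : IsConvexSet E := by
  intro a l m ha hlm
  refine h.add_mem ha ?_
  by_contra hlt
  have h1 := sum_min_lt a (not_le.1 hlt)
  have h2 := sum_min_le (t := t) (a + Finsupp.single l 1 : Fin n →₀ ℕ) m
  rw [h.sum_min a ha] at h1
  rw [h.sum_min _ hlm] at h2
  omega

lemma setX_single (h : IsOrthantUnion E t d) {a : Fin n →₀ ℕ} (ha : a ∈ E) {l : Fin n}
    (hl : t ≤ a l) :
    setX k E l (Finsupp.single a 1) = Finsupp.single (a + Finsupp.single l 1 : Fin n →₀ ℕ) 1 :=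
  setX_single_of_mem ha (h.add_mem ha hl)

lemma setX_single_eq_zero (h : IsOrthantUnion E t d) {a : Fin n →₀ ℕ} {l : Fin n}
    (hl : ¬ (a ∈ E ∧ t ≤ a l)) : setX k E l (Finsupp.single a 1) = 0 :=
  setX_single_of_notMem fun h' => hl ⟨h'.1, h.le_of_add_mem h'.1 h'.2⟩

end IsOrthantUnion

open Classical in
/-- Division by a variable on the span of a union of orthants. -/
def setDiv (k : Type u) [Field k] (E : Set (Fin n →₀ ℕ)) (t : ℕ) (c : Fin n) :
    Module.End k ((Fin n →₀ ℕ) →₀ k) :=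
  Finsupp.linearCombination k fun a =>
    if a ∈ E ∧ t < a c then Finsupp.single (a - Finsupp.single c 1) 1 else 0

lemma setDiv_single {E : Set (Fin n →₀ ℕ)} {t : ℕ} {c : Fin n} {a : Fin n →₀ ℕ}
    (ha : a + Finsupp.single c 1 ∈ E) (h : t ≤ a c) :
    setDiv k E t c (Finsupp.single (a + Finsupp.single c 1 : Fin n →₀ ℕ) 1) =
      Finsupp.single a 1 := by
  rw [setDiv, Finsupp.linearCombination_single, one_smul, if_pos, add_tsub_cancel_right]
  refine ⟨ha, ?_⟩
  simp only [Finsupp.add_apply, Finsupp.single_eq_same]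
  omega

lemma setDiv_single_eq_zero {E : Set (Fin n →₀ ℕ)} {t : ℕ} {c : Fin n} {a : Fin n →₀ ℕ}
    (h : ¬ (a ∈ E ∧ t < a c)) : setDiv k E t c (Finsupp.single a 1) = 0 := by
  rw [setDiv, Finsupp.linearCombination_single, one_smul, if_neg h]

lemma exists_eq_add_single {a : Fin n →₀ ℕ} {c : Fin n} {t : ℕ} (h : t < a c) :
    ∃ b : Fin n →₀ ℕ, a = b + Finsupp.single c 1 ∧ t ≤ b c := by
  have hle : Finsupp.single c 1 ≤ a := by
    rw [Finsupp.single_le_iff]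
    omega
  refine ⟨a - Finsupp.single c 1, (tsub_add_cancel_of_le hle).symm, ?_⟩
  simp only [Finsupp.tsub_apply, Finsupp.single_eq_same]
  omega

lemma end_ext {W : Type w} [AddCommGroup W] [Module k W]
    {T T' : ((Fin n →₀ ℕ) →₀ k) →ₗ[k] W}
    (h : ∀ a, T (Finsupp.single a 1) = T' (Finsupp.single a 1)) : T = T' :=
  Finsupp.lhom_ext' fun a => LinearMap.ext_ring (h a)

lemma setDiv_apply {E : Set (Fin n →₀ ℕ)} {t : ℕ} {c : Fin n} {a : Fin n →₀ ℕ}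
    (ha : a + Finsupp.single c 1 ∈ E) (hc : t ≤ a c) (y : (Fin n →₀ ℕ) →₀ k) :
    setDiv k E t c y a = y (a + Finsupp.single c 1) := by
  have : (Finsupp.lapply a) ∘ₗ setDiv k E t c =
      (Finsupp.lapply (a + Finsupp.single c 1) : ((Fin n →₀ ℕ) →₀ k) →ₗ[k] k) := by
    refine end_ext fun b => ?_
    simp only [LinearMap.comp_apply, Finsupp.lapply_apply]
    by_cases hb : b ∈ E ∧ t < b c
    · obtain ⟨hb, hbc⟩ := hb
      obtain ⟨b, rfl, hb'⟩ := exists_eq_add_single hbc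
      rw [setDiv_single hb hb']
      simp [Finsupp.single_apply]
    · rw [setDiv_single_eq_zero hb, Finsupp.single_eq_of_ne]
      · rfl
      · rintro rfl
        exact hb ⟨ha, by simpa using Nat.lt_succ_of_le hc⟩
  exact LinearMap.congr_fun this y

namespace IsOrthantUnion

variable {E : Set (Fin n →₀ ℕ)} {t d : ℕ}

lemma commute_div_X (h : IsOrthantUnion E t d) {c l : Fin n} (hcl : c ≠ l) :
    Commute (setDiv k E t c) (setX k E l) := by
  refine end_ext fun a => ?_
  simp only [Module.End.mul_apply]
  by_cases ha : a ∈ E ∧ t < a c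
  · obtain ⟨ha, hc⟩ := ha
    obtain ⟨b, rfl, hb⟩ := exists_eq_add_single hc
    have hbE := h.of_add_mem ha hb
    rw [setDiv_single ha hb]
    have e : (b + Finsupp.single c 1 : Fin n →₀ ℕ) l = b l := by simp [hcl]
    by_cases hl : t ≤ b l
    · have hl' : t ≤ (b + Finsupp.single c 1 : Fin n →₀ ℕ) l := e ▸ hl
      rw [h.setX_single ha hl', h.setX_single hbE hl, add_right_comm, setDiv_single]
      · rw [add_right_comm]
        exact h.add_mem ha hl'
      · simpa [hcl.symm] using hb
    · rw [h.setX_single_eq_zero fun h' => hl (e ▸ h'.2), h.setX_single_eq_zero fun h' => hl h'.2,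
        map_zero]
  · rw [setDiv_single_eq_zero ha, map_zero]
    by_cases hl : a ∈ E ∧ t ≤ a l
    · rw [h.setX_single hl.1 hl.2, setDiv_single_eq_zero]
      rintro ⟨-, h2⟩
      exact ha ⟨hl.1, by simpa [hcl.symm] using h2⟩
    · rw [h.setX_single_eq_zero hl, map_zero]

open Classical in
-- The closed form is symmetric in `c` and `l`, which gives commutation.
lemma div_div (h : IsOrthantUnion E t d) (c l : Fin n) (a : Fin n →₀ ℕ) :
    setDiv k E t c (setDiv k E t l (Finsupp.single a 1)) =
      if a ∈ E ∧ ∃ b : Fin n →₀ ℕ, a = b + Finsupp.single c 1 + Finsupp.single l 1 ∧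
          t ≤ b c ∧ t ≤ b l then
        Finsupp.single (a - Finsupp.single c 1 - Finsupp.single l 1) 1 else 0 := by
  split_ifs with H
  · obtain ⟨ha, b, rfl, hc, hl⟩ := H
    have hl' : t ≤ (b + Finsupp.single c 1 : Fin n →₀ ℕ) l := hl.trans (by simp)
    rw [setDiv_single ha hl', setDiv_single (h.of_add_mem ha hl') hc]
    rw [add_right_comm, add_tsub_cancel_right, add_tsub_cancel_right]
  · by_cases hl : a ∈ E ∧ t < a l
    · obtain ⟨ha, hl⟩ := hl
      obtain ⟨b, rfl, hb⟩ := exists_eq_add_single hl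
      rw [setDiv_single ha hb]
      refine setDiv_single_eq_zero fun hc => H ⟨ha, ?_⟩
      obtain ⟨b', rfl, hb'⟩ := exists_eq_add_single hc.2
      by_cases hcl : c = l
      · subst hcl
        exact ⟨b', rfl, hb', hb'⟩
      · exact ⟨b', rfl, hb', by simpa [hcl] using hb⟩
    · rw [setDiv_single_eq_zero hl, map_zero]

lemma commute_div_div (h : IsOrthantUnion E t d) (c l : Fin n) :
    Commute (setDiv k E t c) (setDiv k E t l) := by
  classical
  refine end_ext fun a => ?_
  simp only [Module.End.mul_apply]
  rw [h.div_div, h.div_div, tsub_right_comm]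
  refine if_congr ?_ rfl rfl
  constructor <;> rintro ⟨ha, b, rfl, h1, h2⟩ <;> exact ⟨ha, b, add_right_comm _ _ _, h2, h1⟩

lemma div_X_div (h : IsOrthantUnion E t d) (c : Fin n) :
    setDiv k E t c * setX k E c * setDiv k E t c = setDiv k E t c := by
  refine end_ext fun a => ?_
  simp only [Module.End.mul_apply]
  by_cases ha : a ∈ E ∧ t < a c
  · obtain ⟨ha, hc⟩ := ha
    obtain ⟨b, rfl, hb⟩ := exists_eq_add_single hc
    rw [setDiv_single ha hb, h.setX_single (h.of_add_mem ha hb) hb, setDiv_single ha hb]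
  · rw [setDiv_single_eq_zero ha, map_zero, map_zero]

/-- On monomials of `E` whose `c`-th exponent is at least `t`, division undoes multiplication. On
all others, multiplication and division by `x_c` are both zero. -/
lemma div_div_X (h : IsOrthantUnion E t d) (c : Fin n) :
    setDiv k E t c * setDiv k E t c * setX k E c = setDiv k E t c := by
  refine end_ext fun a => ?_
  simp only [Module.End.mul_apply]
  by_cases ha : a ∈ E ∧ t ≤ a c
  · rw [h.setX_single ha.1 ha.2, setDiv_single (h.add_mem ha.1 ha.2) ha.2]
  · rw [h.setX_single_eq_zero ha, map_zero, map_zero,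
      setDiv_single_eq_zero fun h' => ha ⟨h'.1, h'.2.le⟩]

/-- The module is a direct sum of copies of `S` modulo some variables, with generators in degree
`d`. A cycle killed by all divisions is supported on exponents that are at most `t` everywhere. Such
exponents equal their truncation and hence have degree `d`. -/
lemma vanishes (h : IsOrthantUnion E t d) (hE : IsConvexSet E) (i : ℕ) {z : ℤ} (hz : z ≠ d) :
    (ofSet k E hE).Vanishes i z := by
  rintro f ⟨hf, hfz⟩
  have hx : ∀ l z, ∀ y ∈ setD k E z, setX k E l y ∈ setD k E (z + 1) :=
    fun l z y hy => (ofSet k E hE).x_mem l z y hy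
  obtain ⟨g, hg, H⟩ := exists_reduced (setX k E) (setDiv k E t) (setX_comm hE)
    (fun c l => h.commute_div_X) h.commute_div_div h.div_X_div h.div_div_X
    (setD k E z) (setD k E (z - 1))
    (fun c => setD_induction _ fun a ha hdeg => by
      by_cases hc : t < a c
      · obtain ⟨b, rfl, hb⟩ := exists_eq_add_single hc
        rw [setDiv_single ha hb]
        refine single_mem_setD (h.of_add_mem ha hb) ?_ _
        rw [← hdeg, degree_add_single]
        simp
      · rw [setDiv_single_eq_zero fun h' => hc h'.2]
        exact Submodule.zero_mem _)
    (fun c y hy => by simpa using hx c _ y hy) hf hfz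
  refine ⟨g, hg, (sub_eq_zero.1 ?_).symm⟩
  have hmem : f - koszulD (setX k E) i g ∈ chainsIn (setD k E z) i :=
    fun v => Submodule.sub_mem _ (hfz v) ((ofSet k E hE).koszulD_mem' hg v)
  ext1 v
  have hv : ∀ c, setDiv k E t c ((f - koszulD (setX k E) i g) v) = 0 :=
    fun c => DFunLike.congr_fun (H c) v
  have hvD := hmem v
  change (f - koszulD (setX k E) i g) v = 0
  generalize (f - koszulD (setX k E) i g) v = y at hv hvD
  ext a
  by_contra hne
  have ha := not_imp_comm.1 ((Finsupp.mem_supported' k y).1 hvD a) hne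
  have : ∃ c, t < a c := by
    by_contra hcon
    push Not at hcon
    apply hz
    rw [← ha.2, ← h.sum_min a ha.1, Finsupp.degree_eq_sum]
    exact congrArg Nat.cast (Finset.sum_congr rfl fun l _ => (min_eq_left (hcon l)).symm)
  obtain ⟨c, hc⟩ := this
  -- The coefficient at `b + e_c` is read off at `b` after division by `x_c`, which gives zero.
  obtain ⟨b, rfl, hb⟩ := exists_eq_add_single hc
  rw [← setDiv_apply ha.1 hb, hv c] at hne
  exact hne rfl

end IsOrthantUnion

end Monomials

/-! ## Homogeneous components and the Koszul complex of an equivariant graded module -/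

namespace EquivGradedModule

variable {k : Type u} [Field k] {n : ℕ} (M : EquivGradedModule.{u, v} k n)

/-- The projection to the homogeneous component of degree `j`. -/
def proj (j : ℕ) : Module.End k M.carrier :=
  (M.deg j).subtype ∘ₗ DirectSum.component k ℕ (fun i => M.deg i) j ∘ₗ
    (LinearEquiv.ofBijective (DirectSum.coeLinearMap M.deg) M.isInternal).symm.toLinearMap

lemma proj_mem (j : ℕ) (m : M.carrier) : M.proj j m ∈ M.deg j := Subtype.prop _

lemma proj_of_mem (i j : ℕ) {m : M.carrier} (hm : m ∈ M.deg i) :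
    M.proj j m = if i = j then m else 0 := by
  have : (LinearEquiv.ofBijective (DirectSum.coeLinearMap M.deg) M.isInternal).symm m =
      DirectSum.lof k ℕ (fun i => M.deg i) i ⟨m, hm⟩ := by
    rw [LinearEquiv.symm_apply_eq]
    exact (DirectSum.coeLinearMap_lof M.deg i ⟨m, hm⟩).symm
  simp only [proj, LinearMap.comp_apply, LinearEquiv.coe_coe, this, DirectSum.component.of,
    Submodule.coe_subtype]
  split_ifs with h
  · subst h
    rfl
  · rfl

lemma homogeneous_induction {p : M.carrier → Prop} (m : M.carrier)
    (h : ∀ j, ∀ m ∈ M.deg j, p m) (h0 : p 0) (hadd : ∀ m m', p m → p m' → p (m + m')) : p m := by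
  have hm : m ∈ ⨆ j, M.deg j := by
    rw [M.isInternal.submodule_iSup_eq_top]
    trivial
  exact Submodule.iSup_induction _ (motive := p) hm h h0 hadd

lemma exists_sum_proj (m : M.carrier) : ∃ s : Finset ℕ, ∀ t, s ⊆ t → ∑ j ∈ t, M.proj j m = m := by
  classical
  refine M.homogeneous_induction
    (p := fun m => ∃ s : Finset ℕ, ∀ t, s ⊆ t → ∑ j ∈ t, M.proj j m = m) m
    (fun j m hm => ⟨{j}, fun t ht => ?_⟩)
    ⟨∅, fun t _ => by simp⟩ ?_
  · simp only [M.proj_of_mem j _ hm, Finset.sum_ite_eq]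
    rw [if_pos (ht (Finset.mem_singleton_self j))]
  · rintro m m' ⟨s, hs⟩ ⟨s', hs'⟩
    refine ⟨s ∪ s', fun t ht => ?_⟩
    simp only [map_add, Finset.sum_add_distrib, hs t (Finset.union_subset_left ht),
      hs' t (Finset.union_subset_right ht)]

/-- The homogeneous components, indexed by the integers. -/
def degZ : ℤ → Submodule k M.carrier
  | Int.ofNat j => M.deg j
  | Int.negSucc _ => ⊥

/-- The projections to the homogeneous components, indexed by the integers. -/
def projZ : ℤ → Module.End k M.carrier
  | Int.ofNat j => M.proj j
  | Int.negSucc _ => 0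

lemma projZ_mem (z : ℤ) (m : M.carrier) : M.projZ z m ∈ M.degZ z := by
  cases z with
  | ofNat j => exact M.proj_mem j m
  | negSucc j => exact Submodule.zero_mem _

lemma projZ_of_mem_deg {j : ℕ} (z : ℤ) {m : M.carrier} (hm : m ∈ M.deg j) :
    M.projZ z m = if (j : ℤ) = z then m else 0 := by
  cases z with
  | ofNat i =>
    change M.proj i m = _
    rw [M.proj_of_mem j i hm]
    exact if_congr (by simp) rfl rfl
  | negSucc i =>
    rw [if_neg (by omega)]
    rfl

lemma projZ_of_mem {z : ℤ} {m : M.carrier} (hm : m ∈ M.degZ z) : M.projZ z m = m := by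
  cases z with
  | ofNat j => exact (M.projZ_of_mem_deg _ hm).trans (if_pos rfl)
  | negSucc j =>
    rw [(Submodule.mem_bot k).1 hm]
    rfl

lemma X_smul_mem (l : Fin n) {j : ℕ} {m : M.carrier} (hm : m ∈ M.deg j) :
    (X l : MvPolynomial (Fin n) k) • m ∈ M.deg (j + 1) := by
  rw [add_comm]
  exact M.smul_mem 1 j _ m (isHomogeneous_X k l) hm

lemma projZ_X_smul (l : Fin n) (z : ℤ) (m : M.carrier) :
    M.projZ (z + 1) ((X l : MvPolynomial (Fin n) k) • m) =
      (X l : MvPolynomial (Fin n) k) • M.projZ z m := by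
  refine M.homogeneous_induction
    (p := fun m => M.projZ (z + 1) ((X l : MvPolynomial (Fin n) k) • m) =
      (X l : MvPolynomial (Fin n) k) • M.projZ z m) m (fun j m hm => ?_) (by simp)
    fun m m' h h' => by rw [smul_add, map_add, map_add, smul_add, h, h']
  rw [M.projZ_of_mem_deg z hm, M.projZ_of_mem_deg _ (M.X_smul_mem l hm)]
  by_cases h : (j : ℤ) = z
  · rw [if_pos h, if_pos (by rw [← h]; simp)]
  · rw [if_neg h, if_neg (by push_cast; omega), smul_zero]

lemma projZ_X_smul' (l : Fin n) (z : ℤ) (m : M.carrier) :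
    M.projZ z ((X l : MvPolynomial (Fin n) k) • m) =
      (X l : MvPolynomial (Fin n) k) • M.projZ (z - 1) m := by
  rw [← M.projZ_X_smul, sub_add_cancel]

/-- The multiplications by the variables as commuting operators. -/
abbrev toOp : OpModule.{u, v} k n where
  V := M.carrier
  x := mulX k M.carrier
  comm := mulX_comm
  D := M.degZ
  x_mem l z m hm := by
    rw [← M.projZ_of_mem hm, mulX_apply, ← M.projZ_X_smul]
    exact M.projZ_mem _ _

variable {M}

lemma vanishes_of_free [Module.Free (MvPolynomial (Fin n) k) M.carrier] (i : ℕ) (z : ℤ) :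
    M.toOp.Vanishes (i + 1) z := by
  rintro f ⟨hf, hfz⟩
  -- The primitive `g` need not be homogeneous; its component of degree `z - 1` has the same
  -- boundary.
  obtain ⟨g, hg⟩ := free_koszul_exact (F := M.carrier) (f := f) hf
  refine ⟨(M.projZ (z - 1)).compAlternatingMap g, fun v => M.projZ_mem _ _, ?_⟩
  ext v
  rw [← M.projZ_of_mem (hfz v), ← hg]
  simp only [koszulD_apply, LinearMap.compAlternatingMap_apply, mulX_apply, map_sum,
    M.projZ_X_smul']

lemma sum_X_smul_mem_mSub (c : Fin n → M.carrier) :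
    ∑ l, (X l : MvPolynomial (Fin n) k) • c l ∈ M.mSub := by
  change _ ∈ maxIdeal k n • (⊤ : Submodule (MvPolynomial (Fin n) k) M.carrier)
  refine Submodule.sum_mem _ fun l _ => Submodule.smul_mem_smul ?_ Submodule.mem_top
  exact Ideal.subset_span ⟨l, rfl⟩

lemma exists_of_mem_mSub {m : M.carrier} (hm : m ∈ M.mSub) :
    ∃ c : Fin n → M.carrier, m = ∑ l, (X l : MvPolynomial (Fin n) k) • c l := by
  classical
  change m ∈ maxIdeal k n • (⊤ : Submodule (MvPolynomial (Fin n) k) M.carrier) at hm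
  refine Submodule.smul_induction_on (p := fun m => ∃ c : Fin n → M.carrier,
    m = ∑ l, (X l : MvPolynomial (Fin n) k) • c l) hm (fun f hf y _ => ?_) ?_
  · refine Submodule.span_induction (p := fun f _ => ∃ c : Fin n → M.carrier,
      f • y = ∑ l, (X l : MvPolynomial (Fin n) k) • c l) ?_ ⟨0, by simp⟩ ?_ ?_ hf
    · rintro _ ⟨l, rfl⟩
      refine ⟨Pi.single l y, ?_⟩
      rw [Finset.sum_eq_single l]
      · simp
      · intro b _ hb
        simp [Pi.single_eq_of_ne hb]
      · simp
    · rintro f g - - ⟨c, hc⟩ ⟨c', hc'⟩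
      exact ⟨c + c', by simp [add_smul, hc, hc', Finset.sum_add_distrib]⟩
    · rintro a f - ⟨c, hc⟩
      refine ⟨a • c, ?_⟩
      rw [smul_eq_mul, mul_smul, hc, Finset.smul_sum]
      exact Finset.sum_congr rfl fun l _ => smul_comm _ _ _
  · rintro y y' ⟨c, rfl⟩ ⟨c', rfl⟩
    exact ⟨c + c', by simp [Finset.sum_add_distrib]⟩

lemma exists_graded_of_mem_mSub {z : ℤ} {m : M.carrier} (hz : m ∈ M.degZ z) (hm : m ∈ M.mSub) :
    ∃ c : Fin n → M.carrier, (∀ l, c l ∈ M.degZ (z - 1)) ∧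
      m = ∑ l, (X l : MvPolynomial (Fin n) k) • c l := by
  obtain ⟨c, rfl⟩ := exists_of_mem_mSub hm
  refine ⟨fun l => M.projZ (z - 1) (c l), fun l => M.projZ_mem _ _, ?_⟩
  conv_lhs => rw [← M.projZ_of_mem hz, map_sum]
  exact Finset.sum_congr rfl fun l _ => M.projZ_X_smul' l z (c l)

end EquivGradedModule

/-! ### Koszul chains in one variable -/

section OneChain

variable {k : Type u} [Field k] {n : ℕ} {V : Type v} [AddCommGroup V] [Module k V]
  {W : Type w} [AddCommGroup W] [Module k W]

/-- The Koszul chain in one variable with given values at the basis vectors. -/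
def oneChain (c : Fin n → V) : KoszulChain k n V 1 :=
  AlternatingMap.ofSubsingleton k (Fin n → k) V 0 ((Pi.basisFun k (Fin n)).constr k c)

lemma oneChain_apply (c : Fin n → V) (v : Fin 1 → Fin n → k) :
    oneChain c v = ∑ l, v 0 l • c l := by
  simp [oneChain, Module.Basis.constr_apply_fintype]

lemma oneChain_single (c : Fin n → V) (l : Fin n) (v : Fin 0 → Fin n → k) :
    oneChain (k := k) c (Matrix.vecCons (Pi.single l 1) v) = c l := by
  rw [oneChain_apply, Finset.sum_eq_single l]
  · simp
  · intro b _ hb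
    simp [Pi.single_eq_of_ne hb]
  · simp

lemma oneChain_mem {D : Submodule k V} {c : Fin n → V} (hc : ∀ l, c l ∈ D) :
    oneChain (k := k) c ∈ chainsIn D 1 := by
  intro v
  rw [oneChain_apply]
  exact Submodule.sum_mem _ fun l _ => D.smul_mem _ (hc l)

lemma koszulD_oneChain (x : Fin n → Module.End k V) (c : Fin n → V) (v : Fin 0 → Fin n → k) :
    koszulD x 0 (oneChain c) v = ∑ l, x l (c l) := by
  rw [koszulD_apply]
  exact Finset.sum_congr rfl fun l _ => congrArg _ (oneChain_single c l v)

lemma comp_oneChain (T : V →ₗ[k] W) (c : Fin n → V) :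
    T.compAlternatingMap (oneChain (k := k) c) = oneChain fun l => T (c l) := by
  ext v
  simp [oneChain_apply]

end OneChain

/-! ## Equivariant graded homomorphisms -/

namespace EquivGradedHom

variable {k : Type u} [Field k] {n : ℕ} {M : EquivGradedModule.{u, v} k n}
  {N : EquivGradedModule.{u, w} k n} {P : EquivGradedModule.{u, v'} k n}

/-- The underlying `k`-linear map. -/
abbrev lin (f : EquivGradedHom M N) : M.carrier →ₗ[k] N.carrier := f.toLin.restrictScalars k

lemma map_memZ (f : EquivGradedHom M N) {z : ℤ} {m : M.carrier} (hm : m ∈ M.degZ z) :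
    f.toLin m ∈ N.degZ z := by
  cases z with
  | ofNat j => exact f.map_mem j m hm
  | negSucc j =>
    rw [(Submodule.mem_bot k).1 hm, map_zero]
    exact Submodule.zero_mem _

lemma map_projZ (f : EquivGradedHom M N) (z : ℤ) (m : M.carrier) :
    f.toLin (M.projZ z m) = N.projZ z (f.toLin m) := by
  refine M.homogeneous_induction (p := fun m => f.toLin (M.projZ z m) = N.projZ z (f.toLin m)) m
    (fun j m hm => ?_) (by simp) fun m m' h h' => by
    simp only [map_add, h, h']
  rw [M.projZ_of_mem_deg z hm, N.projZ_of_mem_deg z (f.map_mem j m hm)]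
  split_ifs
  · rfl
  · exact map_zero _

lemma map_proj (f : EquivGradedHom M N) (j : ℕ) (m : M.carrier) :
    f.toLin (M.proj j m) = N.proj j (f.toLin m) :=
  f.map_projZ j m

lemma isHom (f : EquivGradedHom M N) : OpModule.IsHom M.toOp N.toOp f.lin where
  map_mem _ _ hm := f.map_memZ hm
  map_x l _ a _ := f.toLin.map_smul (X l) a

lemma map_mSub (f : EquivGradedHom M N) {m : M.carrier} (hm : m ∈ M.mSub) :
    f.toLin m ∈ N.mSub := by
  obtain ⟨c, rfl⟩ := EquivGradedModule.exists_of_mem_mSub hm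
  simp only [map_sum, map_smul]
  exact EquivGradedModule.sum_X_smul_mem_mSub _

/-- Homogeneous projections commute with equivariant graded maps, so preimages can be projected to
the required degree. -/
lemma isShortExact (f : EquivGradedHom M N) (g : EquivGradedHom N P)
    (hf : Function.Injective f.toLin) (hfg : Function.Exact f.toLin g.toLin)
    (hg : Function.Surjective g.toLin) :
    OpModule.IsShortExact M.toOp N.toOp P.toOp f.lin g.lin where
  left := f.isHom
  right := g.isHom
  inj z a _ h := hf (h.trans (map_zero _).symm)
  zero z a _ := (hfg _).2 ⟨a, rfl⟩
  exact z b hb h := by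
    obtain ⟨a, rfl⟩ := (hfg b).1 h
    refine ⟨M.projZ z a, M.projZ_mem z a, ?_⟩
    exact (f.map_projZ z a).trans (N.projZ_of_mem hb)
  surj z c hc := by
    obtain ⟨b, rfl⟩ := hg c
    refine ⟨N.projZ z b, N.projZ_mem z b, ?_⟩
    exact (g.map_projZ z b).trans (P.projZ_of_mem hc)

/-- The kernel of a homomorphism of equivariant graded modules. -/
def ker (f : EquivGradedHom M N) : EquivGradedModule.{u, v} k n where
  carrier := LinearMap.ker f.toLin
  deg j := (M.deg j).comap ((LinearMap.ker f.toLin).subtype.restrictScalars k)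
  ρ := M.ρ.subrepresentation ((LinearMap.ker f.toLin).restrictScalars k) fun σ m hm => by
    change f.toLin m = 0 at hm
    change f.toLin (M.ρ σ m) = 0
    rw [f.map_ρ, hm, map_zero]
  isInternal := by
    have hp : ∀ j, ∀ m ∈ (LinearMap.ker f.toLin).restrictScalars k,
        M.proj j m ∈ (LinearMap.ker f.toLin).restrictScalars k := fun j m hm => by
      change f.toLin m = 0 at hm
      change f.toLin (M.proj j m) = 0
      rw [f.map_proj, hm, map_zero]
    refine isInternal_of_proj (V := LinearMap.ker f.toLin) _
      (fun j => (M.proj j).restrict (p := (LinearMap.ker f.toLin).restrictScalars k)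
        (q := (LinearMap.ker f.toLin).restrictScalars k) (hp j)) ?_ ?_ ?_
    · exact fun j x hx => Subtype.ext ((M.proj_of_mem j j hx).trans (if_pos rfl))
    · exact fun i j hij x hx => Subtype.ext ((M.proj_of_mem i j hx).trans (if_neg hij))
    · intro x
      obtain ⟨s, hs⟩ := M.exists_sum_proj x.1
      have hx : x = ∑ j ∈ s, (⟨M.proj j x.1, hp j _ x.2⟩ : LinearMap.ker f.toLin) := by
        apply Subtype.ext
        rw [AddSubmonoidClass.coe_finsetSum]
        exact (hs s subset_rfl).symm
      rw [hx]
      exact Submodule.sum_mem _ fun j _ => Submodule.mem_iSup_of_mem j (M.proj_mem j x.1)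
  smul_mem i j p m hp hm := M.smul_mem i j p m.1 hp hm
  ρ_smul σ p m := Subtype.ext (M.ρ_smul σ p m.1)
  ρ_mem σ j m hm := M.ρ_mem σ j m.1 hm

/-- The inclusion of the kernel. -/
def kerι (f : EquivGradedHom M N) : EquivGradedHom f.ker M where
  toLin := (LinearMap.ker f.toLin).subtype
  map_ρ _ _ := rfl
  map_mem _ _ hm := hm

/-- The homomorphism to the kernel of `g` induced by a homomorphism `f` with `g ∘ f = 0`. -/
def toKer (f : EquivGradedHom M N) (g : EquivGradedHom N P) (h : ∀ m, g.toLin (f.toLin m) = 0) :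
    EquivGradedHom M g.ker where
  toLin := f.toLin.codRestrict _ h
  map_ρ σ m := Subtype.ext (f.map_ρ σ m)
  map_mem j m hm := f.map_mem j m hm

lemma ker_isShortExact (f : EquivGradedHom M N) (hf : Function.Surjective f.toLin) :
    OpModule.IsShortExact f.ker.toOp M.toOp N.toOp f.kerι.lin f.lin :=
  isShortExact _ _ Subtype.val_injective
    (fun m => ⟨fun h => ⟨⟨m, h⟩, rfl⟩, fun ⟨x, hx⟩ => hx ▸ x.2⟩) hf

end EquivGradedHom

/-- The resolution of the kernel of the augmentation obtained by truncation. -/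
def EquivFreeResolution.shift {k : Type u} [Field k] {n : ℕ} {M : EquivGradedModule.{u, v} k n}
    (R : EquivFreeResolution.{u, v, w} M) : EquivFreeResolution.{u, w, w} R.ε.ker where
  F i := R.F (i + 1)
  free i := R.free (i + 1)
  d i := R.d (i + 1)
  ε := (R.d 0).toKer R.ε fun m => (R.exact_zero _).2 ⟨m, rfl⟩
  ε_surjective y := by
    obtain ⟨x, hx⟩ := (R.exact_zero y.1).1 y.2
    exact ⟨x, Subtype.ext hx⟩
  exact_zero y := by
    rw [← R.exact_succ 0 y]
    exact Subtype.ext_iff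
  exact_succ i := R.exact_succ (i + 1)

/-! ## Isomorphisms of representations restricted to a subgroup -/

section RepIso

variable {k : Type*} [Field k] {G : Type*} [Group G]
  {X : Type*} [AddCommMonoid X] [Module k X] {Y : Type*} [AddCommMonoid Y] [Module k Y]
  {Z : Type*} [AddCommMonoid Z] [Module k Z]

/-- Isomorphy of two representations as representations of the subgroup `K`. -/
def RepIso (K : Subgroup G) (ρX : Representation k G X) (ρY : Representation k G Y) : Prop :=
  ∃ e : X ≃ₗ[k] Y, ∀ σ ∈ K, ∀ x, e (ρX σ x) = ρY σ (e x)

namespace RepIso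

variable {K : Subgroup G} {ρX : Representation k G X} {ρY : Representation k G Y}
  {ρZ : Representation k G Z}

lemma refl (K : Subgroup G) (ρX : Representation k G X) : RepIso K ρX ρX :=
  ⟨LinearEquiv.refl k X, fun _ _ _ => rfl⟩

lemma symm (h : RepIso K ρX ρY) : RepIso K ρY ρX := by
  obtain ⟨e, he⟩ := h
  refine ⟨e.symm, fun σ hσ y => ?_⟩
  rw [LinearEquiv.symm_apply_eq, he σ hσ, LinearEquiv.apply_symm_apply]

lemma trans (h : RepIso K ρX ρY) (h' : RepIso K ρY ρZ) : RepIso K ρX ρZ := by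
  obtain ⟨e, he⟩ := h
  obtain ⟨e', he'⟩ := h'
  refine ⟨e.trans e', fun σ hσ x => ?_⟩
  rw [LinearEquiv.trans_apply, he σ hσ, he' σ hσ, LinearEquiv.trans_apply]

/-- Two quotients of the same space with the same kernel are isomorphic. -/
lemma of_span {W X Y : Type*} [AddCommGroup W] [Module k W] [AddCommGroup X] [Module k X]
    [AddCommGroup Y] [Module k Y] {ρX : Representation k G X} {ρY : Representation k G Y}
    (p : W →ₗ[k] X) (q : W →ₗ[k] Y) (hp : Function.Surjective p) (hq : Function.Surjective q)
    (hpq : ∀ w, p w = 0 ↔ q w = 0)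
    (h : ∀ σ ∈ K, ∀ w, ∃ w', p w' = ρX σ (p w) ∧ q w' = ρY σ (q w)) : RepIso K ρX ρY := by
  have hk : LinearMap.ker p = LinearMap.ker q := Submodule.ext hpq
  let e : X ≃ₗ[k] Y := (p.quotKerEquivOfSurjective hp).symm.trans
    ((Submodule.quotEquivOfEq _ _ hk).trans (q.quotKerEquivOfSurjective hq))
  have he : ∀ w, e (p w) = q w := fun w => by
    have : (p.quotKerEquivOfSurjective hp).symm (p w) = Submodule.Quotient.mk w := by
      rw [LinearEquiv.symm_apply_eq]
      rfl
    simp only [e, LinearEquiv.trans_apply, this]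
    rfl
  refine ⟨e, fun σ hσ x => ?_⟩
  obtain ⟨w, rfl⟩ := hp x
  obtain ⟨w', h1, h2⟩ := h σ hσ w
  rw [← h1, he, he, h2]

end RepIso

variable {E : Type*} [AddCommGroup E] [Module k E] {E' : Type*} [AddCommGroup E'] [Module k E']

/-- The quotient of `P` by its intersection with `Q`. -/
abbrev Subquot (P Q : Submodule k E) : Type _ := P ⧸ Q.comap P.subtype

/-- The class of an element of `P`. -/
abbrev Subquot.mk (P Q : Submodule k E) (x : E) (hx : x ∈ P) : Subquot P Q :=
  Submodule.Quotient.mk ⟨x, hx⟩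

lemma Subquot.mk_eq_zero {P Q : Submodule k E} {x : E} (hx : x ∈ P) :
    Subquot.mk P Q x hx = 0 ↔ x ∈ Q :=
  Submodule.Quotient.mk_eq_zero _

/-- The representation on a subquotient. -/
def subquotRep (ρ : Representation k G E) (P Q : Submodule k E) (hP : ∀ σ, P ≤ P.comap (ρ σ))
    (hQ : ∀ σ, Q ≤ Q.comap (ρ σ)) : Representation k G (Subquot P Q) :=
  (ρ.subrepresentation P hP).quotient (Q.comap P.subtype) fun σ _ hx => hQ σ hx

/-- A linear relation between two representations induces an isomorphism of subquotients. -/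
lemma RepIso.of_relation {K : Subgroup G} {ρ : Representation k G E} {ρ' : Representation k G E'}
    {P Q : Submodule k E} {P' Q' : Submodule k E'} {hP : ∀ σ, P ≤ P.comap (ρ σ)}
    {hQ : ∀ σ, Q ≤ Q.comap (ρ σ)} {hP' : ∀ σ, P' ≤ P'.comap (ρ' σ)}
    {hQ' : ∀ σ, Q' ≤ Q'.comap (ρ' σ)} (R : Submodule k (E × E'))
    (h1 : ∀ r ∈ R, r.1 ∈ P) (h2 : ∀ r ∈ R, r.2 ∈ P')
    (s1 : ∀ x ∈ P, ∃ y, (x, y) ∈ R) (s2 : ∀ y ∈ P', ∃ x, (x, y) ∈ R)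
    (hR : ∀ r ∈ R, (r.1 ∈ Q ↔ r.2 ∈ Q'))
    (hσ : ∀ σ, ∀ r ∈ R, (ρ σ r.1, ρ' σ r.2) ∈ R) :
    RepIso K (subquotRep ρ P Q hP hQ) (subquotRep ρ' P' Q' hP' hQ') := by
  let p : R →ₗ[k] Subquot P Q := (Submodule.mkQ _) ∘ₗ
    ((LinearMap.fst k E E' ∘ₗ R.subtype).codRestrict P fun r => h1 r.1 r.2)
  let q : R →ₗ[k] Subquot P' Q' := (Submodule.mkQ _) ∘ₗ
    ((LinearMap.snd k E E' ∘ₗ R.subtype).codRestrict P' fun r => h2 r.1 r.2)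
  refine RepIso.of_span p q ?_ ?_ ?_ ?_
  · intro x
    obtain ⟨⟨x, hx⟩, rfl⟩ := Submodule.mkQ_surjective _ x
    obtain ⟨y, hy⟩ := s1 x hx
    exact ⟨⟨(x, y), hy⟩, rfl⟩
  · intro y
    obtain ⟨⟨y, hy⟩, rfl⟩ := Submodule.mkQ_surjective _ y
    obtain ⟨x, hx⟩ := s2 y hy
    exact ⟨⟨(x, y), hx⟩, rfl⟩
  · rintro ⟨r, hr⟩
    exact (Subquot.mk_eq_zero (h1 r hr)).trans ((hR r hr).trans (Subquot.mk_eq_zero (h2 r hr)).symm)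
  · rintro σ - ⟨r, hr⟩
    exact ⟨⟨_, hσ σ r hr⟩, rfl, rfl⟩

end RepIso

/-! ## Koszul homology as a representation -/

namespace EquivGradedModule

variable {k : Type u} [Field k] {n : ℕ} (M : EquivGradedModule.{u, v} k n)

/-- The action of the symmetric group on Koszul chains. -/
def chainRep (i : ℕ) : Representation k (Equiv.Perm (Fin n)) (KoszulChain k n M.carrier i) where
  toFun σ :=
    { toFun := fun f => (M.ρ σ).compAlternatingMap (f.compLinearMap (LinearMap.funLeft k k σ))
      map_add' := fun f g => by
        ext v
        simp
      map_smul' := fun c f => by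
        ext v
        simp }
  map_one' := by
    refine LinearMap.ext fun f => ?_
    ext v
    simp only [map_one]
    rfl
  map_mul' σ τ := by
    refine LinearMap.ext fun f => ?_
    ext v
    simp only [map_mul]
    rfl

lemma chainRep_apply (i : ℕ) (σ : Equiv.Perm (Fin n)) (f : KoszulChain k n M.carrier i)
    (v : Fin i → Fin n → k) :
    M.chainRep i σ f v = M.ρ σ (f fun j => v j ∘ σ) := rfl

lemma koszulD_chainRep {i : ℕ} (σ : Equiv.Perm (Fin n)) (f : KoszulChain k n M.carrier (i + 1)) :
    koszulD (mulX k M.carrier) i (M.chainRep (i + 1) σ f) =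
      M.chainRep i σ (koszulD (mulX k M.carrier) i f) := by
  ext v
  rw [chainRep_apply, koszulD_apply, koszulD_apply, map_sum, ← Equiv.sum_comp σ]
  refine Finset.sum_congr rfl fun l _ => ?_
  rw [mulX_apply, mulX_apply, M.ρ_smul, rename_X, chainRep_apply]
  congr 3
  funext j
  refine Fin.cases ?_ (fun j => rfl) j
  funext m
  simp [Pi.single_apply]

lemma ρ_memZ (σ : Equiv.Perm (Fin n)) {z : ℤ} {m : M.carrier} (hm : m ∈ M.degZ z) :
    M.ρ σ m ∈ M.degZ z := by
  cases z with
  | ofNat j => exact M.ρ_mem σ j m hm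
  | negSucc j =>
    rw [(Submodule.mem_bot k).1 hm, map_zero]
    exact Submodule.zero_mem _

lemma chainRep_mem_chains (i : ℕ) (z : ℤ) (σ : Equiv.Perm (Fin n))
    {f : KoszulChain k n M.carrier i} (hf : f ∈ M.toOp.chains i z) :
    M.chainRep i σ f ∈ M.toOp.chains i z :=
  fun _ => M.ρ_memZ σ (hf _)

lemma chainRep_mem_cycles (i : ℕ) (z : ℤ) (σ : Equiv.Perm (Fin n)) :
    M.toOp.cycles i z ≤ (M.toOp.cycles i z).comap (M.chainRep i σ) := by
  rintro f ⟨h1, h2⟩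
  refine ⟨?_, M.chainRep_mem_chains i z σ h2⟩
  cases i with
  | zero => trivial
  | succ i =>
    have h1 : koszulD (mulX k M.carrier) i f = 0 := h1
    change koszulD (mulX k M.carrier) i _ = 0
    rw [koszulD_chainRep, h1, map_zero]

lemma chainRep_mem_boundaries (i : ℕ) (z : ℤ) (σ : Equiv.Perm (Fin n)) :
    M.toOp.boundaries i z ≤ (M.toOp.boundaries i z).comap (M.chainRep i σ) := by
  rintro _ ⟨g, hg, rfl⟩
  exact ⟨_, M.chainRep_mem_chains _ _ σ hg, M.koszulD_chainRep σ g⟩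

/-- Koszul homology in homological degree `i` and internal degree `z`. -/
abbrev KoszulHomology (i : ℕ) (z : ℤ) : Type _ :=
  Subquot (M.toOp.cycles i z) (M.toOp.boundaries i z)

/-- The action of the symmetric group on Koszul homology. -/
def koszulRep (i : ℕ) (z : ℤ) : Representation k (Equiv.Perm (Fin n)) (M.KoszulHomology i z) :=
  subquotRep (M.chainRep i) _ _ (M.chainRep_mem_cycles i z) (M.chainRep_mem_boundaries i z)

end EquivGradedModule

lemma EquivGradedHom.comp_chainRep {k : Type u} [Field k] {n : ℕ} {M : EquivGradedModule.{u, v} k n}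
    {N : EquivGradedModule.{u, w} k n} (f : EquivGradedHom M N) (i : ℕ) (σ : Equiv.Perm (Fin n))
    (c : KoszulChain k n M.carrier i) :
    f.lin.compAlternatingMap (M.chainRep i σ c) = N.chainRep i σ (f.lin.compAlternatingMap c) := by
  ext v
  exact f.map_ρ σ _

/-! ## Comparison of Koszul homology with resolutions -/

section Comparison

variable {k : Type u} [Field k] {n : ℕ} {M : EquivGradedModule.{u, v} k n}

lemma comp_zero_chain {V : Type v} [AddCommGroup V] [Module k V] {W : Type w} [AddCommGroup W]
    [Module k W] (T : V →ₗ[k] W) {i : ℕ} : T.compAlternatingMap (0 : KoszulChain k n V i) = 0 := by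
  ext v
  simp

lemma comp_sub_chain {V : Type v} [AddCommGroup V] [Module k V] {W : Type w} [AddCommGroup W]
    [Module k W] (T : V →ₗ[k] W) {i : ℕ} (f g : KoszulChain k n V i) :
    T.compAlternatingMap (f - g) = T.compAlternatingMap f - T.compAlternatingMap g := by
  ext v
  simp

lemma comp_add_chain {V : Type v} [AddCommGroup V] [Module k V] {W : Type w} [AddCommGroup W]
    [Module k W] (T : V →ₗ[k] W) {i : ℕ} (f g : KoszulChain k n V i) :
    T.compAlternatingMap (f + g) = T.compAlternatingMap f + T.compAlternatingMap g := by
  ext v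
  simp

lemma comp_smul_chain {V : Type v} [AddCommGroup V] [Module k V] {W : Type w} [AddCommGroup W]
    [Module k W] (T : V →ₗ[k] W) {i : ℕ} (c : k) (f : KoszulChain k n V i) :
    T.compAlternatingMap (c • f) = c • T.compAlternatingMap f := by
  ext v
  simp

/-- The shift of Koszul homology along a short exact sequence with acyclic middle term. -/
lemma koszul_connecting_iso (K : Subgroup (Equiv.Perm (Fin n))) {A : EquivGradedModule.{u, w} k n}
    {B : EquivGradedModule.{u, v'} k n} (φ : EquivGradedHom A B) (ψ : EquivGradedHom B M)
    (h : OpModule.IsShortExact A.toOp B.toOp M.toOp φ.lin ψ.lin) (i : ℕ) (z : ℤ)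
    (h1 : B.toOp.Vanishes (i + 1) z) (h0 : B.toOp.Vanishes i (z + 1)) :
    RepIso K (M.koszulRep (i + 1) z) (A.koszulRep i (z + 1)) := by
  -- The zig-zag of the connecting map is kept as a relation containing all choices of `b`; this
  -- makes it linear and equivariant at once.
  let R : Submodule k (KoszulChain k n M.carrier (i + 1) × KoszulChain k n A.carrier i) :=
    { carrier := {r | r.2 ∈ A.toOp.cycles i (z + 1) ∧ ∃ b ∈ B.toOp.chains (i + 1) z,
        ψ.lin.compAlternatingMap b = r.1 ∧
        koszulD (mulX k B.carrier) i b = φ.lin.compAlternatingMap r.2}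
      add_mem' := by
        rintro ⟨_, a⟩ ⟨_, a'⟩ ⟨ha, b, hb, rfl, hab⟩ ⟨ha', b', hb', rfl, hab'⟩
        refine ⟨add_mem ha ha', b + b', add_mem hb hb', comp_add_chain _ _ _, ?_⟩
        rw [map_add, hab, hab']
        exact (comp_add_chain _ _ _).symm
      zero_mem' := ⟨zero_mem _, 0, zero_mem _, comp_zero_chain _,
        (map_zero _).trans (comp_zero_chain _).symm⟩
      smul_mem' := by
        rintro c ⟨_, a⟩ ⟨ha, b, hb, rfl, hab⟩
        refine ⟨Submodule.smul_mem _ c ha, c • b, Submodule.smul_mem _ c hb,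
          comp_smul_chain _ _ _, ?_⟩
        rw [map_smul, hab]
        exact (comp_smul_chain _ _ _).symm }
  refine RepIso.of_relation R ?_ ?_ ?_ ?_ ?_ ?_
  · rintro ⟨_, a⟩ ⟨ha, b, hb, rfl, hab⟩
    refine ⟨?_, h.right.comp_mem hb⟩
    change koszulD (mulX k M.carrier) i _ = 0
    rw [h.right.koszulD_comp hb, hab]
    exact h.comp_comp ha.2
  · exact fun r hr => hr.1
  · intro f hf
    obtain ⟨b, hb, a, ha, hbf, hab⟩ := h.connecting hf
    exact ⟨a, ha, b, hb, hbf, hab⟩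
  · intro a ha
    obtain ⟨b, hb, hab⟩ := h0 (h.left.comp_mem_cycles ha)
    rw [add_sub_cancel_right] at hb
    exact ⟨_, ha, b, hb, rfl, hab⟩
  · rintro ⟨_, a⟩ ⟨ha, b, hb, rfl, hab⟩
    constructor
    -- If `ψ b` is the boundary of `g`, then `b` minus the boundary of a lift of `g` comes from `A`,
    -- and its differential is the image of `a`.
    · rintro ⟨g, hg, hgb⟩
      obtain ⟨g', hg', rfl⟩ := h.lift hg
      change _ = ψ.lin.compAlternatingMap b at hgb
      have e : ψ.lin.compAlternatingMap (b - koszulD (mulX k B.carrier) (i + 1) g') = 0 := by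
        rw [comp_sub_chain, ← hgb, sub_eq_zero]
        exact h.right.koszulD_comp hg'
      obtain ⟨a', ha', hab'⟩ := h.factor (sub_mem hb (B.toOp.koszulD_mem' hg')) e
      refine ⟨a', by rwa [add_sub_cancel_right], ?_⟩
      refine exists_chain_factor (A.degZ (z + 1)) (A.toOp.koszulD_mem ha') ha.2
        (fun v hv => h.inj _ v hv) (?_ : φ.lin.compAlternatingMap _ = φ.lin.compAlternatingMap _)
      rw [← hab, ← h.left.koszulD_comp ha', hab', map_sub,
        koszulD_koszulD (mulX k B.carrier) mulX_comm, sub_zero]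
    -- If `a` is the boundary of `a'`, then `b - φ a'` is a cycle of the acyclic module `B` with the
    -- same image as `b`.
    · rintro ⟨a', ha', haa⟩
      change koszulD (mulX k A.carrier) i a' = a at haa
      change b ∈ chainsIn _ _ at hb
      rw [add_sub_cancel_right] at ha'
      have hc : b - φ.lin.compAlternatingMap a' ∈ B.toOp.cycles (i + 1) z := by
        refine ⟨?_, sub_mem hb (h.left.comp_mem ha')⟩
        change koszulD (mulX k B.carrier) i _ = 0
        rw [map_sub, hab, ← haa, sub_eq_zero]
        exact (h.left.koszulD_comp ha').symm
      obtain ⟨g, hg, hgb⟩ := h1 hc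
      refine ⟨ψ.lin.compAlternatingMap g, h.right.comp_mem hg, ?_⟩
      rw [h.right.koszulD_comp hg, hgb, comp_sub_chain]
      exact (congrArg _ (h.comp_comp ha')).trans (sub_zero _)
  · rintro σ ⟨_, a⟩ ⟨ha, b, hb, rfl, hab⟩
    refine ⟨A.chainRep_mem_cycles _ _ σ ha, B.chainRep _ σ b, B.chainRep_mem_chains _ _ σ hb,
      ψ.comp_chainRep _ σ b, ?_⟩
    rw [B.koszulD_chainRep, hab]
    exact (φ.comp_chainRep _ σ a).symm

namespace EquivFreeResolution

variable (R : EquivFreeResolution.{u, v, w} M)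

/-- Homogeneous elements of `F_i` that represent cycles of `F_• ⊗_S k`. -/
def liftCycles (i j : ℕ) : Submodule k (R.F i).carrier :=
  (R.F i).deg j ⊓ (R.cycles i).comap (R.F i).mSub.mkQ

/-- Elements of `F_i` that represent boundaries of `F_• ⊗_S k`. -/
def liftBoundaries (i : ℕ) : Submodule k (R.F i).carrier :=
  (R.boundaries i).comap (R.F i).mSub.mkQ

lemma mem_liftBoundaries {i : ℕ} {u : (R.F i).carrier} :
    u ∈ R.liftBoundaries i ↔ ∃ w, u - (R.d i).toLin w ∈ (R.F i).mSub := by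
  constructor
  · rintro ⟨w, hw⟩
    obtain ⟨w, rfl⟩ := Submodule.mkQ_surjective _ w
    exact ⟨w, (Submodule.Quotient.eq _).1 hw.symm⟩
  · rintro ⟨w, hw⟩
    exact ⟨Submodule.Quotient.mk w, ((Submodule.Quotient.eq _).2 hw).symm⟩

lemma mem_liftCycles_succ {i j : ℕ} {u : (R.F (i + 1)).carrier} :
    u ∈ R.liftCycles (i + 1) j ↔ u ∈ (R.F (i + 1)).deg j ∧ (R.d i).toLin u ∈ (R.F i).mSub :=
  and_congr_right fun _ => Submodule.Quotient.mk_eq_zero _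

lemma mem_liftCycles_zero {j : ℕ} {u : (R.F 0).carrier} :
    u ∈ R.liftCycles 0 j ↔ u ∈ (R.F 0).deg j :=
  and_iff_left trivial

lemma liftCycles_le (i j : ℕ) (σ : Equiv.Perm (Fin n)) :
    R.liftCycles i j ≤ (R.liftCycles i j).comap ((R.F i).ρ σ) :=
  fun _ hu => ⟨(R.F i).ρ_mem σ j _ hu.1, R.cycles_le_comap i σ hu.2⟩

lemma liftBoundaries_le (i : ℕ) (σ : Equiv.Perm (Fin n)) :
    R.liftBoundaries i ≤ (R.liftBoundaries i).comap ((R.F i).ρ σ) := by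
  rintro u ⟨w, hw⟩
  refine ⟨(R.F (i + 1)).fiberRep σ w, ?_⟩
  rw [EquivGradedHom.fiberMap_rep, hw]
  rfl

/-- Homogeneous representatives in `F_i` turn a component of an iterated quotient into one
subquotient, to which `RepIso.of_relation` applies. -/
lemma torDeg_iso_subquot (K : Subgroup (Equiv.Perm (Fin n))) (i j : ℕ) :
    RepIso K (R.torDegRep i j) (subquotRep (R.F i).ρ (R.liftCycles i j) (R.liftBoundaries i)
      (R.liftCycles_le i j) (R.liftBoundaries_le i)) := by
  let p0 : R.liftCycles i j →ₗ[k] R.cycles i :=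
    ((R.F i).mSub.mkQ ∘ₗ (R.liftCycles i j).subtype).codRestrict (R.cycles i) fun u => u.2.2
  let p : R.liftCycles i j →ₗ[k] R.torDeg i j :=
    (Submodule.mkQ _ ∘ₗ p0).codRestrict (R.torDeg i j)
      fun u => ⟨p0 u, ⟨u.1, u.2.1, rfl⟩, rfl⟩
  refine RepIso.of_span p (Submodule.mkQ _) ?_ (Submodule.mkQ_surjective _) ?_ ?_
  · rintro ⟨_, ⟨x, hx⟩, ⟨u, hu, hux⟩, rfl⟩
    change (R.F i).mSub.mkQ u = x at hux
    subst hux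
    exact ⟨⟨u, hu, hx⟩, rfl⟩
  · intro u
    refine Subtype.ext_iff.trans ((Submodule.Quotient.mk_eq_zero _).trans ?_)
    exact (Submodule.Quotient.mk_eq_zero
      ((R.liftBoundaries i).comap (R.liftCycles i j).subtype) (x := u)).symm
  · rintro σ - ⟨u, hu⟩
    exact ⟨⟨(R.F i).ρ σ u, R.liftCycles_le i j σ hu⟩, rfl, rfl⟩

/-- Both sides are the degree `j` part of `M / 𝔪 M`; an element `u` of `F_0` corresponds to `ε(u)`.
-/
lemma torDeg_iso_koszul_zero (K : Subgroup (Equiv.Perm (Fin n))) (j : ℕ) :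
    RepIso K (R.torDegRep 0 j) (M.koszulRep 0 j) := by
  refine (R.torDeg_iso_subquot K 0 j).trans ?_
  let Rel : Submodule k ((R.F 0).carrier × KoszulChain k n M.carrier 0) :=
    { carrier := {r | r.1 ∈ (R.F 0).deg j ∧ ∀ v, r.2 v = R.ε.toLin r.1}
      add_mem' := fun h h' => ⟨add_mem h.1 h'.1, fun v => by simp [h.2, h'.2]⟩
      zero_mem' := ⟨zero_mem _, fun v => by simp⟩
      smul_mem' := fun c r h => ⟨Submodule.smul_mem _ c h.1, fun v => by
        simp [h.2]⟩ }
  refine RepIso.of_relation Rel ?_ ?_ ?_ ?_ ?_ ?_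
  · exact fun r hr => R.mem_liftCycles_zero.2 hr.1
  · rintro r ⟨hr, hr'⟩
    refine ⟨trivial, fun v => ?_⟩
    rw [hr']
    exact R.ε.map_mem j _ hr
  · intro u hu
    exact ⟨AlternatingMap.constOfIsEmpty k _ (Fin 0) (R.ε.toLin u), hu.1, fun v => rfl⟩
  · rintro f ⟨-, hf⟩
    have hf0 : f 0 ∈ M.degZ j := hf 0
    obtain ⟨u, hu⟩ := R.ε_surjective (f 0)
    refine ⟨(R.F 0).proj j u, (R.F 0).proj_mem j u, fun v => ?_⟩
    rw [R.ε.map_proj, hu, Subsingleton.elim v 0]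
    exact (M.projZ_of_mem hf0).symm
  · rintro ⟨u, f⟩ ⟨hu, hf⟩
    have hfj : R.ε.toLin u ∈ M.degZ j := R.ε.map_mem j u hu
    rw [mem_liftBoundaries]
    constructor
    · rintro ⟨w, hw⟩
      have h := R.ε.map_mSub hw
      rw [map_sub, (R.exact_zero _).2 ⟨w, rfl⟩, sub_zero] at h
      obtain ⟨c, hc, hcu⟩ := EquivGradedModule.exists_graded_of_mem_mSub hfj h
      refine ⟨oneChain c, oneChain_mem hc, ?_⟩
      ext v
      exact ((koszulD_oneChain _ c v).trans hcu.symm).trans (hf v).symm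
    · rintro ⟨g, -, hg⟩
      change koszulD (mulX k M.carrier) 0 g = f at hg
      choose c hc using fun l => R.ε_surjective (g (Matrix.vecCons (Pi.single l 1) 0))
      have h : R.ε.toLin (u - ∑ l, (X l : MvPolynomial (Fin n) k) • c l) = 0 := by
        change ∀ v, f v = R.ε.toLin u at hf
        rw [map_sub, ← hf 0, ← hg, koszulD_apply, map_sum, sub_eq_zero]
        refine Finset.sum_congr rfl fun l _ => ?_
        rw [map_smul, hc]
        rfl
      obtain ⟨w, hw⟩ := (R.exact_zero _).1 h
      refine ⟨w, ?_⟩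
      rw [hw, sub_sub_cancel]
      exact EquivGradedModule.sum_X_smul_mem_mSub c
  · rintro σ ⟨u, f⟩ ⟨hu, hf⟩
    refine ⟨(R.F 0).ρ_mem σ j u hu, fun v => ?_⟩
    change M.ρ σ (f _) = R.ε.toLin _
    change ∀ v, f v = R.ε.toLin u at hf
    rw [hf, R.ε.map_ρ]

/-- An element `u` of `F_1` with `d u ∈ 𝔪 F_0` is related to the cycle `ε(c)` for every one-chain
`c` of `F_0` with boundary `d u`. This case cannot be reduced to index zero of `R.shift`, where all
elements count as cycles. -/
lemma torDeg_iso_koszul_one (K : Subgroup (Equiv.Perm (Fin n))) (j : ℕ) :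
    RepIso K (R.torDegRep 1 j) (M.koszulRep 1 (j - 1)) := by
  have := R.free 0
  refine (R.torDeg_iso_subquot K 1 j).trans ?_
  have hex := R.ε.ker_isShortExact R.ε_surjective
  let Rel : Submodule k ((R.F 1).carrier × KoszulChain k n M.carrier 1) :=
    { carrier := {r | r.1 ∈ (R.F 1).deg j ∧ ∃ c ∈ (R.F 0).toOp.chains 1 (j - 1),
        R.ε.lin.compAlternatingMap c = r.2 ∧
        ∀ v, koszulD (mulX k (R.F 0).carrier) 0 c v = (R.d 0).toLin r.1}
      add_mem' := by
        rintro ⟨u, _⟩ ⟨u', _⟩ ⟨hu, c, hc, rfl, h⟩ ⟨hu', c', hc', rfl, h'⟩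
        refine ⟨add_mem hu hu', c + c', add_mem hc hc', comp_add_chain _ _ _, fun v => ?_⟩
        rw [map_add, AlternatingMap.add_apply, h, h']
        exact (map_add _ _ _).symm
      zero_mem' := ⟨zero_mem _, 0, zero_mem _, comp_zero_chain _, fun v => by simp⟩
      smul_mem' := by
        rintro a ⟨u, _⟩ ⟨hu, c, hc, rfl, h⟩
        refine ⟨Submodule.smul_mem _ a hu, a • c, Submodule.smul_mem _ a hc,
          comp_smul_chain _ _ _, fun v => ?_⟩
        rw [map_smul, AlternatingMap.smul_apply, h]
        exact ((R.d 0).lin.map_smul a u).symm }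
  refine RepIso.of_relation Rel ?_ ?_ ?_ ?_ ?_ ?_
  · rintro ⟨u, _⟩ ⟨hu, c, hc, rfl, h⟩
    refine R.mem_liftCycles_succ.2 ⟨hu, ?_⟩
    change ∀ v, _ = (R.d 0).toLin u at h
    rw [← h 0, koszulD_apply]
    exact EquivGradedModule.sum_X_smul_mem_mSub _
  · rintro ⟨u, _⟩ ⟨hu, c, hc, rfl, h⟩
    refine ⟨?_, R.ε.isHom.comp_mem hc⟩
    change koszulD (mulX k M.carrier) 0 _ = 0
    rw [R.ε.isHom.koszulD_comp hc]
    ext v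
    exact (congrArg R.ε.toLin (h v)).trans ((R.exact_zero _).2 ⟨u, rfl⟩)
  · intro u hu
    obtain ⟨hu, hdu⟩ := R.mem_liftCycles_succ.1 hu
    obtain ⟨c, hc, hcu⟩ := EquivGradedModule.exists_graded_of_mem_mSub
      (z := (j : ℤ)) ((R.d 0).map_mem j u hu) hdu
    refine ⟨_, hu, oneChain c, oneChain_mem hc, rfl, fun v => ?_⟩
    exact (koszulD_oneChain _ c v).trans hcu.symm
  · rintro f ⟨hf, hfj⟩
    have hf : koszulD (mulX k M.carrier) 0 f = 0 := hf
    obtain ⟨c, hc, rfl⟩ := hex.lift hfj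
    have hcj : koszulD (mulX k (R.F 0).carrier) 0 c 0 ∈ (R.F 0).degZ j :=
      (R.F 0).toOp.koszulD_mem' hc 0
    have h0 : R.ε.toLin (koszulD (mulX k (R.F 0).carrier) 0 c 0) = 0 := by
      have := R.ε.isHom.koszulD_comp hc
      exact (DFunLike.congr_fun this 0).symm.trans (DFunLike.congr_fun hf 0)
    obtain ⟨u, hu⟩ := (R.exact_zero _).1 h0
    refine ⟨(R.F 1).proj j u, (R.F 1).proj_mem j u, c, hc, rfl, fun v => ?_⟩
    change _ = (R.d 0).toLin ((R.F 1).proj j u)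
    rw [(R.d 0).map_proj, hu, Subsingleton.elim v 0]
    exact ((R.F 0).projZ_of_mem hcj).symm
  · rintro ⟨u, _⟩ ⟨hu, c, hc, rfl, h⟩
    change ∀ v, _ = (R.d 0).toLin u at h
    change u ∈ R.liftBoundaries 1 ↔ R.ε.lin.compAlternatingMap c ∈ M.toOp.boundaries 1 (j - 1)
    rw [mem_liftBoundaries]
    constructor
    · rintro ⟨w, hw⟩
      -- Modulo the image of `F_2`, `u` is `∑ x_l b_l`. Hence `d u` is the boundary of a one-chain
      -- with values in the image of `d`, which `ε` kills. It differs from `c` by a boundary, as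
      -- `F_0` is acyclic.
      obtain ⟨b, hb⟩ := EquivGradedModule.exists_of_mem_mSub hw
      have hdu : (R.d 0).toLin u = ∑ l, (X l : MvPolynomial (Fin n) k) •
          (R.d 0).toLin ((R.F 1).projZ (j - 1) (b l)) := by
        have h1 : (R.d 0).toLin u = (R.d 0).toLin (∑ l, (X l : MvPolynomial (Fin n) k) • b l) := by
          rw [← hb, map_sub, (R.exact_succ 0 _).2 ⟨w, rfl⟩, sub_zero]
        have h2 : (R.d 0).toLin u ∈ (R.F 0).degZ j := (R.d 0).map_mem j u hu
        rw [← (R.F 0).projZ_of_mem h2, h1, map_sum, map_sum]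
        refine Finset.sum_congr rfl fun l _ => ?_
        rw [map_smul, (R.F 0).projZ_X_smul', (R.d 0).map_projZ]
      set c' : Fin n → (R.F 0).carrier := fun l => (R.d 0).toLin ((R.F 1).projZ (j - 1) (b l))
        with hc'
      have hmem : oneChain c' ∈ (R.F 0).toOp.chains 1 (j - 1) :=
        oneChain_mem fun l => (R.d 0).map_memZ ((R.F 1).projZ_mem _ _)
      have hcyc : c - oneChain c' ∈ (R.F 0).toOp.cycles 1 (j - 1) := by
        refine ⟨?_, sub_mem hc hmem⟩
        change koszulD (mulX k (R.F 0).carrier) 0 _ = 0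
        rw [map_sub, sub_eq_zero]
        ext v
        exact (h v).trans (hdu.trans (koszulD_oneChain (mulX k (R.F 0).carrier) c' v).symm)
      obtain ⟨g, hg, hgc⟩ := EquivGradedModule.vanishes_of_free 0 _ hcyc
      refine ⟨R.ε.lin.compAlternatingMap g, R.ε.isHom.comp_mem hg, ?_⟩
      rw [R.ε.isHom.koszulD_comp hg, hgc, comp_sub_chain, comp_oneChain]
      have : (fun l => R.ε.lin (c' l)) = 0 := funext fun l => (R.exact_zero _).2 ⟨_, rfl⟩
      rw [this]
      ext v
      simp [oneChain_apply]
    · rintro ⟨g, hg, hgc⟩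
      change koszulD (mulX k M.carrier) 1 g = R.ε.lin.compAlternatingMap c at hgc
      obtain ⟨g', hg', rfl⟩ := hex.lift hg
      have h0 : R.ε.lin.compAlternatingMap (c - koszulD (mulX k (R.F 0).carrier) 1 g') = 0 := by
        rw [comp_sub_chain, ← hgc, sub_eq_zero]
        exact R.ε.isHom.koszulD_comp hg'
      -- After subtracting a boundary, `c` takes values in `ker ε`, the image of `F_1`, so it lifts
      -- to a one-chain of `F_1`. Its boundary differs from `u` by a cycle of the resolution.
      obtain ⟨b, -, hb⟩ := exists_chain_lift (R.d 0).lin ⊤ (LinearMap.ker R.ε.lin)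
        (fun y hy => by
          obtain ⟨x, hx⟩ := (R.exact_zero y).1 hy
          exact ⟨x, trivial, hx⟩) (f := c - koszulD (mulX k (R.F 0).carrier) 1 g')
        (fun v => DFunLike.congr_fun h0 v)
      have hdu : (R.d 0).toLin (u - ∑ l, (X l : MvPolynomial (Fin n) k) •
          b (Matrix.vecCons (Pi.single l 1) 0)) = 0 := by
        have h1 : koszulD (mulX k (R.F 0).carrier) 0 (c - koszulD (mulX k (R.F 0).carrier) 1 g') =
            koszulD (mulX k (R.F 0).carrier) 0 c := by
          rw [map_sub, koszulD_koszulD _ mulX_comm, sub_zero]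
        rw [map_sub, ← h 0, ← h1, ← hb, koszulD_apply, map_sum, sub_eq_zero]
        refine Finset.sum_congr rfl fun l _ => ?_
        rw [map_smul]
        rfl
      obtain ⟨w, hw⟩ := (R.exact_succ 0 _).1 hdu
      refine ⟨w, ?_⟩
      rw [hw, sub_sub_cancel]
      exact EquivGradedModule.sum_X_smul_mem_mSub _
  · rintro σ ⟨u, _⟩ ⟨hu, c, hc, rfl, h⟩
    change ∀ v, _ = (R.d 0).toLin u at h
    refine ⟨(R.F 1).ρ_mem σ j u hu, (R.F 0).chainRep 1 σ c,
      (R.F 0).chainRep_mem_chains _ _ σ hc, R.ε.comp_chainRep 1 σ c, fun v => ?_⟩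
    rw [(R.F 0).koszulD_chainRep]
    change (R.F 0).ρ σ (koszulD (mulX k (R.F 0).carrier) 0 c _) = (R.d 0).toLin _
    rw [h, (R.d 0).map_ρ]

/-- In index `i + 1` the homology of `R.shift` is definitionally that of `R` in index `i + 2`. On
the Koszul side the connecting isomorphism trades one homological degree for one coefficient degree.
-/
lemma torDeg_iso_koszul_step (K : Subgroup (Equiv.Perm (Fin n))) (i j : ℕ)
    (h : RepIso K (R.shift.torDegRep (i + 1) j)
      (R.ε.ker.koszulRep (i + 1) (j - (i + 1 : ℕ)))) :
    RepIso K (R.torDegRep (i + 2) j) (M.koszulRep (i + 2) (j - (i + 2 : ℕ))) := by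
  have := R.free 0
  have h' : RepIso K (M.koszulRep (i + 2) (j - (i + 2 : ℕ)))
      (R.ε.ker.koszulRep (i + 1) (j - (i + 2 : ℕ) + 1)) :=
    koszul_connecting_iso K R.ε.kerι R.ε (R.ε.ker_isShortExact R.ε_surjective) (i + 1) _
      (EquivGradedModule.vanishes_of_free _ _) (EquivGradedModule.vanishes_of_free _ _)
  have e : (j : ℤ) - (i + 2 : ℕ) + 1 = j - (i + 1 : ℕ) := by
    push_cast
    ring
  rw [e] at h'
  exact RepIso.trans h h'.symm

/-- The kernel of `ε` lives in the universe of the resolution, so the induction runs over modules of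
that universe. -/
lemma torDeg_iso_koszul_of_universe (K : Subgroup (Equiv.Perm (Fin n))) (i : ℕ) :
    ∀ {M : EquivGradedModule.{u, w} k n} (R : EquivFreeResolution.{u, w, w} M) (j : ℕ),
    RepIso K (R.torDegRep i j) (M.koszulRep i (j - i)) := by
  induction i with
  | zero =>
    intro M R j
    rw [show (j : ℤ) - (0 : ℕ) = j by simp]
    exact R.torDeg_iso_koszul_zero K j
  | succ i ih =>
    intro M R j
    cases i with
    | zero => simpa using R.torDeg_iso_koszul_one K j
    | succ i => exact R.torDeg_iso_koszul_step K i j (ih R.shift j)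

/-- `Tor` is computed by Koszul homology. -/
theorem torDeg_iso_koszul (K : Subgroup (Equiv.Perm (Fin n))) (i j : ℕ) :
    RepIso K (R.torDegRep i j) (M.koszulRep i (j - i)) := by
  rcases i with - | - | i
  · rw [show (j : ℤ) - (0 : ℕ) = j by simp]
    exact R.torDeg_iso_koszul_zero K j
  · simpa using R.torDeg_iso_koszul_one K j
  · exact R.torDeg_iso_koszul_step K i j (torDeg_iso_koszul_of_universe K _ R.shift j)

end EquivFreeResolution

end Comparison

/-! ## The exponents of `N^λ` -/

section Exponents

variable {n : ℕ}

lemma mapDomain_perm_apply (σ : Equiv.Perm (Fin n)) (a : Fin n →₀ ℕ) (j : Fin n) :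
    a.mapDomain σ (σ j) = a j :=
  Finsupp.mapDomain_apply σ.injective a j

lemma mapDomain_perm_le {σ : Equiv.Perm (Fin n)} {a b : Fin n →₀ ℕ} :
    a.mapDomain σ ≤ b ↔ ∀ j, a j ≤ b (σ j) := by
  constructor
  · intro h j
    rw [← mapDomain_perm_apply σ a j]
    exact h (σ j)
  · intro h j
    obtain ⟨j, rfl⟩ := σ.surjective j
    rw [mapDomain_perm_apply]
    exact h j

lemma sum_comp_mapDomain_perm (σ : Equiv.Perm (Fin n)) (a : Fin n →₀ ℕ) (f : ℕ → ℕ) :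
    ∑ j, f (a.mapDomain σ j) = ∑ j, f (a j) := by
  rw [← Equiv.sum_comp σ]
  simp only [mapDomain_perm_apply]

lemma degree_mapDomain_perm (σ : Equiv.Perm (Fin n)) (a : Fin n →₀ ℕ) :
    (a.mapDomain σ).degree = a.degree := by
  simp only [Finsupp.degree_eq_sum]
  exact sum_comp_mapDomain_perm σ a id

/-- The largest exponent. -/
def top (a : Fin n →₀ ℕ) : ℕ := Finset.univ.sup a

lemma le_top (a : Fin n →₀ ℕ) (j : Fin n) : a j ≤ top a := Finset.le_sup (Finset.mem_univ j)

/-- Exponents of the multiples of the monomials in the orbit of `x^a`. -/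
def orbitUp (a : Fin n →₀ ℕ) : Set (Fin n →₀ ℕ) :=
  {b | ∃ σ : Equiv.Perm (Fin n), a.mapDomain σ ≤ b}

/-- Exponents of the multiples of the monomials in the orbits of `x_j x^a`, where `a_j` is smaller
than the largest exponent minus one. -/
def raisedUp (a : Fin n →₀ ℕ) : Set (Fin n →₀ ℕ) :=
  {b | ∃ j, a j + 1 < top a ∧ ∃ σ : Equiv.Perm (Fin n),
    (Finsupp.single j 1 + a).mapDomain σ ≤ b}

/-- Exponents of the monomials that form a basis of `N^λ`. -/
def orbitDiff (a : Fin n →₀ ℕ) : Set (Fin n →₀ ℕ) := orbitUp a \ raisedUp a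

lemma orbitUp_mono {a b c : Fin n →₀ ℕ} (hb : b ∈ orbitUp a) (h : b ≤ c) : c ∈ orbitUp a := by
  obtain ⟨σ, hσ⟩ := hb
  exact ⟨σ, hσ.trans h⟩

lemma raisedUp_mono {a b c : Fin n →₀ ℕ} (hb : b ∈ raisedUp a) (h : b ≤ c) : c ∈ raisedUp a := by
  obtain ⟨j, hj, σ, hσ⟩ := hb
  exact ⟨j, hj, σ, hσ.trans h⟩

/-- Were the inequality strict at `σ j`, `x^b` would be a multiple of `σ(x_j x^a)`. -/
lemma orbitDiff_spec {a b : Fin n →₀ ℕ} (hb : b ∉ raisedUp a) {σ : Equiv.Perm (Fin n)}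
    (hσ : a.mapDomain σ ≤ b) {j : Fin n} (hj : a j + 1 < top a) : b (σ j) = a j := by
  have h := mapDomain_perm_le.1 hσ
  by_contra hne
  refine hb ⟨j, hj, σ, mapDomain_perm_le.2 fun i => ?_⟩
  have := h i
  simp only [Finsupp.add_apply, Finsupp.single_apply]
  split_ifs with hij
  · subst hij
    omega
  · omega

/-- The number of exponents above a threshold. -/
def numAbove (t : ℕ) (a : Fin n →₀ ℕ) : ℕ := ∑ j, if t + 1 ≤ a j then 1 else 0

lemma sum_min_succ (t : ℕ) (a : Fin n →₀ ℕ) :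
    ∑ j, min (a j) (t + 1) = ∑ j, min (a j) t + numAbove t a := by
  rw [numAbove, ← Finset.sum_add_distrib]
  refine Finset.sum_congr rfl fun j _ => ?_
  split_ifs <;> omega

lemma numAbove_mono {t : ℕ} {a b : Fin n →₀ ℕ} (h : a ≤ b) : numAbove t a ≤ numAbove t b := by
  refine Finset.sum_le_sum fun j _ => ?_
  have := h j
  split_ifs <;> omega

/-- Exponents whose truncation at `t` is a permutation of that of `a`, with at least `c` entries
above `t`. -/
def layer (a : Fin n →₀ ℕ) (t c : ℕ) : Set (Fin n →₀ ℕ) :=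
  {b | (∃ σ : Equiv.Perm (Fin n), ∀ j, min (b (σ j)) t = min (a j) t) ∧ c ≤ numAbove t b}

lemma sum_min_of_mem_layer {a b : Fin n →₀ ℕ} {t c : ℕ} (hb : b ∈ layer a t c) :
    ∑ j, min (b j) t = ∑ j, min (a j) t := by
  obtain ⟨⟨σ, hσ⟩, -⟩ := hb
  rw [← Equiv.sum_comp σ]
  exact Finset.sum_congr rfl fun j _ => hσ j

lemma layer_zero_isOrthantUnion (a : Fin n →₀ ℕ) (t : ℕ) :
    IsOrthantUnion (layer a t 0) t (∑ j, min (a j) t) where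
  mem_of_min_eq b b' h := by
    rintro ⟨⟨σ, hσ⟩, -⟩
    exact ⟨⟨σ, fun j => (h (σ j)).symm.trans (hσ j)⟩, Nat.zero_le _⟩
  sum_min b hb := sum_min_of_mem_layer hb

/-- Exactly `c` entries exceed `t`. This can be read off from the truncation at `t + 1`, whose sum
is that of the truncation at `t` plus `c`. -/
lemma layer_diff_isOrthantUnion (a : Fin n →₀ ℕ) (t c : ℕ) :
    IsOrthantUnion (layer a t c \ layer a t (c + 1)) (t + 1) (∑ j, min (a j) t + c) where
  mem_of_min_eq b b' h := by
    have e : numAbove t b = numAbove t b' := by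
      refine Finset.sum_congr rfl fun j _ => ?_
      have := h j
      split_ifs <;> omega
    have e' : ∀ j, min (b j) t = min (b' j) t := fun j => by
      have := h j
      omega
    rintro ⟨⟨⟨σ, hσ⟩, h1⟩, h2⟩
    refine ⟨⟨⟨σ, fun j => (e' (σ j)).symm.trans (hσ j)⟩, e ▸ h1⟩, fun h3 => h2 ⟨⟨σ, hσ⟩, ?_⟩⟩
    rw [e]
    exact h3.2
  sum_min b hb := by
    rw [sum_min_succ, sum_min_of_mem_layer hb.1]
    have h1 := hb.1.2
    have h2 : ¬ c + 1 ≤ numAbove t b := fun h => hb.2 ⟨hb.1.1, h⟩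
    omega

lemma layer_isConvexSet (a : Fin n →₀ ℕ) (t c : ℕ) : IsConvexSet (layer a t c) := by
  intro b l m hb hlm
  have h := (layer_zero_isOrthantUnion a t).isConvexSet b l m ⟨hb.1, Nat.zero_le _⟩
    ⟨hlm.1, Nat.zero_le _⟩
  exact ⟨h.1, hb.2.trans (numAbove_mono le_self_add)⟩

/-- Write `s` for the truncated sum. In the sequence of two consecutive layers and their difference,
the larger layer and the difference are concentrated in degree `s + c`. This leaves degrees `s + c`
and `s + c + 1` for the smaller layer. -/
lemma layer_vanishes (k : Type u) [Field k] (a : Fin n →₀ ℕ) (t c : ℕ) :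
    ∀ (i : ℕ) {z : ℤ}, z ≠ (∑ j, min (a j) t + c : ℕ) →
      (ofSet k (layer a t c) (layer_isConvexSet a t c)).Vanishes i z := by
  induction c with
  | zero => exact fun i z hz => (layer_zero_isOrthantUnion a t).vanishes _ i hz
  | succ c ih =>
    intro i z hz
    by_cases hzc : z = (∑ j, min (a j) t + c : ℕ)
    -- Degree `s + c` is excluded: with at least `c + 1` entries above `t`, every monomial has
    -- degree at least `s + c + 1`.
    · refine OpModule.vanishes_of_eq_zero _ i z fun y hy => ?_
      ext b
      by_contra hne
      obtain ⟨hb, hbz⟩ := not_imp_comm.1 ((Finsupp.mem_supported' k y).1 hy b) hne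
      rw [hzc, Nat.cast_inj, Finsupp.degree_eq_sum] at hbz
      have h1 := sum_min_succ t b
      have h2 : ∑ j, min (b j) (t + 1) ≤ ∑ j, b j := Finset.sum_le_sum fun j _ => min_le_left _ _
      have h3 := sum_min_of_mem_layer hb
      have h4 := hb.2
      omega
    · have hd := (layer_diff_isOrthantUnion a t c).isConvexSet
      have hv : (ofSet k _ hd).Vanishes (i + 1) (z - 1) := by
        refine (layer_diff_isOrthantUnion a t c).vanishes hd _ fun h => hz ?_
        push_cast at h ⊢
        omega
      exact (ofSet_shortExact (k := k) (layer_isConvexSet a t c) (layer_isConvexSet a t (c + 1)) hd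
        (fun b hb => ⟨hb.1, (Nat.le_succ c).trans hb.2⟩)
        (fun b l hb hl => ⟨hl.1, hb.2.trans (numAbove_mono le_self_add)⟩)).vanishes_left
        (ih i hzc) hv

lemma numAbove_eq_card (t : ℕ) (a : Fin n →₀ ℕ) :
    numAbove t a = (Finset.univ.filter fun j => t + 1 ≤ a j).card := by
  rw [numAbove, Finset.card_filter]

/-- Fix the positions where `a < t`, inject those where `a = t + 1` into those where `b > t`, and
extend to a permutation. The positions where `a = t` then land where `b ≥ t`. -/
lemma exists_perm_le {a b : Fin n →₀ ℕ} {t : ℕ} (hat : ∀ j, a j ≤ t + 1)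
    (hab : ∀ j, min (b j) t = min (a j) t) (hc : numAbove t a ≤ numAbove t b) :
    ∃ τ : Equiv.Perm (Fin n), ∀ j, a j ≤ b (τ j) := by
  classical
  set A := Finset.univ.filter fun j => t + 1 ≤ a j with hA
  set B := Finset.univ.filter fun j => t + 1 ≤ b j with hB
  set L := Finset.univ.filter fun j => a j < t with hL
  have hcard : Fintype.card A ≤ Fintype.card B := by
    rw [Fintype.card_coe, Fintype.card_coe, hA, hB, ← numAbove_eq_card, ← numAbove_eq_card]
    exact hc
  obtain ⟨e⟩ := Function.Embedding.nonempty_of_card_le hcard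
  let f : Fin n → Fin n := fun j => if h : j ∈ A then (e ⟨j, h⟩).1 else j
  have hfA : ∀ j (h : j ∈ A), f j = (e ⟨j, h⟩).1 := fun j h => dif_pos h
  have hfA' : ∀ j ∈ A, t + 1 ≤ b (f j) := fun j h => by
    rw [hfA j h]
    exact (Finset.mem_filter.1 (e ⟨j, h⟩).2).2
  have hfL : ∀ j ∈ L, f j = j := fun j h => dif_neg fun h' => by
    have h1 := (Finset.mem_filter.1 h).2
    have h2 := (Finset.mem_filter.1 h').2
    omega
  have hbL : ∀ j ∈ L, b j < t := fun j h => by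
    have h1 := (Finset.mem_filter.1 h).2
    have := hab j
    omega
  have hinj : Set.InjOn f (L ∪ A : Finset (Fin n)) := by
    intro x hx y hy hxy
    rcases Finset.mem_union.1 hx with hx | hx <;> rcases Finset.mem_union.1 hy with hy | hy
    · rwa [hfL x hx, hfL y hy] at hxy
    · have h1 := hfA' y hy
      rw [← hxy, hfL x hx] at h1
      have := hbL x hx
      omega
    · have h1 := hfA' x hx
      rw [hxy, hfL y hy] at h1
      have := hbL y hy
      omega
    · rw [hfA x hx, hfA y hy] at hxy
      exact congrArg Subtype.val (e.injective (Subtype.ext hxy))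
  obtain ⟨g, hg⟩ := Finset.exists_equiv_extend_of_card_eq (t := (Finset.univ : Finset (Fin n)))
    (by simp) (Finset.subset_univ _) hinj
  let τ : Equiv.Perm (Fin n) := g.trans (Equiv.subtypeUnivEquiv Finset.mem_univ)
  have hτ : ∀ j ∈ L ∪ A, τ j = f j := hg
  refine ⟨τ, fun j => ?_⟩
  by_cases hjL : j ∈ L
  · rw [hτ j (Finset.mem_union_left _ hjL), hfL j hjL]
    have := hab j
    have := (Finset.mem_filter.1 hjL).2
    omega
  · by_cases hjA : j ∈ A
    · rw [hτ j (Finset.mem_union_right _ hjA)]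
      exact (hat j).trans (hfA' j hjA)
    · have h1 : ¬ t + 1 ≤ a j := fun h => hjA (Finset.mem_filter.2 ⟨Finset.mem_univ _, h⟩)
      have h2 : t ≤ b (τ j) := by
        by_contra hlt
        -- A position with `b < t` is fixed by `τ`, so it is not the image of an index outside `L`.
        have h3 : τ j ∈ L := Finset.mem_filter.2 ⟨Finset.mem_univ _, by
          have := hab (τ j)
          omega⟩
        have h4 : τ (τ j) = τ j := (hτ _ (Finset.mem_union_left _ h3)).trans (hfL _ h3)
        exact hjL (τ.injective h4 ▸ h3)
      omega

/-- The entries that may be raised are those below `t`. Not being a multiple of a raised monomial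
freezes them, so the truncation at `t` is a rearrangement of that of `a`. Conversely, raising such
an entry would increase the truncated sum. -/
lemma orbitDiff_eq_layer {a : Fin n →₀ ℕ} {t : ℕ} (ht : top a = t + 1) :
    orbitDiff a = layer a t (numAbove t a) := by
  ext b
  constructor
  · rintro ⟨⟨σ, hσ⟩, hb⟩
    have h := mapDomain_perm_le.1 hσ
    refine ⟨⟨σ, fun j => ?_⟩, ?_⟩
    · by_cases hj : a j + 1 < top a
      · rw [orbitDiff_spec hb hσ hj]
      · have := h j
        omega
    · calc numAbove t a = numAbove t (a.mapDomain σ) :=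
            (sum_comp_mapDomain_perm σ a fun x => if t + 1 ≤ x then 1 else 0).symm
        _ ≤ numAbove t b := numAbove_mono hσ
  · intro hb
    refine ⟨?_, ?_⟩
    · obtain ⟨⟨σ, hσ⟩, hc⟩ := hb
      obtain ⟨τ, hτ⟩ := exists_perm_le (a := a)
        (b := b.mapDomain (σ.symm : Equiv.Perm (Fin n))) (t := t)
        (fun j => ht ▸ le_top a j)
        (fun j => by
          have := mapDomain_perm_apply σ.symm b (σ j)
          rw [Equiv.symm_apply_apply] at this
          rw [this, hσ])
        (hc.trans_eq
          (sum_comp_mapDomain_perm σ.symm b fun x => if t + 1 ≤ x then 1 else 0).symm)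
      refine ⟨σ * τ, mapDomain_perm_le.2 fun j => (hτ j).trans_eq ?_⟩
      have := mapDomain_perm_apply σ.symm b (σ (τ j))
      rwa [Equiv.symm_apply_apply] at this
    · rintro ⟨j, hj, σ, hσ⟩
      have h1 := sum_min_of_mem_layer hb
      have h2 := IsOrthantUnion.sum_min_lt (t := t) a (l := j) (by omega)
      have h3 : ∑ i, min ((Finsupp.single j 1 + a).mapDomain σ i) t ≤ ∑ i, min (b i) t :=
        Finset.sum_le_sum fun i _ => min_le_min_right _ (hσ i)
      rw [sum_comp_mapDomain_perm σ _ fun x => min x t, add_comm] at h3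
      omega

lemma orbitDiff_isConvexSet (a : Fin n →₀ ℕ) : IsConvexSet (orbitDiff a) := by
  rintro b l m ⟨hb, -⟩ ⟨-, h⟩
  exact ⟨orbitUp_mono hb le_self_add, fun h' => h (raisedUp_mono h' le_self_add)⟩

lemma orbitDiff_vanishes (k : Type u) [Field k] (a : Fin n →₀ ℕ) (i : ℕ) {z : ℤ}
    (hz : z ≠ a.degree) : (ofSet k (orbitDiff a) (orbitDiff_isConvexSet a)).Vanishes i z := by
  rcases h : top a with - | t
  · have ha : a = 0 := by
      ext j
      have := le_top a j
      simp only [Finsupp.coe_zero, Pi.zero_apply]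
      omega
    subst ha
    -- Here `N^λ` is `S` itself, a single orthant truncated at zero.
    have hE : IsOrthantUnion (orbitDiff (0 : Fin n →₀ ℕ)) 0 0 :=
      { mem_of_min_eq := fun b b' _ _ => by
          refine ⟨⟨1, mapDomain_perm_le.2 fun j => Nat.zero_le _⟩, ?_⟩
          rintro ⟨j, hj, -⟩
          omega
        sum_min := fun b _ => by simp }
    exact hE.vanishes _ i (by simpa using hz)
  · have e := orbitDiff_eq_layer h
    have hdeg : a.degree = ∑ j, min (a j) t + numAbove t a := by
      rw [← sum_min_succ, Finsupp.degree_eq_sum]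
      exact Finset.sum_congr rfl fun j _ => (min_eq_left (h ▸ le_top a j)).symm
    rw [hdeg] at hz
    have := layer_vanishes k a t _ i hz
    simp only [e]
    exact this

end Exponents

lemma OpModule.Vanishes.of_bijective {k : Type u} [Field k] {n : ℕ} {A : OpModule.{u, v} k n}
    {B : OpModule.{u, w} k n} {T : A.V →ₗ[k] B.V} (hT : OpModule.IsHom A B T)
    (hinj : ∀ z, ∀ a ∈ A.D z, T a = 0 → a = 0) (hsurj : ∀ z, ∀ b ∈ B.D z, ∃ a ∈ A.D z, T a = b)
    {i : ℕ} {z : ℤ} (h : A.Vanishes i z) : B.Vanishes i z := by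
  rintro f ⟨hf, hfz⟩
  obtain ⟨g, hg, rfl⟩ := exists_chain_lift T _ _ (hsurj z) hfz
  refine hT.comp_mem_boundaries (h ⟨?_, hg⟩)
  cases i with
  | zero => trivial
  | succ i =>
    have h0 := (hT.koszulD_comp hg).symm.trans hf
    change koszulD A.x i g = 0
    ext v
    exact hinj _ _ (A.koszulD_mem hg v) (DFunLike.congr_fun h0 v)

/-! ### Monomial ideals and the monomial basis of `N^λ` -/

section MonomialIdeals

variable {k : Type u} [Field k] {n : ℕ}

lemma mem_span_mon {A : Set (Fin n →₀ ℕ)} {f : MvPolynomial (Fin n) k} :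
    f ∈ Ideal.span (mon k '' A) ↔ ∀ b ∈ f.support, ∃ a ∈ A, a ≤ b :=
  mem_ideal_span_monomial_image

lemma mon_mem_span_mon {A : Set (Fin n →₀ ℕ)} {b : Fin n →₀ ℕ} :
    mon k b ∈ Ideal.span (mon k '' A) ↔ ∃ a ∈ A, a ≤ b := by
  classical
  rw [mem_span_mon, mon, support_monomial, if_neg one_ne_zero]
  simp

lemma orbitIdeal_eq_span (A : Set (Fin n →₀ ℕ)) : orbitIdeal (mon k '' A) =
    Ideal.span (mon k '' {b | ∃ a ∈ A, ∃ σ : Equiv.Perm (Fin n), b = a.mapDomain σ}) := by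
  rw [orbitIdeal]
  congr 1
  ext g
  constructor
  · rintro ⟨_, ⟨a, ha, rfl⟩, σ, rfl⟩
    exact ⟨_, ⟨a, ha, σ, rfl⟩, (rename_monomial σ a 1).symm⟩
  · rintro ⟨_, ⟨a, ha, σ, rfl⟩, rfl⟩
    exact ⟨_, ⟨a, ha, rfl⟩, σ, (rename_monomial σ a 1).symm⟩

lemma mem_orbitIdeal {A : Set (Fin n →₀ ℕ)} {f : MvPolynomial (Fin n) k} :
    f ∈ orbitIdeal (mon k '' A) ↔
      ∀ b ∈ f.support, ∃ a ∈ A, ∃ σ : Equiv.Perm (Fin n), a.mapDomain σ ≤ b := by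
  rw [orbitIdeal_eq_span, mem_span_mon]
  refine forall₂_congr fun b _ => ?_
  constructor
  · rintro ⟨_, ⟨a, ha, σ, rfl⟩, h⟩
    exact ⟨a, ha, σ, h⟩
  · rintro ⟨a, ha, σ, h⟩
    exact ⟨_, ⟨a, ha, σ, rfl⟩, h⟩

lemma mem_orbitIdeal_singleton {a : Fin n →₀ ℕ} {f : MvPolynomial (Fin n) k} :
    f ∈ orbitIdeal (mon k '' {a}) ↔ ∀ b ∈ f.support, b ∈ orbitUp a := by
  rw [mem_orbitIdeal]
  simp [orbitUp]

lemma exists_last_iff {a : Fin n →₀ ℕ} (ha : IsPartition a) (m : Fin n) :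
    (∃ l : Fin n, (l : ℕ) + 1 = n ∧ a m + 1 < a l) ↔ a m + 1 < top a := by
  constructor
  · rintro ⟨l, -, h⟩
    exact h.trans_le (le_top a l)
  · intro h
    have hn := m.pos
    refine ⟨⟨n - 1, by omega⟩, by simp only; omega, h.trans_le ?_⟩
    refine Finset.sup_le fun j _ => ha ?_
    rw [Fin.le_def]
    simp only
    omega

/-- The entries of a partition are nondecreasing, so the small ones occupy an initial segment of
length `p(λ)`. -/
lemma lt_numSmall_iff {a : Fin n →₀ ℕ} (ha : IsPartition a) (i : Fin n) :
    (i : ℕ) < numSmall a ↔ a i + 1 < top a := by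
  simp only [numSmall, exists_last_iff ha]
  constructor
  · intro h
    by_contra hi
    have hsub : {m : Fin n | a m + 1 < top a} ⊆ (Finset.Iio i : Finset (Fin n)) := by
      intro m hm
      rw [Finset.coe_Iio, Set.mem_Iio]
      by_contra hle
      have := ha (not_lt.1 hle)
      have hm : a m + 1 < top a := hm
      omega
    have := Set.ncard_le_ncard hsub (Finset.finite_toSet _)
    rw [Set.ncard_coe_finset, Fin.card_Iio] at this
    omega
  · intro hi
    have hsub : ((Finset.Iic i : Finset (Fin n)) : Set (Fin n)) ⊆
        {m : Fin n | a m + 1 < top a} := by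
      intro m hm
      rw [Finset.coe_Iic, Set.mem_Iic] at hm
      have := ha hm
      change a m + 1 < top a
      omega
    have := Set.ncard_le_ncard hsub (Set.toFinite _)
    rw [Set.ncard_coe_finset, Fin.card_Iic] at this
    omega

lemma mem_orbitIdeal_raised {a : Fin n →₀ ℕ} (ha : IsPartition a) {f : MvPolynomial (Fin n) k} :
    f ∈ orbitIdeal (mon k '' raised a) ↔ ∀ b ∈ f.support, b ∈ raisedUp a := by
  rw [mem_orbitIdeal]
  refine forall₂_congr fun b _ => ?_
  constructor
  · rintro ⟨_, ⟨i, hi, rfl⟩, σ, h⟩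
    exact ⟨i, (lt_numSmall_iff ha i).1 hi, σ, h⟩
  · rintro ⟨i, hi, σ, h⟩
    exact ⟨_, ⟨i, (lt_numSmall_iff ha i).2 hi, rfl⟩, σ, h⟩

open Classical in
/-- The polynomial with given coefficients at the exponents in `E`. -/
def setPoly (k : Type u) [Field k] (E : Set (Fin n →₀ ℕ)) :
    ((Fin n →₀ ℕ) →₀ k) →ₗ[k] MvPolynomial (Fin n) k :=
  Finsupp.linearCombination k fun a => if a ∈ E then mon k a else 0

open Classical in
lemma coeff_setPoly (E : Set (Fin n →₀ ℕ)) (y : (Fin n →₀ ℕ) →₀ k) (b : Fin n →₀ ℕ) :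
    coeff b (setPoly k E y) = if b ∈ E then y b else 0 := by
  have : lcoeff k b ∘ₗ setPoly k E =
      if b ∈ E then (Finsupp.lapply b : ((Fin n →₀ ℕ) →₀ k) →ₗ[k] k) else 0 := by
    refine end_ext fun a => ?_
    simp only [LinearMap.comp_apply, setPoly, Finsupp.linearCombination_single, one_smul,
      lcoeff_apply]
    by_cases hb : b ∈ E
    · rw [if_pos hb, Finsupp.lapply_apply, Finsupp.single_apply]
      split_ifs with h1 h2 h2
      · rw [mon, coeff_monomial, if_pos h2]
      · rw [mon, coeff_monomial, if_neg h2]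
      · exact absurd (h2 ▸ hb) h1
      · rfl
    · rw [if_neg hb, LinearMap.zero_apply]
      split_ifs with h1
      · rw [mon, coeff_monomial, if_neg (fun h : a = b => hb (h ▸ h1))]
      · rfl
  have h := LinearMap.congr_fun this y
  split_ifs at h ⊢ <;> exact h

lemma setPoly_single {E : Set (Fin n →₀ ℕ)} {a : Fin n →₀ ℕ} (h : a ∈ E) :
    setPoly k E (Finsupp.single a 1) = mon k a := by
  rw [setPoly, Finsupp.linearCombination_single, one_smul, if_pos h]

lemma mem_of_mem_support_setPoly {E : Set (Fin n →₀ ℕ)} {y : (Fin n →₀ ℕ) →₀ k}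
    {b : Fin n →₀ ℕ} (hb : b ∈ (setPoly k E y).support) : b ∈ E := by
  classical
  rw [mem_support_iff, coeff_setPoly] at hb
  by_contra h
  exact hb (if_neg h)

/-- The basis of `N^λ` by monomials. -/
def setToN (k : Type u) [Field k] (a : Fin n →₀ ℕ) :
    ((Fin n →₀ ℕ) →₀ k) →ₗ[k] (Nmod k a).carrier :=
  ((relSub (orbitIdeal (mon k '' {a})) (orbitIdeal (mon k '' raised a))).mkQ.restrictScalars k) ∘ₗ
    (setPoly k (orbitDiff a)).codRestrict
      ((orbitIdeal (mon k '' {a})).restrictScalars k) fun _ =>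
        mem_orbitIdeal_singleton.2 fun _ hb => (mem_of_mem_support_setPoly hb).1

lemma setToN_eq_zero {a : Fin n →₀ ℕ} {y : (Fin n →₀ ℕ) →₀ k} :
    setToN k a y = 0 ↔ setPoly k (orbitDiff a) y ∈ orbitIdeal (mon k '' raised a) :=
  Submodule.Quotient.mk_eq_zero _

lemma setToN_isHom {a : Fin n →₀ ℕ} (ha : IsPartition a) :
    OpModule.IsHom (ofSet k (orbitDiff a) (orbitDiff_isConvexSet a)) (Nmod k a).toOp
      (setToN k a) where
  map_mem z := setD_induction (setToN k a) fun b hb hz => by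
    subst hz
    refine ⟨⟨setPoly k (orbitDiff a) (Finsupp.single b 1), _⟩, ?_, rfl⟩
    change setPoly k (orbitDiff a) (Finsupp.single b 1) ∈ homogeneousSubmodule (Fin n) k b.degree
    rw [setPoly_single hb]
    exact isHomogeneous_monomial _ rfl
  map_x l z := setD_ext (setToN k a ∘ₗ setX k (orbitDiff a) l)
      (mulX k (Nmod k a).carrier l ∘ₗ setToN k a) fun b hb _ => by
    refine (Submodule.Quotient.eq _).2 ?_
    change setPoly k (orbitDiff a) (setX k (orbitDiff a) l (Finsupp.single b 1)) -
      X l * setPoly k (orbitDiff a) (Finsupp.single b 1) ∈ orbitIdeal (mon k '' raised a)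
    have hX : X l * mon k b = mon k (b + Finsupp.single l 1) := by
      rw [mon, mon, X, monomial_mul, one_mul, add_comm]
    rw [setPoly_single hb, hX]
    by_cases h : b + Finsupp.single l 1 ∈ orbitDiff a
    · rw [setX_single_of_mem hb h, setPoly_single h, sub_self]
      exact Ideal.zero_mem _
    · rw [setX_single_of_notMem fun h' => h h'.2, map_zero, zero_sub, neg_mem_iff,
        mem_orbitIdeal_raised ha]
      intro c hc
      rw [Finset.mem_singleton.1 (support_monomial_subset hc)]
      by_contra h'
      exact h ⟨orbitUp_mono hb.1 le_self_add, h'⟩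

lemma Nmod_vanishes {a : Fin n →₀ ℕ} (ha : IsPartition a) (i : ℕ) {z : ℤ} (hz : z ≠ a.degree) :
    (Nmod k a).toOp.Vanishes i z := by
  classical
  refine (orbitDiff_vanishes k a i hz).of_bijective (setToN_isHom ha) ?_ ?_
  · intro z y hy h0
    rw [setToN_eq_zero, mem_orbitIdeal_raised ha] at h0
    ext b
    by_contra hne
    have hb := (not_imp_comm.1 ((Finsupp.mem_supported' k y).1 hy b) hne).1
    refine hb.2 (h0 b ?_)
    rw [mem_support_iff, coeff_setPoly, if_pos hb]
    exact hne
  · intro z c hc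
    rcases z with j | j
    · obtain ⟨⟨f, hf⟩, hfj, rfl⟩ := hc
      change f.IsHomogeneous j at hfj
      -- Terms of `f` outside `orbitDiff a` lie in the denominator of `N^λ` and may be dropped.
      let y : (Fin n →₀ ℕ) →₀ k :=
        Finsupp.onFinset f.support (fun b => if b ∈ orbitDiff a then coeff b f else 0) fun b hb =>
          mem_support_iff.2 fun h => hb (by simp [h])
      have hy : ∀ b, y b = if b ∈ orbitDiff a then coeff b f else 0 := fun b => rfl
      refine ⟨y, (Finsupp.mem_supported' k y).2 fun b hb => ?_, ?_⟩
      · rw [hy]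
        by_contra hne
        split_ifs at hne with h
        · refine hb ⟨h, ?_⟩
          have := hfj hne
          rw [Finsupp.degree_eq_weight_one]
          exact congrArg Nat.cast this
        · exact hne rfl
      · refine (Submodule.Quotient.eq _).2 ?_
        change setPoly k (orbitDiff a) y - f ∈ orbitIdeal (mon k '' raised a)
        rw [mem_orbitIdeal_raised ha]
        intro b hb
        rw [mem_support_iff, coeff_sub, coeff_setPoly, hy] at hb
        by_contra h
        split_ifs at hb with h1
        · exact hb (sub_self _)
        · rw [zero_sub, neg_ne_zero, ← mem_support_iff] at hb
          exact h1 ⟨mem_orbitIdeal_singleton.1 hf b hb, h⟩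
    · rw [(Submodule.mem_bot k).1 hc]
      exact ⟨0, Submodule.zero_mem _, map_zero _⟩

end MonomialIdeals

/-! ## Shifted sets of exponents -/

section ShiftedSets

variable {n : ℕ}

/-- The sum of the squares of the exponents. -/
def sumSq (a : Fin n →₀ ℕ) : ℕ := ∑ j, a j ^ 2

lemma sumSq_mapDomain_perm (σ : Equiv.Perm (Fin n)) (a : Fin n →₀ ℕ) :
    sumSq (a.mapDomain σ) = sumSq a :=
  sum_comp_mapDomain_perm σ a (· ^ 2)

lemma sumSq_add_single (a : Fin n →₀ ℕ) (l : Fin n) :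
    sumSq (a + Finsupp.single l 1) = sumSq a + (2 * a l + 1) := by
  have h : ∀ j, (a + Finsupp.single l 1 : Fin n →₀ ℕ) j ^ 2 =
      a j ^ 2 + if j = l then 2 * a l + 1 else 0 := fun j => by
    rw [Finsupp.add_apply, Finsupp.single_apply]
    by_cases hj : j = l
    · subst hj
      simp only [if_true]
      ring
    · rw [if_neg (Ne.symm hj), if_neg hj]
      rfl
  simp only [sumSq, h, Finset.sum_add_distrib, Finset.sum_ite_eq', Finset.mem_univ, if_true]

lemma mapDomain_add_single (σ : Equiv.Perm (Fin n)) (a : Fin n →₀ ℕ) (l : Fin n) :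
    (a + Finsupp.single l 1).mapDomain σ = a.mapDomain σ + Finsupp.single (σ l) 1 := by
  rw [Finsupp.mapDomain_add, Finsupp.mapDomain_single]

lemma mapDomain_mapDomain_perm (σ τ : Equiv.Perm (Fin n)) (a : Fin n →₀ ℕ) :
    (a.mapDomain τ).mapDomain σ = a.mapDomain (σ * τ : Equiv.Perm (Fin n)) := by
  rw [Equiv.Perm.coe_mul, Finsupp.mapDomain_comp]

lemma mapDomain_symm_mapDomain (σ : Equiv.Perm (Fin n)) (a : Fin n →₀ ℕ) :
    (a.mapDomain σ.symm).mapDomain σ = a := by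
  ext j
  obtain ⟨j, rfl⟩ := σ.surjective j
  rw [mapDomain_perm_apply]
  have := mapDomain_perm_apply σ.symm a (σ j)
  rwa [Equiv.symm_apply_apply] at this

lemma mapDomain_swap {a : Fin n →₀ ℕ} {l m : Fin n} (h : a l = a m) :
    a.mapDomain (Equiv.swap l m) = a := by
  ext j
  obtain ⟨j, rfl⟩ := (Equiv.swap l m).surjective j
  rw [mapDomain_perm_apply]
  by_cases hl : j = l
  · rw [hl, Equiv.swap_apply_left, h]
  · by_cases hm : j = m
    · rw [hm, Equiv.swap_apply_right, h]
    · rw [Equiv.swap_apply_of_ne_of_ne hl hm]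

/-- Raising `c` to `c + 1` adds `2c + 1` to the sum of squares. Equality forces `a l = a m`, and
then the two exponents differ by the transposition of `l` and `m`. -/
lemma sumSq_shift {a : Fin n →₀ ℕ} {l m : Fin n} (h : a m ≤ a l) :
    sumSq (a + Finsupp.single m 1) ≤ sumSq (a + Finsupp.single l 1) ∧
      (sumSq (a + Finsupp.single m 1) = sumSq (a + Finsupp.single l 1) →
        ∃ σ : Equiv.Perm (Fin n), a + Finsupp.single m 1 =
          (a + Finsupp.single l 1).mapDomain σ) := by
  rw [sumSq_add_single, sumSq_add_single]
  refine ⟨by omega, fun h' => ⟨Equiv.swap l m, ?_⟩⟩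
  rw [mapDomain_add_single, Equiv.swap_apply_left, mapDomain_swap (by omega)]

lemma exists_monotone_perm (a : Fin n →₀ ℕ) :
    ∃ (b : Fin n →₀ ℕ) (σ : Equiv.Perm (Fin n)), IsPartition b ∧ b.mapDomain σ = a := by
  refine ⟨a.mapDomain (Tuple.sort a).symm, Tuple.sort a, ?_, mapDomain_symm_mapDomain _ _⟩
  have : ⇑(a.mapDomain (Tuple.sort a).symm) = a ∘ Tuple.sort a := by
    funext j
    rw [Finsupp.mapDomain_equiv_apply, Equiv.symm_symm]
    rfl
  rw [IsPartition, this]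
  exact Tuple.monotone_sort a

lemma eq_of_mapDomain_perm {a b : Fin n →₀ ℕ} (ha : IsPartition a) (hb : IsPartition b)
    {σ : Equiv.Perm (Fin n)} (h : a.mapDomain σ = b) : a = b := by
  have h1 : ⇑a = b ∘ σ := by
    funext j
    rw [← h]
    exact (mapDomain_perm_apply σ a j).symm
  have h2 := Tuple.unique_monotone (f := b) (σ := σ) (τ := 1) (h1 ▸ ha) hb
  exact DFunLike.coe_injective (h1.trans h2)

lemma eq_of_le_of_degree_le {a b : Fin n →₀ ℕ} (h : a ≤ b) (hd : b.degree ≤ a.degree) :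
    a = b := by
  rw [Finsupp.degree_eq_sum, Finsupp.degree_eq_sum] at hd
  have h1 : ∑ j, a j = ∑ j, b j := le_antisymm (Finset.sum_le_sum fun j _ => h j) hd
  ext j
  exact (Finset.sum_eq_sum_iff_of_le fun j _ => h j).1 h1 j (Finset.mem_univ j)

lemma degree_le_of_le {a b : Fin n →₀ ℕ} (h : a ≤ b) : a.degree ≤ b.degree := by
  rw [Finsupp.degree_eq_sum, Finsupp.degree_eq_sum]
  exact Finset.sum_le_sum fun j _ => h j

/-- The sets of exponents of symmetric shifted ideals. -/
structure IsShiftedSet (S : Set (Fin n →₀ ℕ)) : Prop where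
  up : ∀ {a b}, a ∈ S → a ≤ b → b ∈ S
  perm : ∀ {a} (σ : Equiv.Perm (Fin n)), a ∈ S → a.mapDomain σ ∈ S
  shift : ∀ {a : Fin n →₀ ℕ} {l m : Fin n}, a + Finsupp.single l 1 ∈ S →
    (∀ j, (a + Finsupp.single l 1 : Fin n →₀ ℕ) j ≤ a l + 1) → a m ≤ a l →
    a + Finsupp.single m 1 ∈ S

/-- The partitions that are minimal elements of a set of exponents. -/
def generators (S : Set (Fin n →₀ ℕ)) : Set (Fin n →₀ ℕ) :=
  {a | IsPartition a ∧ Minimal (· ∈ S) a}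

/-- Dickson's lemma: minimal exponents form an antichain in a well quasi-order. -/
lemma generators_finite (S : Set (Fin n →₀ ℕ)) : (generators S).Finite := by
  have h : {a | Minimal (· ∈ S) a}.Finite :=
    (setOfPred_minimal_antichain (· ∈ S)).finite_of_partiallyWellOrderedOn
      (Set.isPWO_of_wellQuasiOrderedLE _)
  exact h.subset fun a ha => ha.2

namespace IsShiftedSet

variable {S : Set (Fin n →₀ ℕ)}

lemma perm_iff (hS : IsShiftedSet S) {a : Fin n →₀ ℕ} (σ : Equiv.Perm (Fin n)) :
    a.mapDomain σ ∈ S ↔ a ∈ S := by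
  refine ⟨fun h => ?_, hS.perm σ⟩
  have := hS.perm σ.symm h
  have e := mapDomain_symm_mapDomain σ.symm a
  rw [Equiv.symm_symm] at e
  rwa [e] at this

lemma mem_of_mem_orbitUp (hS : IsShiftedSet S) {a b : Fin n →₀ ℕ} (ha : a ∈ S)
    (hb : b ∈ orbitUp a) : b ∈ S := by
  obtain ⟨σ, hσ⟩ := hb
  exact hS.up (hS.perm σ ha) hσ

lemma exists_generator (hS : IsShiftedSet S) {b : Fin n →₀ ℕ} (hb : b ∈ S) :
    ∃ a ∈ generators S, b ∈ orbitUp a := by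
  obtain ⟨m, hmb, hm⟩ := exists_minimal_le_of_wellFoundedLT (· ∈ S) b hb
  obtain ⟨a, σ, ha, rfl⟩ := exists_monotone_perm m
  refine ⟨a, ⟨ha, (hS.perm_iff σ).1 hm.1, fun c hc hca => ?_⟩, σ, hmb⟩
  have h1 : c.mapDomain σ ≤ a.mapDomain σ := mapDomain_perm_le.2 fun j => by
    rw [mapDomain_perm_apply]
    exact hca j
  have h2 := hm.2 (hS.perm σ hc) h1
  intro j
  have := h2 (σ j)
  rwa [mapDomain_perm_apply, mapDomain_perm_apply] at this

/-- Shifting an element of `S` below `b` when it is small enough where `b` is small. -/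
lemma exists_le_of_shift (hS : IsShiftedSet S) (b : Fin n →₀ ℕ) :
    ∀ (e : ℕ) (a : Fin n →₀ ℕ), ∑ j, (a j - b j) = e → a ∈ S → a.degree ≤ b.degree →
      (∀ j, b j + 1 < top b → a j ≤ b j) →
      ∃ c ∈ S, c ≤ b ∧ c.degree = a.degree ∧ sumSq c ≤ sumSq a ∧
        (sumSq c = sumSq a → ∃ σ : Equiv.Perm (Fin n), c = a.mapDomain σ) := by
  intro e
  induction e with
  | zero =>
    intro a he ha _ _
    refine ⟨a, ha, fun j => ?_, rfl, le_rfl, fun _ => ⟨1, by simp⟩⟩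
    have := Finset.sum_eq_zero_iff.1 he j (Finset.mem_univ j)
    omega
  | succ e ih =>
    intro a he ha hdeg hsmall
    have hex : ∃ j, b j < a j := by
      by_contra hcon
      push Not at hcon
      rw [Finset.sum_eq_zero fun j _ => Nat.sub_eq_zero_of_le (hcon j)] at he
      omega
    -- Excess occurs only where `b` is at least `top b - 1`, so an excess entry is at least `top b`.
    -- If a largest entry of `a` is not in excess, it is at most `top b`, and any excess entry is
    -- then also largest.
    obtain ⟨l, hmax, hl⟩ : ∃ l, (∀ j, a j ≤ a l) ∧ b l < a l := by
      obtain ⟨j, hj⟩ := hex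
      obtain ⟨l, -, hl⟩ := Finset.exists_max_image Finset.univ a ⟨j, Finset.mem_univ j⟩
      by_cases hbl : b l < a l
      · exact ⟨l, fun j => hl j (Finset.mem_univ j), hbl⟩
      · refine ⟨j, fun i => (hl i (Finset.mem_univ i)).trans ?_, hj⟩
        have h1 : ¬ b j + 1 < top b := fun h => absurd (hsmall j h) (by omega)
        have := le_top b l
        omega
    have hltop : top b ≤ a l := by
      have h1 : ¬ b l + 1 < top b := fun h => absurd (hsmall l h) (by omega)
      omega
    -- The degree bound forces a deficit somewhere; a unit moves from `l` to `m`, which lowers the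
    -- total excess by one.
    obtain ⟨m, hm⟩ : ∃ m, a m < b m := by
      by_contra hcon
      push Not at hcon
      have := eq_of_le_of_degree_le (a := b) (b := a) hcon hdeg
      rw [this] at hl
      exact hl.false
    have hmt := le_top b m
    have hlm : l ≠ m := by
      rintro rfl
      omega
    obtain ⟨c, rfl, -⟩ := exists_eq_add_single (a := a) (c := l) (t := 0) (by omega)
    have hcl : (c + Finsupp.single l 1 : Fin n →₀ ℕ) l = c l + 1 := by simp
    have hcm : (c + Finsupp.single l 1 : Fin n →₀ ℕ) m = c m := by simp [hlm]
    have hcj : ∀ j, j ≠ l → (c + Finsupp.single l 1 : Fin n →₀ ℕ) j = c j := fun j hj => by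
      simp [hj.symm]
    rw [hcl] at hl hltop hmax
    rw [hcm] at hm
    have hml : c m ≤ c l := by omega
    have hdeg' : (c + Finsupp.single m 1).degree = (c + Finsupp.single l 1).degree := by
      rw [degree_add_single, degree_add_single]
    have hsum : ∑ j, ((c + Finsupp.single m 1 : Fin n →₀ ℕ) j - b j) = e := by
      have h1 : ∑ j, ((c + Finsupp.single l 1 : Fin n →₀ ℕ) j - b j) =
          ∑ j, (((c + Finsupp.single m 1 : Fin n →₀ ℕ) j - b j) + if j = l then 1 else 0) := by
        refine Finset.sum_congr rfl fun j _ => ?_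
        simp only [Finsupp.add_apply, Finsupp.single_apply]
        by_cases h1 : j = l
        · subst h1
          rw [if_pos rfl, if_neg hlm.symm]
          omega
        · rw [if_neg (Ne.symm h1), if_neg h1]
          by_cases h2 : j = m
          · subst h2
            rw [if_pos rfl]
            omega
          · rw [if_neg (Ne.symm h2)]
            rfl
      rw [he, Finset.sum_add_distrib] at h1
      simp only [Finset.sum_ite_eq', Finset.mem_univ, if_true] at h1
      omega
    obtain ⟨c', hc', hcb, hcd, hcs, hce⟩ := ih (c + Finsupp.single m 1) hsum
      (hS.shift ha hmax hml) (hdeg'.trans_le hdeg) (fun j hj => by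
        by_cases h1 : j = m
        · subst h1
          simp only [Finsupp.add_apply, Finsupp.single_eq_same]
          omega
        · have := hsmall j hj
          simp only [Finsupp.add_apply, Finsupp.single_apply, if_neg (Ne.symm h1)] at this ⊢
          omega)
    have hsq := sumSq_shift hml
    refine ⟨c', hc', hcb, hcd.trans hdeg', hcs.trans hsq.1, fun h => ?_⟩
    obtain ⟨σ, rfl⟩ := hce (le_antisymm hcs (h ▸ hsq.1))
    obtain ⟨τ, hτ⟩ := hsq.2 (le_antisymm hsq.1 (h ▸ hcs))
    exact ⟨σ * τ, by rw [hτ, mapDomain_mapDomain_perm]⟩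

end IsShiftedSet

/-- The multiples of the orbits of the minimal partitions other than `b`. -/
def removeOrbit (S : Set (Fin n →₀ ℕ)) (b : Fin n →₀ ℕ) : Set (Fin n →₀ ℕ) :=
  {c | ∃ a ∈ generators S, a ≠ b ∧ c ∈ orbitUp a}

/-- `b` is a minimal partition of maximal degree and, in that degree, with maximal sum of squares
of the exponents. -/
structure IsLastGenerator (S : Set (Fin n →₀ ℕ)) (b : Fin n →₀ ℕ) : Prop where
  mem : b ∈ generators S
  degree_le : ∀ a ∈ generators S, a.degree ≤ b.degree
  sumSq_le : ∀ a ∈ generators S, a.degree = b.degree → sumSq a ≤ sumSq b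

lemma exists_isLastGenerator {S : Set (Fin n →₀ ℕ)} (h : (generators S).Nonempty) :
    ∃ b, IsLastGenerator S b := by
  obtain ⟨b, hb, hmax⟩ := Set.exists_max_image (generators S)
    (fun a => toLex (a.degree, sumSq a)) (generators_finite S) h
  refine ⟨b, hb, fun a ha => ?_, fun a ha hd => ?_⟩
  · rcases Prod.Lex.le_iff.1 (hmax a ha) with h | h
    · exact h.le
    · exact h.1.le
  · rcases Prod.Lex.le_iff.1 (hmax a ha) with h | h
    · exact absurd hd h.ne
    · exact h.2

namespace IsLastGenerator

variable {S : Set (Fin n →₀ ℕ)} {b : Fin n →₀ ℕ}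

/-- A generator whose orbit contains an element of the right degree that can be shifted into the
orbit of `b` is `b` itself. -/
lemma eq_of_shift (hb : IsLastGenerator S b) {a c : Fin n →₀ ℕ} (ha : a ∈ generators S)
    {σ : Equiv.Perm (Fin n)} (hbc : b.degree ≤ c.degree) (hσ : b.mapDomain σ ≤ c)
    (hd : c.degree = a.degree)
    (hsq : sumSq c ≤ sumSq a)
    (heq : sumSq c = sumSq a → ∃ τ : Equiv.Perm (Fin n), c = a.mapDomain τ) : a = b := by
  have h1 : b.mapDomain σ = c := eq_of_le_of_degree_le hσ (by
    rw [degree_mapDomain_perm, hd]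
    exact hb.degree_le a ha)
  have h2 : a.degree = b.degree := le_antisymm (hb.degree_le a ha) (hd ▸ hbc)
  have h3 : sumSq c = sumSq b := by rw [← h1, sumSq_mapDomain_perm]
  -- The element `c` lies in the orbit of `b`, so the sum of squares of `b` is at most that of `a`,
  -- and the choice of `b` gives equality.
  obtain ⟨τ, hτ⟩ := heq (le_antisymm hsq (h3 ▸ hb.sumSq_le a ha h2))
  have h4 : a.mapDomain (σ.symm * τ : Equiv.Perm (Fin n)) = b := by
    rw [← mapDomain_mapDomain_perm, ← hτ, ← h1]
    have := mapDomain_symm_mapDomain σ.symm b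
    rwa [Equiv.symm_symm] at this
  exact eq_of_mapDomain_perm ha.1 hb.mem.1 h4

/-- Suppose `x^c` is a common multiple of orbit elements of `b` and of another generator `a`, but of
no raised monomial. Then a permutation of `a` is at most `b` at all small positions of `b`. Since
also `|a| ≤ |b|`, shifts bring it below `b`, hence onto `b` by minimality. The sum of squares then
forces `a = b`. -/
lemma orbitUp_inter_subset (hb : IsLastGenerator S b) (hS : IsShiftedSet S) :
    orbitUp b ∩ removeOrbit S b ⊆ raisedUp b := by
  rintro c ⟨⟨σ, hσ⟩, a, ha, hab, τ, hτ⟩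
  by_contra hc
  let a' := (a.mapDomain τ).mapDomain σ.symm
  have haS : a' ∈ S := hS.perm _ (hS.perm _ ha.2.1)
  have hle : ∀ j, a' j ≤ c (σ j) := fun j => by
    rw [Finsupp.mapDomain_equiv_apply, Equiv.symm_symm]
    exact hτ (σ j)
  have hd : a'.degree = a.degree := by rw [degree_mapDomain_perm, degree_mapDomain_perm]
  obtain ⟨c', hc', hcb, hcd, hcs, hce⟩ := hS.exists_le_of_shift b _ a' rfl haS
    (hd.trans_le (hb.degree_le a ha)) fun j hj => (hle j).trans_eq (orbitDiff_spec hc hσ hj)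
  have hbc := hb.mem.2.2 hc' hcb
  have hs : sumSq a' = sumSq a := by rw [sumSq_mapDomain_perm, sumSq_mapDomain_perm]
  refine hab (hb.eq_of_shift ha (σ := 1) (c := c') (degree_le_of_le hbc) (by simpa using hbc)
    (hcd.trans hd) (hs ▸ hcs) fun h => ?_)
  obtain ⟨ρ, hρ⟩ := hce (h.trans hs.symm)
  exact ⟨ρ * σ.symm * τ, by rw [hρ, mapDomain_mapDomain_perm, mapDomain_mapDomain_perm]⟩

/-- The monomial `x_j x^b` is divisible by the shift `x_j x^b / x_l`, where `b l` is maximal. This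
shift lies in `S`, has the degree of `b` and a strictly smaller sum of squares, so the generator
below it is not `b`. -/
lemma raisedUp_subset (hb : IsLastGenerator S b) (hS : IsShiftedSet S) :
    raisedUp b ⊆ removeOrbit S b := by
  rintro c ⟨j, hj, σ, hσ⟩
  obtain ⟨l, -, hl⟩ := Finset.exists_max_image Finset.univ b ⟨j, Finset.mem_univ j⟩
  have htop : top b = b l := le_antisymm (Finset.sup_le hl) (le_top b l)
  obtain ⟨b', hb', -⟩ := exists_eq_add_single (a := b) (c := l) (t := 0) (by omega)
  have hlj : l ≠ j := by
    rintro rfl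
    omega
  have hbl : b l = b' l + 1 := by rw [hb']; simp
  have hbj : b j = b' j := by rw [hb']; simp [hlj]
  have hmem : b' + Finsupp.single j 1 ∈ S := by
    refine hS.shift (l := l) (hb' ▸ hb.mem.2.1) (fun i => ?_) (by omega)
    rw [← hb', ← hbl]
    exact hl i (Finset.mem_univ i)
  obtain ⟨a, ha, τ, hτ⟩ := hS.exists_generator hmem
  refine ⟨a, ha, ?_, σ * τ, ?_⟩
  · rintro rfl
    have h1 : a.mapDomain τ = b' + Finsupp.single j 1 := eq_of_le_of_degree_le hτ (by
      rw [degree_mapDomain_perm, hb', degree_add_single, degree_add_single])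
    have h2 : sumSq a = sumSq (b' + Finsupp.single j 1) := by rw [← h1, sumSq_mapDomain_perm]
    rw [hb', sumSq_add_single, sumSq_add_single] at h2
    omega
  · refine le_trans ?_ hσ
    rw [← mapDomain_mapDomain_perm]
    refine mapDomain_perm_le.2 fun i => ?_
    rw [mapDomain_perm_apply]
    refine (hτ i).trans ?_
    rw [hb']
    simp only [Finsupp.add_apply]
    omega

lemma eq_union (hb : IsLastGenerator S b) (hS : IsShiftedSet S) :
    S = removeOrbit S b ∪ orbitUp b := by
  ext c
  constructor
  · intro hc
    obtain ⟨a, ha, hca⟩ := hS.exists_generator hc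
    by_cases hab : a = b
    · exact Or.inr (hab ▸ hca)
    · exact Or.inl ⟨a, ha, hab, hca⟩
  · rintro (⟨a, ha, -, hca⟩ | hc)
    · exact hS.mem_of_mem_orbitUp ha.2.1 hca
    · exact hS.mem_of_mem_orbitUp hb.mem.2.1 hc

/-- Let a permuted generator `τ a` lie below `c + e_l`. Either it already lies below `c`, or its own
shift lies below `c + e_m`. A generator below that shift cannot be `b`, because `eq_of_shift` would
give `a = b`. -/
lemma isShiftedSet (hb : IsLastGenerator S b) (hS : IsShiftedSet S) :
    IsShiftedSet (removeOrbit S b) where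
  up := by
    rintro c c' ⟨a, ha, hab, hc⟩ hcc
    exact ⟨a, ha, hab, orbitUp_mono hc hcc⟩
  perm := by
    rintro c σ ⟨a, ha, hab, τ, hτ⟩
    refine ⟨a, ha, hab, σ * τ, ?_⟩
    rw [← mapDomain_mapDomain_perm]
    exact mapDomain_perm_le.2 fun j => by
      rw [mapDomain_perm_apply]
      exact hτ j
  shift := by
    rintro c l m ⟨a, ha, hab, τ, hτ⟩ hmax hml
    by_cases hal : a.mapDomain τ l ≤ c l
    · refine ⟨a, ha, hab, τ, le_trans (fun j => ?_) (le_self_add : c ≤ c + _)⟩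
      by_cases hj : j = l
      · exact hj ▸ hal
      · have := hτ j
        simpa [Ne.symm hj] using this
    · obtain ⟨a', ha', -⟩ := exists_eq_add_single (a := a.mapDomain τ) (c := l) (t := 0) (by omega)
      rw [ha'] at hτ
      have hac : a' ≤ c := by
        intro j
        have := hτ j
        simp only [Finsupp.add_apply] at this
        omega
      have hal' : a' l = c l := by
        rw [ha'] at hal
        simp only [Finsupp.add_apply, Finsupp.single_eq_same] at hal
        have := hac l
        omega
      have hml' : a' m ≤ a' l := hal' ▸ (hac m).trans hml
      have hmem : a' + Finsupp.single m 1 ∈ S := by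
        refine hS.shift (ha' ▸ hS.perm τ ha.2.1) (fun j => ?_) hml'
        rw [hal']
        exact (hτ j).trans (hmax j)
      obtain ⟨a₂, ha₂, hu⟩ := hS.exists_generator hmem
      have hsq := sumSq_shift hml'
      rw [← ha', sumSq_mapDomain_perm] at hsq
      refine ⟨a₂, ha₂, ?_, orbitUp_mono hu (add_le_add_left hac _)⟩
      rintro rfl
      obtain ⟨σ, hσ⟩ := hu
      refine hab (hb.eq_of_shift ha (σ := σ) (c := a' + Finsupp.single m 1) ?_ hσ ?_ hsq.1
        fun h => ?_)
      · rw [← degree_mapDomain_perm σ a₂]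
        exact degree_le_of_le hσ
      · rw [← degree_mapDomain_perm τ a, ha', degree_add_single, degree_add_single]
      · obtain ⟨ρ, hρ⟩ := hsq.2 h
        exact ⟨ρ * τ, by rw [hρ, mapDomain_mapDomain_perm]⟩

end IsLastGenerator

lemma generators_removeOrbit {S : Set (Fin n →₀ ℕ)} (hS : IsShiftedSet S)
    (b : Fin n →₀ ℕ) :
    generators (removeOrbit S b) = generators S \ {b} := by
  have hsub : removeOrbit S b ⊆ S := by
    rintro c ⟨a, ha, -, hca⟩
    exact hS.mem_of_mem_orbitUp ha.2.1 hca
  have hself : ∀ a : Fin n →₀ ℕ, a ∈ orbitUp a := fun a => ⟨1, by simp⟩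
  ext a
  constructor
  · rintro ⟨ha, ⟨a₀, ha₀, hab, σ, hσ⟩, hmin⟩
    have h1 : a₀.mapDomain σ ∈ removeOrbit S b := ⟨a₀, ha₀, hab, σ, le_rfl⟩
    have h2 : a₀.mapDomain σ = a := le_antisymm hσ (hmin h1 hσ)
    have h3 := eq_of_mapDomain_perm ha₀.1 ha h2
    exact h3 ▸ ⟨ha₀, hab⟩
  · rintro ⟨ha, hab⟩
    exact ⟨ha.1, ⟨a, ha, hab, hself a⟩, fun c hc hca => ha.2.2 (hsub hc) hca⟩

end ShiftedSets

/-! ## The filtration of a symmetric shifted ideal -/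

section Filtration

variable {k : Type u} [Field k] {n : ℕ}

/-- The exponents of the monomials in an ideal. -/
def expSet (I : Ideal (MvPolynomial (Fin n) k)) : Set (Fin n →₀ ℕ) :=
  {b | mon k b ∈ I}

lemma IsMonomialIdeal.mem_iff {I : Ideal (MvPolynomial (Fin n) k)} (hI : IsMonomialIdeal I)
    {f : MvPolynomial (Fin n) k} : f ∈ I ↔ ∀ b ∈ f.support, b ∈ expSet I := by
  obtain ⟨A, rfl⟩ := hI
  rw [mem_span_mon]
  exact forall₂_congr fun b _ => mon_mem_span_mon.symm

lemma partitionGenerators_eq (I : Ideal (MvPolynomial (Fin n) k)) :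
    partitionGenerators I = generators (expSet I) := by
  ext a
  exact ⟨fun h => ⟨h.1.1, h.2⟩, fun h => ⟨⟨h.1, h.2.1⟩, h.2⟩⟩

lemma IsSymmFixed.mapDomain_mem {I : Ideal (MvPolynomial (Fin n) k)} (hI : IsSymmFixed I)
    {a : Fin n →₀ ℕ} (σ : Equiv.Perm (Fin n)) (ha : a ∈ expSet I) :
    a.mapDomain σ ∈ expSet I := by
  have h := hI.rename_mem σ ha
  rwa [mon, rename_monomial] at h

/-- Sorting puts some index of maximal entry last. Exchanging it with `l`, which has the same entry,
leaves the sorted sequence unchanged. -/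
lemma exists_sorting_perm (c : Fin n →₀ ℕ) (l : Fin n) (hl : ∀ j, c j ≤ c l) :
    ∃ (σ : Equiv.Perm (Fin n)) (t : Fin n), (t : ℕ) + 1 = n ∧ σ l = t ∧
      IsPartition (c.mapDomain σ) := by
  have hn := l.pos
  let t : Fin n := ⟨n - 1, by omega⟩
  let τ := Tuple.sort c
  have hmono : Monotone (c ∘ τ) := Tuple.monotone_sort c
  have hle : τ.symm l ≤ t := by
    rw [Fin.le_def]
    simp only [t]
    omega
  have ht : c (τ t) = c l := by
    refine le_antisymm (hl _) ?_
    have := hmono hle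
    simpa using this
  have hc : ∀ j, c (τ (Equiv.swap (τ.symm l) t j)) = c (τ j) := by
    intro j
    by_cases h1 : j = τ.symm l
    · rw [h1, Equiv.swap_apply_left, ht, Equiv.apply_symm_apply]
    · by_cases h2 : j = t
      · rw [h2, Equiv.swap_apply_right, ht, Equiv.apply_symm_apply]
      · rw [Equiv.swap_apply_of_ne_of_ne h1 h2]
  refine ⟨(τ * Equiv.swap (τ.symm l) t).symm, t, by simp only [t]; omega, ?_, ?_⟩
  · rw [Equiv.symm_apply_eq, Equiv.Perm.mul_apply, Equiv.swap_apply_right,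
      Equiv.apply_symm_apply]
  · have : ⇑(c.mapDomain (τ * Equiv.swap (τ.symm l) t).symm) = c ∘ τ := by
      funext j
      rw [Finsupp.mapDomain_equiv_apply, Equiv.symm_symm]
      exact hc j
    rw [IsPartition, this]
    exact hmono

/-- The defining condition concerns partitions and the last index. A permutation that sorts the
exponent and sends the chosen maximal index to the end transfers it to arbitrary exponents. -/
lemma IsSymmetricShifted.isShiftedSet {I : Ideal (MvPolynomial (Fin n) k)}
    (hI : IsSymmetricShifted I) : IsShiftedSet (expSet I) where
  up := by
    rintro a b ha hab
    change mon k b ∈ I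
    have : mon k b = mon k (b - a) * mon k a := by
      rw [mon, mon, mon, monomial_mul, one_mul, tsub_add_cancel_of_le hab]
    rw [this]
    exact I.mul_mem_left _ ha
  perm σ ha := hI.fixed.mapDomain_mem σ ha
  shift := by
    rintro a l m hc hmax hml
    by_cases hlm : m = l
    · exact hlm ▸ hc
    have hcl : (a + Finsupp.single l 1 : Fin n →₀ ℕ) l = a l + 1 := by simp
    obtain ⟨σ, t, ht, hσ, hp⟩ := exists_sorting_perm (a + Finsupp.single l 1) l (hcl ▸ hmax)
    have h := hI.shifted _ ⟨hp, hI.fixed.mapDomain_mem σ hc⟩ (σ m) t ht (by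
      rw [← hσ, mapDomain_perm_apply, mapDomain_perm_apply, hcl]
      simp only [Finsupp.add_apply, Finsupp.single_apply, if_neg (Ne.symm hlm)]
      omega)
    rw [mapDomain_add_single, hσ, add_right_comm, add_tsub_cancel_right,
      ← mapDomain_add_single] at h
    have h' := hI.fixed.mapDomain_mem σ.symm h
    have e := mapDomain_symm_mapDomain σ.symm (a + Finsupp.single m 1)
    rw [Equiv.symm_symm] at e
    rwa [e] at h'

lemma IsShiftedSet.expSet_span {S : Set (Fin n →₀ ℕ)} (hS : IsShiftedSet S) :
    expSet (Ideal.span (mon k '' S)) = S := by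
  ext b
  refine mon_mem_span_mon.trans ⟨fun ⟨a, ha, hab⟩ => hS.up ha hab, fun h => ⟨b, h, le_rfl⟩⟩

lemma IsShiftedSet.isSymmetricShifted {S : Set (Fin n →₀ ℕ)} (hS : IsShiftedSet S) :
    IsSymmetricShifted (Ideal.span (mon k '' S)) where
  monomial := ⟨S, rfl⟩
  fixed σ := by
    rw [Ideal.map_span]
    congr 1
    ext g
    constructor
    · rintro ⟨_, ⟨a, ha, rfl⟩, rfl⟩
      exact ⟨_, hS.perm σ ha, (rename_monomial σ a 1).symm⟩
    · rintro ⟨a, ha, rfl⟩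
      refine ⟨_, ⟨_, hS.perm σ.symm ha, rfl⟩, (rename_monomial σ _ 1).trans ?_⟩
      rw [mapDomain_symm_mapDomain]
      rfl
  shifted := by
    rintro a ⟨hp, ha⟩ m l hl hml
    have ha : a ∈ expSet (Ideal.span (mon k '' S)) := ha
    change _ ∈ expSet (Ideal.span (mon k '' S))
    rw [hS.expSet_span] at ha ⊢
    obtain ⟨a', rfl, -⟩ := exists_eq_add_single (a := a) (c := l) (t := 0) (by omega)
    rw [add_right_comm, add_tsub_cancel_right]
    have hlm : l ≠ m := by
      rintro rfl
      exact hml.false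
    refine hS.shift ha (fun j => ?_) ?_
    · have h1 : j ≤ l := by
        rw [Fin.le_def]
        omega
      have := hp h1
      simpa using this
    · simp only [Finsupp.add_apply, Finsupp.single_eq_same, Finsupp.single_apply,
        if_neg hlm] at hml
      omega

namespace EquivGradedHom

variable {M : EquivGradedModule.{u, v} k n} {N : EquivGradedModule.{u, w} k n}
  {P : EquivGradedModule.{u, v'} k n}

/-- The composition of homomorphisms of equivariant graded modules. -/
def comp (g : EquivGradedHom N P) (f : EquivGradedHom M N) : EquivGradedHom M P where
  toLin := g.toLin ∘ₗ f.toLin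
  map_ρ σ m := by
    rw [LinearMap.comp_apply, f.map_ρ, g.map_ρ]
    rfl
  map_mem j m hm := g.map_mem j _ (f.map_mem j m hm)

/-- The inverse of a bijective homomorphism of equivariant graded modules. -/
def inverse (f : EquivGradedHom M N) (hf : Function.Bijective f.toLin) : EquivGradedHom N M where
  toLin := (LinearEquiv.ofBijective f.toLin hf).symm
  map_ρ σ y := by
    obtain ⟨x, rfl⟩ := hf.2 y
    rw [← f.map_ρ]
    have h : ∀ x, (LinearEquiv.ofBijective f.toLin hf).symm (f.toLin x) = x := fun x =>
      (LinearEquiv.ofBijective f.toLin hf).symm_apply_apply x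
    exact (h _).trans (congrArg _ (h x).symm)
  map_mem j y hy := by
    obtain ⟨x, rfl⟩ := hf.2 y
    have h : ∀ x, (LinearEquiv.ofBijective f.toLin hf).symm (f.toLin x) = x := fun x =>
      (LinearEquiv.ofBijective f.toLin hf).symm_apply_apply x
    have hx : M.proj j x = x := hf.1 (by
      rw [f.map_proj, N.proj_of_mem j j hy, if_pos rfl])
    exact ((h x).trans hx.symm) ▸ M.proj_mem j x

lemma toLin_inverse (f : EquivGradedHom M N) (hf : Function.Bijective f.toLin) (y : N.carrier) :
    f.toLin ((f.inverse hf).toLin y) = y :=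
  (LinearEquiv.ofBijective f.toLin hf).apply_symm_apply y

end EquivGradedHom

/-! ### Equivariant maps between ideals and their quotients -/

section IdealHoms

variable {U V I J : Ideal (MvPolynomial (Fin n) k)} (hU : IsSymmFixed U) (hgU : IsGradedIdeal U)
  (hV : IsSymmFixed V) (hgV : IsGradedIdeal V) (hI : IsSymmFixed I) (hgI : IsGradedIdeal I)
  (hJ : IsSymmFixed J) (hgJ : IsGradedIdeal J)

/-- The inclusion of ideals. -/
def idealInclusion (h : U ≤ V) : EquivGradedHom (ofIdeal U hU hgU) (ofIdeal V hV hgV) where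
  toLin := Submodule.inclusion h
  map_ρ _ _ := rfl
  map_mem _ _ hm := hm

/-- The projection from an ideal to a quotient. -/
def idealMkQ (U V : Ideal (MvPolynomial (Fin n) k)) (hU : IsSymmFixed U) (hgU : IsGradedIdeal U)
    (hV : IsSymmFixed V) (hgV : IsGradedIdeal V) :
    EquivGradedHom (ofIdeal U hU hgU) (ofIdealQuotient U V hU hgU hV hgV) where
  toLin := (relSub U V).mkQ
  map_ρ _ _ := rfl
  map_mem _ m hm := ⟨m, hm, rfl⟩

/-- The map between quotients of ideals induced by inclusions. -/
def quotientInclusion (h : U ≤ I) (h' : V ≤ J) :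
    EquivGradedHom (ofIdealQuotient U V hU hgU hV hgV) (ofIdealQuotient I J hI hgI hJ hgJ) where
  toLin := Submodule.mapQ (relSub U V) (relSub I J) (Submodule.inclusion h) fun _ hx => h' hx
  map_ρ σ y := by
    obtain ⟨x, rfl⟩ := (relSub U V).mkQ_surjective y
    rfl
  map_mem := by
    rintro j _ ⟨x, hx, rfl⟩
    exact ⟨Submodule.inclusion h x, hx, rfl⟩

/-- The second isomorphism theorem: the hypotheses say `U ∩ J = V` and `I = U + J`. -/
lemma quotientInclusion_bijective (h : U ≤ I) (h' : V ≤ J) (hinf : U ⊓ J ≤ V) (hsup : I ≤ J ⊔ U) :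
    Function.Bijective (quotientInclusion hU hgU hV hgV hI hgI hJ hgJ h h').toLin := by
  constructor
  · refine (injective_iff_map_eq_zero _).2 fun y hy => ?_
    obtain ⟨x, rfl⟩ := (relSub U V).mkQ_surjective y
    have hx : x.1 ∈ J := (Submodule.Quotient.mk_eq_zero (relSub I J)).1 hy
    exact (Submodule.Quotient.mk_eq_zero (relSub U V)).2 (hinf ⟨x.2, hx⟩)
  · intro y
    obtain ⟨⟨x, hx⟩, rfl⟩ := (relSub I J).mkQ_surjective y
    obtain ⟨a, ha, b, hb, rfl⟩ := Submodule.mem_sup.1 (hsup hx)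
    refine ⟨(relSub U V).mkQ ⟨b, hb⟩, (Submodule.Quotient.eq (relSub I J)).2 ?_⟩
    change b - (a + b) ∈ J
    rw [sub_add_cancel_right]
    exact J.neg_mem ha

end IdealHoms

/-- The short exact sequence obtained by removing the last generator of a symmetric shifted
ideal. -/
lemma IsSymmetricShifted.exists_exact {I : Ideal (MvPolynomial (Fin n) k)}
    (hI : IsSymmetricShifted I) {b : Fin n →₀ ℕ} (hb : IsLastGenerator (expSet I) b) :
    ∃ (J : Ideal (MvPolynomial (Fin n) k)) (hJ : IsSymmetricShifted J)
      (f : EquivGradedHom hJ.toModule hI.toModule) (g : EquivGradedHom hI.toModule (Nmod k b)),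
      partitionGenerators J = partitionGenerators I \ {b} ∧
      OpModule.IsShortExact hJ.toModule.toOp hI.toModule.toOp (Nmod k b).toOp f.lin g.lin := by
  have hS := hI.isShiftedSet
  have hS' := hb.isShiftedSet hS
  let J := Ideal.span (mon k '' removeOrbit (expSet I) b)
  have hJ : IsSymmetricShifted J := hS'.isSymmetricShifted
  have hexp : expSet J = removeOrbit (expSet I) b := hS'.expSet_span
  have hmemJ : ∀ {f}, f ∈ J ↔ ∀ c ∈ f.support, c ∈ removeOrbit (expSet I) b := by
    intro f
    rw [hJ.monomial.mem_iff, hexp]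
  have hJI : J ≤ I := fun f hf => hI.monomial.mem_iff.2 fun c hc => by
    rw [hb.eq_union hS]
    exact Or.inl (hmemJ.1 hf c hc)
  have hUI : orbitIdeal (mon k '' {b}) ≤ I := fun f hf => hI.monomial.mem_iff.2 fun c hc => by
    rw [hb.eq_union hS]
    exact Or.inr (mem_orbitIdeal_singleton.1 hf c hc)
  have hVJ : orbitIdeal (mon k '' raised b) ≤ J := fun f hf => hmemJ.2 fun c hc =>
    hb.raisedUp_subset hS ((mem_orbitIdeal_raised hb.mem.1).1 hf c hc)
  have hinf : orbitIdeal (mon k '' {b}) ⊓ J ≤ orbitIdeal (mon k '' raised b) := fun f hf =>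
    (mem_orbitIdeal_raised hb.mem.1).2 fun c hc =>
      hb.orbitUp_inter_subset hS ⟨mem_orbitIdeal_singleton.1 hf.1 c hc, hmemJ.1 hf.2 c hc⟩
  have hsup : I ≤ J ⊔ orbitIdeal (mon k '' {b}) := by
    intro f hf
    rw [f.as_sum]
    refine Submodule.sum_mem _ fun c hc => ?_
    have hc' := hI.monomial.mem_iff.1 hf c hc
    have hmon : mon k c ∈ J ⊔ orbitIdeal (mon k '' {b}) := by
      have hsupp : ∀ c' ∈ (mon k c).support, c' = c := fun c' h =>
        Finset.mem_singleton.1 (support_monomial_subset h)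
      rw [hb.eq_union hS] at hc'
      rcases hc' with h | h
      · exact Ideal.mem_sup_left (hmemJ.2 fun c' h' => hsupp c' h' ▸ h)
      · exact Ideal.mem_sup_right (mem_orbitIdeal_singleton.2 fun c' h' => hsupp c' h' ▸ h)
    have : MvPolynomial.monomial c (coeff c f) = C (coeff c f) * mon k c := by
      rw [mon, C_mul_monomial, mul_one]
    rw [this]
    exact Ideal.mul_mem_left _ _ hmon
  -- The numerator of `N^b` together with `J` spans `I` and meets `J` in the denominator, so `N^b ≅
  -- I / J`.
  have hbij := quotientInclusion_bijective (orbitIdeal_symm _) (orbitIdeal_graded _)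
    (orbitIdeal_symm _) (orbitIdeal_graded _) hI.fixed hI.monomial.isGraded hJ.fixed
    hJ.monomial.isGraded hUI hVJ hinf hsup
  let e := (quotientInclusion (orbitIdeal_symm _) (orbitIdeal_graded _)
    (orbitIdeal_symm _) (orbitIdeal_graded _) hI.fixed hI.monomial.isGraded hJ.fixed
    hJ.monomial.isGraded hUI hVJ)
  let g := (e.inverse hbij).comp (idealMkQ I J hI.fixed hI.monomial.isGraded hJ.fixed
    hJ.monomial.isGraded)
  have hg : ∀ x, e.toLin (g.toLin x) = (relSub I J).mkQ x := fun x => e.toLin_inverse hbij _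
  refine ⟨J, hJ, idealInclusion hJ.fixed hJ.monomial.isGraded hI.fixed hI.monomial.isGraded hJI,
    g, ?_, EquivGradedHom.isShortExact _ _ (Submodule.inclusion_injective hJI) ?_ ?_⟩
  · rw [partitionGenerators_eq, partitionGenerators_eq, hexp, generators_removeOrbit hS]
  · intro x
    have h0 : (relSub I J).mkQ x = 0 ↔ x.1 ∈ J := Submodule.Quotient.mk_eq_zero (relSub I J)
    have h1 : g.toLin x = 0 ↔ x.1 ∈ J := Iff.trans ⟨fun h =>
      (hg x).symm.trans ((congrArg e.toLin h).trans (map_zero _)), fun h =>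
      hbij.1 ((hg x).trans (h.trans (map_zero e.toLin).symm))⟩ h0
    exact h1.trans ⟨fun h => ⟨⟨x.1, h⟩, rfl⟩, fun ⟨y, hy⟩ => hy ▸ y.2⟩
  · intro y
    obtain ⟨x, hx⟩ := (relSub I J).mkQ_surjective (e.toLin y)
    exact ⟨x, hbij.1 ((hg x).trans hx)⟩

end Filtration

/-! ### Splitting by averaging, and direct sums of representations -/

namespace RepIso

section Split

variable {k : Type*} [Field k] {G : Type*} [Group G]
  {K : Subgroup G}

section Monoid

variable {X : Type*} [AddCommMonoid X] [Module k X] {Y : Type*} [AddCommMonoid Y] [Module k Y]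
  {X' : Type*} [AddCommMonoid X'] [Module k X'] {Y' : Type*} [AddCommMonoid Y'] [Module k Y']
  {ρX : Representation k G X} {ρY : Representation k G Y} {ρX' : Representation k G X'}
  {ρY' : Representation k G Y'}

lemma of_subsingleton [Subsingleton X] [Subsingleton Y] : RepIso K ρX ρY :=
  ⟨LinearEquiv.ofBijective 0 ⟨fun _ _ _ => Subsingleton.elim _ _,
    fun _ => ⟨0, Subsingleton.elim _ _⟩⟩, fun _ _ _ => Subsingleton.elim _ _⟩

lemma subsingleton [Subsingleton Y] (h : RepIso K ρX ρY) : Subsingleton X :=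
  h.choose.toEquiv.subsingleton

lemma of_bijective (f : X →ₗ[k] Y) (hf : Function.Bijective f)
    (h : ∀ σ ∈ K, ∀ x, f (ρX σ x) = ρY σ (f x)) : RepIso K ρX ρY :=
  ⟨LinearEquiv.ofBijective f hf, h⟩

lemma prodCongr (h : RepIso K ρX ρX') (h' : RepIso K ρY ρY') :
    RepIso K (ρX.prod ρY) (ρX'.prod ρY') := by
  obtain ⟨e, he⟩ := h
  obtain ⟨e', he'⟩ := h'
  exact ⟨e.prodCongr e', fun σ hσ x => Prod.ext (he σ hσ x.1) (he' σ hσ x.2)⟩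

end Monoid

variable {X : Type*} [AddCommGroup X] [Module k X] {Y : Type*} [AddCommGroup Y] [Module k Y]
  {Z : Type*} [AddCommGroup Z] [Module k Z]
  {ρX : Representation k G X} {ρY : Representation k G Y} {ρZ : Representation k G Z}

/-- An equivariant retraction, by averaging over a group of invertible order. -/
lemma exists_equivariant_retraction [Finite K] (hK : (Nat.card K : k) ≠ 0) (f : X →ₗ[k] Y)
    (hf : Function.Injective f) (h : ∀ σ ∈ K, ∀ x, f (ρX σ x) = ρY σ (f x)) :
    ∃ r : Y →ₗ[k] X, (∀ x, r (f x) = x) ∧ ∀ σ ∈ K, ∀ y, r (ρY σ y) = ρX σ (r y) := by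
  have := Fintype.ofFinite K
  obtain ⟨r, hr⟩ := f.exists_leftInverse_of_injective (LinearMap.ker_eq_bot.2 hf)
  let s : Y →ₗ[k] X := (Nat.card K : k)⁻¹ • ∑ σ : K, ρX σ ∘ₗ r ∘ₗ ρY (σ⁻¹ : K)
  have hs : ∀ y, s y = (Nat.card K : k)⁻¹ • ∑ σ : K, ρX σ (r (ρY (σ⁻¹ : K) y)) := fun y => by
    simp only [s, LinearMap.smul_apply, LinearMap.sum_apply, LinearMap.comp_apply]
  refine ⟨s, fun x => ?_, fun σ hσ y => ?_⟩
  · have : ∀ σ : K, ρX σ (r (ρY (σ⁻¹ : K) (f x))) = x := fun σ => by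
      rw [← h _ (σ⁻¹).2, ← LinearMap.comp_apply r f, hr, LinearMap.id_apply, ← Module.End.mul_apply,
        ← map_mul, ← Subgroup.coe_mul, mul_inv_cancel, Subgroup.coe_one, map_one,
        Module.End.one_apply]
    rw [hs, Finset.sum_congr rfl fun σ _ => this σ, Finset.sum_const, Finset.card_univ,
      ← Nat.card_eq_fintype_card, ← Nat.cast_smul_eq_nsmul k, smul_smul, inv_mul_cancel₀ hK,
      one_smul]
  · rw [hs, hs, map_smul, map_sum]
    congr 1
    refine (Fintype.sum_equiv (Equiv.mulLeft (⟨σ, hσ⟩ : K)) _ _ fun τ => ?_).symm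
    have e : ((τ⁻¹ * (⟨σ, hσ⟩ : K)⁻¹ : K) : G) * σ = (τ⁻¹ : K) := by simp
    rw [Equiv.coe_mulLeft, mul_inv_rev, ← Module.End.mul_apply, ← Module.End.mul_apply,
      ← map_mul, ← map_mul, e]
    rfl

/-- Equivariant short exact sequences split over a group of invertible order. -/
lemma of_exact [Finite K] (hK : (Nat.card K : k) ≠ 0) (f : X →ₗ[k] Y) (g : Y →ₗ[k] Z)
    (hf : Function.Injective f) (hfg : Function.Exact f g) (hg : Function.Surjective g)
    (hfσ : ∀ σ ∈ K, ∀ x, f (ρX σ x) = ρY σ (f x))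
    (hgσ : ∀ σ ∈ K, ∀ y, g (ρY σ y) = ρZ σ (g y)) :
    RepIso K ρY (ρX.prod ρZ) := by
  obtain ⟨r, hr, hrσ⟩ := exists_equivariant_retraction hK f hf hfσ
  refine of_bijective (r.prod g) ⟨?_, ?_⟩ fun σ hσ y => Prod.ext (hrσ σ hσ y) (hgσ σ hσ y)
  · refine (injective_iff_map_eq_zero _).2 fun y hy => ?_
    obtain ⟨x, rfl⟩ := (hfg y).1 (congrArg Prod.snd hy)
    have : x = 0 := (hr x).symm.trans (congrArg Prod.fst hy)
    rw [this, map_zero]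
  · rintro ⟨x, z⟩
    obtain ⟨y, rfl⟩ := hg z
    have h0 : ∀ x, g (f x) = 0 := fun x => (hfg _).2 ⟨x, rfl⟩
    refine ⟨y + f (x - r y), Prod.ext ?_ ?_⟩
    · change r _ = x
      rw [map_add, hr, add_sub_cancel]
    · change g _ = g y
      rw [map_add, h0, add_zero]

end Split

section DirectSum

variable {k : Type*} [Field k] {G : Type*} [Group G] {ι : Type*} {X : ι → Type*}
  [∀ a, AddCommMonoid (X a)] [∀ a, Module k (X a)] {Y : ι → Type*}
  [∀ a, AddCommMonoid (Y a)] [∀ a, Module k (Y a)] {K : Subgroup G}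

lemma directSum_congr {ρ : ∀ a, Representation k G (X a)} {ρ' : ∀ a, Representation k G (Y a)}
    (h : ∀ a, RepIso K (ρ a) (ρ' a)) :
    RepIso K (Representation.directSum ρ) (Representation.directSum ρ') := by
  choose e he using h
  refine ⟨DirectSum.congrLinearEquiv e, fun σ hσ x => ?_⟩
  rw [DirectSum.coe_congrLinearEquiv]
  refine DFinsupp.ext fun a => ?_
  exact he a σ hσ (x a)

lemma directSum_of_iff (ρ : ∀ a, Representation k G (X a)) {p q : ι → Prop}
    (h : ∀ a, p a ↔ q a) :
    RepIso K (Representation.directSum fun a : {a // p a} => ρ a.1)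
      (Representation.directSum fun a : {a // q a} => ρ a.1) := by
  obtain rfl : p = q := funext fun a => propext (h a)
  exact refl _ _

/-- Splitting off one summand. -/
lemma directSum_insert (ρ : ∀ a, Representation k G (X a)) {p q : ι → Prop} {b : ι}
    (h : ∀ a, p a ↔ q a ∨ a = b) (hb : ¬ q b) :
    RepIso K (Representation.directSum fun a : {a // p a} => ρ a.1)
      ((Representation.directSum fun a : {a // q a} => ρ a.1).prod (ρ b)) := by
  classical
  let t : {a // q a} → {a // p a} := fun a => ⟨a.1, (h a.1).2 (Or.inl a.2)⟩
  have ht : Function.Injective t := fun a a' e => Subtype.ext (congrArg (fun c => c.1) e)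
  let b' : {a // p a} := ⟨b, (h b).2 (Or.inr rfl)⟩
  let F : (⨁ a : {a // p a}, X a.1) →ₗ[k] (⨁ a : {a // q a}, X a.1) × X b :=
    { toFun := fun x => (DFinsupp.comapDomain t ht x, x b')
      map_add' := fun x y => Prod.ext (DFinsupp.comapDomain_add t ht x y) rfl
      map_smul' := fun c x => Prod.ext (DFinsupp.comapDomain_smul t ht c x) rfl }
  have hF1 : ∀ x a, (F x).1 a = x (t a) := fun x a => DFinsupp.comapDomain_apply t ht x a
  refine of_bijective F ⟨?_, ?_⟩ fun σ _ x => ?_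
  · refine fun x y hxy => DFinsupp.ext fun a => ?_
    obtain ⟨a, ha⟩ := a
    rcases (h a).1 ha with hq | rfl
    · exact (hF1 x ⟨a, hq⟩).symm.trans ((by rw [hxy] : _ = (F y).1 _).trans (hF1 y ⟨a, hq⟩))
    · exact congrArg Prod.snd hxy
  · rintro ⟨y, v⟩
    -- `E` includes the summands other than `b`, so that `F ∘ E` is the inclusion of the first
    -- factor.
    let E : (⨁ a : {a // q a}, X a.1) →ₗ[k] ⨁ a : {a // p a}, X a.1 :=
      DirectSum.toModule k _ _ fun a => DirectSum.lof k _ (fun a : {a // p a} => X a.1) (t a)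
    have hE : F ∘ₗ E = LinearMap.inl k _ _ := by
      refine DirectSum.linearMap_ext k fun a => LinearMap.ext fun x => ?_
      simp only [LinearMap.comp_apply, E, DirectSum.toModule_lof]
      refine Prod.ext (DFinsupp.comapDomain_single (β := fun a : {a // p a} => X a.1) t ht a x) ?_
      refine DFinsupp.single_eq_of_ne fun e => hb ?_
      have : b = a.1 := congrArg Subtype.val e
      exact this ▸ a.2
    refine ⟨E y + DirectSum.lof k _ (fun a : {a // p a} => X a.1) b' v, ?_⟩
    rw [map_add, ← LinearMap.comp_apply F E, hE]
    refine Prod.ext ?_ ?_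
    · refine Eq.trans (congrArg (y + ·) ?_) (add_zero y)
      refine DFinsupp.ext fun a => (hF1 _ a).trans ?_
      refine DFinsupp.single_eq_of_ne fun e => hb ?_
      have : a.1 = b := congrArg Subtype.val e
      exact this ▸ a.2
    · change 0 + _ = v
      rw [zero_add]
      exact DFinsupp.single_eq_same
  · exact Prod.ext (DFinsupp.ext fun a => (hF1 _ a).trans
      (congrArg (ρ a.1 σ) (hF1 x a).symm)) rfl

end DirectSum

end RepIso

/-! ## Koszul homology of symmetric shifted ideals -/

section KoszulSequence

variable {k : Type u} [Field k] {n : ℕ} {A : EquivGradedModule.{u, v} k n}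
  {B : EquivGradedModule.{u, w} k n} {C : EquivGradedModule.{u, v'} k n}

lemma EquivGradedModule.vanishes_iff {i : ℕ} {z : ℤ} :
    A.toOp.Vanishes i z ↔ Subsingleton (A.KoszulHomology i z) := by
  rw [Submodule.Quotient.subsingleton_iff, Submodule.comap_subtype_eq_top]
  rfl

namespace EquivGradedHom

/-- The map induced on Koszul homology. -/
def koszulMap (f : EquivGradedHom A B) (i : ℕ) (z : ℤ) :
    A.KoszulHomology i z →ₗ[k] B.KoszulHomology i z :=
  Submodule.mapQ _ _ (LinearMap.restrict (p := A.toOp.cycles i z) (q := B.toOp.cycles i z)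
    { toFun := fun c => f.lin.compAlternatingMap c
      map_add' := comp_add_chain f.lin
      map_smul' := comp_smul_chain f.lin } fun _ hc => f.isHom.comp_mem_cycles hc)
    fun _ hc => f.isHom.comp_mem_boundaries hc

lemma koszulMap_rep (f : EquivGradedHom A B) (i : ℕ) (z : ℤ) (σ : Equiv.Perm (Fin n))
    (x : A.KoszulHomology i z) :
    f.koszulMap i z (A.koszulRep i z σ x) = B.koszulRep i z σ (f.koszulMap i z x) := by
  obtain ⟨⟨c, hc⟩, rfl⟩ := Submodule.mkQ_surjective _ x
  exact congrArg (Submodule.mkQ _) (Subtype.ext (f.comp_chainRep i σ c))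

end EquivGradedHom

variable {f : EquivGradedHom A B} {g : EquivGradedHom B C}

namespace OpModule.IsShortExact

lemma koszulMap_injective (h : IsShortExact A.toOp B.toOp C.toOp f.lin g.lin) {i : ℕ} {z : ℤ}
    (hC : C.toOp.Vanishes (i + 1) (z - 1)) : Function.Injective (f.koszulMap i z) := by
  refine (injective_iff_map_eq_zero _).2 fun x hx => ?_
  obtain ⟨⟨c, hc⟩, rfl⟩ := Submodule.mkQ_surjective _ x
  exact (Subquot.mk_eq_zero hc).2 (h.boundaries_of_comp hC hc.2 ((Subquot.mk_eq_zero _).1 hx))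

lemma koszulMap_exact (h : IsShortExact A.toOp B.toOp C.toOp f.lin g.lin) (i : ℕ) (z : ℤ) :
    Function.Exact (f.koszulMap i z) (g.koszulMap i z) := by
  intro x
  constructor
  · obtain ⟨⟨c, hc⟩, rfl⟩ := Submodule.mkQ_surjective _ x
    intro hx
    obtain ⟨a, ha, hab⟩ := h.exact_middle hc ((Subquot.mk_eq_zero _).1 hx)
    refine ⟨Subquot.mk _ _ a ha, Eq.symm ?_⟩
    exact (Submodule.Quotient.eq _).2 hab
  · rintro ⟨y, rfl⟩
    obtain ⟨⟨c, hc⟩, rfl⟩ := Submodule.mkQ_surjective _ y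
    refine (Subquot.mk_eq_zero _).2 ?_
    change g.lin.compAlternatingMap (f.lin.compAlternatingMap c) ∈ C.toOp.boundaries i z
    rw [h.comp_comp hc.2]
    exact zero_mem _

/-- The cokernel embeds in `H_{i-1}(A)_{z+1}`. The quantified form of `hA` asks for nothing when `i
= 0`. -/
lemma koszulMap_surjective (h : IsShortExact A.toOp B.toOp C.toOp f.lin g.lin) {i : ℕ} {z : ℤ}
    (hA : ∀ j, j + 1 = i → A.toOp.Vanishes j (z + 1)) :
    Function.Surjective (g.koszulMap i z) := by
  intro x
  obtain ⟨⟨c, hc⟩, rfl⟩ := Submodule.mkQ_surjective _ x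
  obtain ⟨b, hb, rfl⟩ : ∃ b ∈ B.toOp.cycles i z, g.lin.compAlternatingMap b = c := by
    cases i with
    | zero => exact h.exists_cycle_lift_zero hc
    | succ i => exact h.exists_cycle_lift (hA i rfl) hc
  exact ⟨Subquot.mk _ _ b hb, rfl⟩

end OpModule.IsShortExact

end KoszulSequence

/-! ### Induction on the number of generators -/

section Decomposition

variable {k : Type u} [Field k] {n : ℕ}

lemma IsSymmetricShifted.eq_bot {I : Ideal (MvPolynomial (Fin n) k)} (hI : IsSymmetricShifted I)
    (h : partitionGenerators I = ∅) : I = ⊥ := by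
  refine (Submodule.eq_bot_iff _).2 fun f hf => ?_
  rw [← support_eq_empty, Finset.eq_empty_iff_forall_notMem]
  intro b hb
  obtain ⟨a, ha, -⟩ := hI.isShiftedSet.exists_generator (hI.monomial.mem_iff.1 hf b hb)
  rw [← partitionGenerators_eq, h] at ha
  exact ha

/-- The Koszul homology of a symmetric shifted ideal, as a representation of a group of
permutations of invertible order. -/
theorem IsSymmetricShifted.koszul_decomposition (K : Subgroup (Equiv.Perm (Fin n)))
    (hK : (Nat.card K : k) ≠ 0) (N : ℕ) : ∀ {I : Ideal (MvPolynomial (Fin n) k)}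
    (hI : IsSymmetricShifted I), (partitionGenerators I).ncard = N → ∀ i d : ℕ,
    RepIso K (hI.toModule.koszulRep i d) (Representation.directSum
      fun a : {a // a ∈ partitionGenerators I ∧ a.degree = d} =>
        (Nmod k a.1).koszulRep i d) := by
  induction N with
  | zero =>
    intro I hI hN i d
    have hfin : (partitionGenerators I).Finite := partitionGenerators_eq I ▸ generators_finite _
    have h0 := (Set.ncard_eq_zero hfin).1 hN
    have : IsEmpty {a // a ∈ partitionGenerators I ∧ a.degree = d} :=
      ⟨fun a => by simpa [h0] using a.2.1⟩
    have : Subsingleton (hI.toModule.KoszulHomology i d) :=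
      EquivGradedModule.vanishes_iff.1 (OpModule.vanishes_of_eq_zero _ _ _ fun x _ =>
        Subtype.ext ((Submodule.eq_bot_iff I).1 (hI.eq_bot h0) x.1 x.2))
    have : Subsingleton (⨁ a : {a // a ∈ partitionGenerators I ∧ a.degree = d},
        (Nmod k a.1).KoszulHomology i d) := DFinsupp.uniqueOfIsEmpty.instSubsingleton
    exact RepIso.of_subsingleton
  | succ N ih =>
    intro I hI hN i d
    have hfin : (partitionGenerators I).Finite := partitionGenerators_eq I ▸ generators_finite _
    have hne : (partitionGenerators I).Nonempty := by
      rw [← Set.ncard_pos hfin]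
      omega
    obtain ⟨b, hb⟩ := exists_isLastGenerator (partitionGenerators_eq I ▸ hne)
    obtain ⟨J, hJ, f, g, hgen, hex⟩ := hI.exists_exact hb
    have hbI : b ∈ partitionGenerators I := partitionGenerators_eq I ▸ hb.mem
    have hN' : (partitionGenerators J).ncard = N := by
      rw [hgen, Set.ncard_sdiff_singleton_of_mem hbI]
      omega
    -- By induction the homology of `J` lives in the degrees of its generators, none of which
    -- exceeds the degree of `b`.
    have hvan : ∀ i, hJ.toModule.toOp.Vanishes i ((b.degree + 1 : ℕ) : ℤ) := fun i => by
      have : IsEmpty {a // a ∈ partitionGenerators J ∧ a.degree = b.degree + 1} := by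
        refine ⟨fun ⟨a, ha, hd⟩ => ?_⟩
        rw [hgen, partitionGenerators_eq] at ha
        have := hb.degree_le a ha.1
        omega
      have : Subsingleton (⨁ a : {a // a ∈ partitionGenerators J ∧ a.degree = b.degree + 1},
        (Nmod k a.1).KoszulHomology i (b.degree + 1 : ℕ)) :=
          DFinsupp.uniqueOfIsEmpty.instSubsingleton
      exact EquivGradedModule.vanishes_iff.2 (ih hJ hN' i (b.degree + 1)).subsingleton
    -- The kernel is the image of `H_{i+1}(N^b)_{d-1}`, which is zero unless `d = |b| + 1`; in that
    -- degree the source is already zero.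
    have hinj : Function.Injective (f.koszulMap i d) := by
      by_cases hd : d = b.degree + 1
      · subst hd
        have := EquivGradedModule.vanishes_iff.1 (hvan i)
        exact Function.injective_of_subsingleton _
      · exact hex.koszulMap_injective (Nmod_vanishes hb.mem.1 _ (by omega))
    -- The target is zero unless `d = |b|`, and then the obstruction lies in the homology of `J` in
    -- degree `|b| + 1`.
    have hsurj : Function.Surjective (g.koszulMap i d) := by
      by_cases hd : d = b.degree
      · subst hd
        exact hex.koszulMap_surjective fun j _ => hvan j
      · have := EquivGradedModule.vanishes_iff.1
          (Nmod_vanishes (k := k) hb.mem.1 i (z := d) (by omega))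
        exact Function.surjective_to_subsingleton _
    have hsplit : RepIso K (hI.toModule.koszulRep i d)
        ((hJ.toModule.koszulRep i d).prod ((Nmod k b).koszulRep i d)) :=
      RepIso.of_exact hK (f.koszulMap i d) (g.koszulMap i d) hinj (hex.koszulMap_exact i d) hsurj
        (fun σ _ => f.koszulMap_rep i d σ) fun σ _ => g.koszulMap_rep i d σ
    refine (hsplit.trans (RepIso.prodCongr (ih hJ hN' i d) (RepIso.refl _ _))).trans ?_
    -- In degree `|b|` the factor of `N^b` is the new summand; in all other degrees it is zero and
    -- the index set does not change.
    by_cases hd : d = b.degree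
    · refine (RepIso.directSum_insert (fun a => (Nmod k a).koszulRep i d) (fun a => ?_) ?_).symm
      · rw [hgen]
        by_cases hab : a = b
        · simp [hab, hbI, hd]
        · simp [hab]
      · simp [hgen]
    · have := EquivGradedModule.vanishes_iff.1
        (Nmod_vanishes (k := k) hb.mem.1 i (z := d) (by omega))
      refine RepIso.trans (RepIso.of_bijective (LinearMap.fst k _ _) ⟨fun x y h => ?_,
        Prod.fst_surjective⟩ fun _ _ _ => rfl) (RepIso.directSum_of_iff
          (fun a => (Nmod k a).koszulRep i d) fun a => ?_)
      · exact Prod.ext h (Subsingleton.elim _ _)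
      · rw [hgen]
        constructor
        · exact fun h => ⟨h.1.1, h.2⟩
        · rintro ⟨h1, h2⟩
          refine ⟨⟨h1, ?_⟩, h2⟩
          rintro rfl
          exact hd h2.symm

end Decomposition

/-! ## `Tor` of the quotients `N^λ` -/

section Tor

variable {k : Type u} [Field k] {n : ℕ} {M : EquivGradedModule.{u, v} k n}

namespace EquivFreeResolution

variable (R : EquivFreeResolution.{u, v, w} M)

/-- The subspace `𝔪 F_i` is homogeneous and the differential has degree zero, so components of
cycles are cycles. -/
lemma proj_mem_liftCycles {i : ℕ} (j : ℕ) {x : (R.F i).carrier}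
    (hx : (R.F i).mSub.mkQ x ∈ R.cycles i) : (R.F i).proj j x ∈ R.liftCycles i j := by
  cases i with
  | zero => exact R.mem_liftCycles_zero.2 ((R.F 0).proj_mem j x)
  | succ i =>
    refine R.mem_liftCycles_succ.2 ⟨(R.F (i + 1)).proj_mem j x, ?_⟩
    have h : (R.d i).toLin x ∈ (R.F i).mSub := (Submodule.Quotient.mk_eq_zero _).1 hx
    rw [(R.d i).map_proj]
    obtain ⟨c, hc⟩ := EquivGradedModule.exists_of_mem_mSub h
    have : (R.F i).proj j ((R.d i).toLin x) =
        ∑ l, (X l : MvPolynomial (Fin n) k) • (R.F i).projZ (j - 1) (c l) := by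
      change (R.F i).projZ j _ = _
      rw [hc, map_sum]
      exact Finset.sum_congr rfl fun l _ => (R.F i).projZ_X_smul' l j (c l)
    rw [this]
    exact EquivGradedModule.sum_X_smul_mem_mSub _

lemma torDeg_eq_top {i j : ℕ} (h : ∀ j', j' ≠ j → R.torDeg i j' = ⊥) : R.torDeg i j = ⊤ := by
  refine Submodule.eq_top_iff'.2 fun y => ?_
  obtain ⟨⟨x, hx⟩, rfl⟩ := Submodule.mkQ_surjective _ y
  obtain ⟨x, rfl⟩ := Submodule.mkQ_surjective _ x
  obtain ⟨s, hs⟩ := (R.F i).exists_sum_proj x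
  have hc : ∀ j', (R.F i).mSub.mkQ ((R.F i).proj j' x) ∈ R.cycles i := fun j' =>
    (R.proj_mem_liftCycles j' hx).2
  have hmem : ∀ j', Submodule.mkQ ((R.boundaries i).comap (R.cycles i).subtype)
      ⟨_, hc j'⟩ ∈ R.torDeg i j' := fun j' => ⟨_, ⟨_, (R.F i).proj_mem j' x, rfl⟩, rfl⟩
  have hsum : (⟨(R.F i).mSub.mkQ x, hx⟩ : R.cycles i) = ∑ j' ∈ s, ⟨_, hc j'⟩ := by
    apply Subtype.ext
    rw [AddSubmonoidClass.coe_finsetSum]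
    change (R.F i).mSub.mkQ x = ∑ j' ∈ s, (R.F i).mSub.mkQ _
    rw [← map_sum, hs s subset_rfl]
  rw [hsum, map_sum]
  refine Submodule.sum_mem _ fun j' _ => ?_
  by_cases hj : j' = j
  · exact hj ▸ hmem j'
  · have := hmem j'
    rw [h j' hj, Submodule.mem_bot] at this
    rw [this]
    exact zero_mem _

/-- When the Koszul homology is concentrated in one degree, so is `Tor`. -/
lemma torRep_iso_koszul (K : Subgroup (Equiv.Perm (Fin n))) (i d : ℕ)
    (h : ∀ z : ℤ, z ≠ d → M.toOp.Vanishes i z) : RepIso K (R.torRep i) (M.koszulRep i d) := by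
  have htop : R.torDeg i (i + d) = ⊤ := R.torDeg_eq_top fun j hj => by
    have := EquivGradedModule.vanishes_iff.1 (h (j - i) (by omega))
    rw [← Submodule.subsingleton_iff_eq_bot]
    -- Only vanishing matters here, so the trivial group suffices.
    exact (R.torDeg_iso_koszul ⊥ i j).subsingleton
  have h1 : RepIso K (R.torDegRep i (i + d)) (R.torRep i) :=
    RepIso.of_bijective (R.torDeg i (i + d)).subtype ⟨Subtype.val_injective, fun x =>
      ⟨⟨x, htop ▸ Submodule.mem_top⟩, rfl⟩⟩ fun _ _ _ => rfl
  have h2 := R.torDeg_iso_koszul K i (i + d)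
  rw [show ((i + d : ℕ) : ℤ) - i = d by push_cast; ring] at h2
  exact h1.symm.trans h2

end EquivFreeResolution

lemma IsSymmetricShifted.tor_decomposition {I : Ideal (MvPolynomial (Fin n) k)}
    (hI : IsSymmetricShifted I) (i d : ℕ) (F : EquivFreeResolution.{u, u, v} hI.toModule)
    (G : ∀ a : {a // a ∈ partitionGenerators I ∧ a.degree = d},
      EquivFreeResolution.{u, u, w} (Nmod k a.1))
    (K : Subgroup (Equiv.Perm (Fin n))) (hK : (Nat.card K : k) ≠ 0) :
    RepIso K (F.torDegRep i (i + d)) (Representation.directSum fun a => (G a).torRep i) := by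
  have h := F.torDeg_iso_koszul K i (i + d)
  rw [show ((i + d : ℕ) : ℤ) - i = d by push_cast; ring] at h
  refine (h.trans (hI.koszul_decomposition K hK _ rfl i d)).trans
    (RepIso.directSum_congr fun a => ?_)
  refine ((G a).torRep_iso_koszul K i d fun z hz => Nmod_vanishes a.2.1.1.1 i ?_).symm
  rw [a.2.2]
  exact hz

end Tor

end SymShifted

end

theorem theorem5p4 {k : Type u} [Field k] {n : ℕ} (I : Ideal (MvPolynomial (Fin n) k))
    (hI : SymShifted.IsSymmetricShifted I) (i d : ℕ)
    (F : SymShifted.EquivFreeResolution.{u, u, v} hI.toModule)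
    (G : ∀ a : {a // a ∈ SymShifted.partitionGenerators I ∧ a.degree = d},
      SymShifted.EquivFreeResolution.{u, u, w} (SymShifted.Nmod k a.1)) :
    (((n.factorial : ℕ) : k) ≠ 0 →
      Nonempty ((F.torDegRep i (i + d)).Equiv
        (Representation.directSum fun a => (G a).torRep i))) ∧
    Nonempty (F.torDeg i (i + d) ≃ₗ[k] ⨁ a, (G a).Tor i) := by
  constructor
  · intro hn
    -- The whole symmetric group has order `n!`.
    obtain ⟨e, he⟩ := hI.tor_decomposition i d F G ⊤ (by
      rwa [Subgroup.card_top, Nat.card_perm, Nat.card_fin])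
    exact ⟨Representation.Equiv.mk e fun σ => LinearMap.ext fun x => he σ trivial x⟩
  -- The trivial group has order one, which is nonzero in every field.
  · obtain ⟨e, -⟩ := hI.tor_decomposition i d F G ⊥ (by simp)
    exact ⟨e⟩
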